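/- Let $d\ge 2$, $T>0$, $0<\mu<1$, $\alpha>0$, and let $\mathbb T^d=\mathbb R^d/\mathbb Z^d$. Let $H:\mathbb T^d\times\mathbb R^d\to\mathbb R$, $H=H(x,p)$, be $C^\infty$ and satisfy the following conditions. 1. For every $x$ the map $p\mapsto H(x,p)$ is strictly convex, $\lim_{|p|\to\infty}H(x,p)/|p|=+\infty$, and $H\ge 1$. 2. There are $c,C>0$ with $D_pH(x,p)\cdot p-H(x,p)\ge cH(x,p)-C$ for all $x,p$. 3. There is $C$ with $|D_xH|,\,|D^2_{xx}H|\le CH+C$; and for every $\delta>0$ there is $C_\delta$ such that $\operatorname{tr}(D^2_{px}H\,M)\le\delta\operatorname{tr}(D^2_{pp}H\,M^2)+C_\delta H$ for every symmetric matrix $M$ and all $x,p$. 4. There is $C$ with $|D^2_{xp}H|^2\le C H^{\frac{2+2\mu}{2+\mu}}$ and $|D^2_{pp}H\,M|^2\le C H^{\frac{\mu}{2+\mu}}\operatorname{tr}(D^2_{pp}H\,M\,M)$ for every symmetric matrix $M$ and all $x,p$. Let $u_T,m_0\in C^\infty(\mathbb T^d)$ with $\int_{\mathbb T^d}m_0\,dx=1$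 and $m_0\ge\kappa_0$ for some constant $\kappa_0>0$. Let $\eta\in C_c^\infty(\mathbb R^d)$ be non-negative and symmetric, $\eta(-x)=\eta(x)$, with $\int\eta=1$; put $\eta_\epsilon(x)=\epsilon^{-d}\eta(x/\epsilon)$ and $g_\epsilon(m)=\eta_\epsilon*\big((\eta_\epsilon*m)^\alpha\big)$ for $\epsilon>0$, and $g_0(m)=m^\alpha$. Then for every $r$ with $$1\le r<\frac{d(1+\mu)}{d(1+\mu)-2}$$ there is a constant $C$ such that for every $\epsilon\ge 0$ and every $C^\infty$ solution $(u^\epsilon,m^\epsilon)$ on $\mathbb T^d\times[0,T]$ of $$\begin{cases}-u^\epsilon_t+H(x,Du^\epsilon)=\Delta u^\epsilon+g_\epsilon(m^\epsilon),\\ m^\epsilon_t-\operatorname{div}\big(D_pH(x,Du^\epsilon)\,m^\epsilon\big)=\Delta m^\epsilon,\end{cases}\qquad u^\epsilon(x,T)=u_T(x),\quad m^\epsilon(x,0)=m_0(x),$$ one has $$\sup_{0\le t\le T}\|m^\epsilon(\cdot,t)\|_{L^r(\mathbb T^d)}\le C .$$ That is, $m^\epsilon$ is bounded in $L^\infty(0,T;L^r(\mathbb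 T^d))$ uniformly in $\epsilon$. -/

import Mathlib

open Set Filter MeasureTheory
open scoped ContDiff

namespace MFG

noncomputable section

/-- The space `ℝ^d` with its Euclidean norm. -/
abbrev Sp (d : ℕ) : Type := EuclideanSpace ℝ (Fin d)

/-- The `i`-th vector of the standard basis of `ℝ^d`. -/
def stdVec {d : ℕ} (i : Fin d) : Sp d := EuclideanSpace.single i (1 : ℝ)

/-- Functions on the torus `𝕋^d = ℝ^d / ℤ^d` are functions on `ℝ^d` that are 1-periodic in each
coordinate. -/
def TorusPeriodic {d : ℕ} (f : Sp d → ℝ) : Prop :=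
  ∀ (i : Fin d) (x : Sp d), f (x + stdVec i) = f x

/-- The fundamental cell `[0,1]^d` of the torus. -/
def unitCell (d : ℕ) : Set (Sp d) := {x | ∀ i, x i ∈ Icc (0 : ℝ) 1}

/-- Lebesgue measure of the torus, carried by its fundamental cell. -/
def torusMeasure (d : ℕ) : Measure (Sp d) := volume.restrict (unitCell d)

/-- The partial derivative `∂_i f (x)`. -/
def pd {d : ℕ} (i : Fin d) (f : Sp d → ℝ) (x : Sp d) : ℝ := fderiv ℝ f x (stdVec i)

/-- The divergence `∑ i, ∂_i F_i` of a vector field. -/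
def divergence {d : ℕ} (F : Sp d → Sp d) (x : Sp d) : ℝ := ∑ i, pd i (fun y => F y i) x

/-! Derivatives of a Hamiltonian `H (x, p)`. -/

/-- `D_x H (x, p)`. -/
def DxH {d : ℕ} (H : Sp d → Sp d → ℝ) (x p : Sp d) : Sp d := gradient (fun y => H y p) x

/-- `D_p H (x, p)`. -/
def DpH {d : ℕ} (H : Sp d → Sp d → ℝ) (x p : Sp d) : Sp d := gradient (H x) p

/-- `D²_xx H (x, p)`, with entries `∂_{x_i} ∂_{x_j} H`. -/
def DxxH {d : ℕ} (H : Sp d → Sp d → ℝ) (x p : Sp d) : Matrix (Fin d) (Fin d) ℝ :=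
  Matrix.of fun i j => pd i (fun y => pd j (fun z => H z p) y) x

/-- `D²_pp H (x, p)`, with entries `∂_{p_i} ∂_{p_j} H`. -/
def DppH {d : ℕ} (H : Sp d → Sp d → ℝ) (x p : Sp d) : Matrix (Fin d) (Fin d) ℝ :=
  Matrix.of fun i j => pd i (fun q => pd j (H x) q) p

/-- `D²_px H (x, p)`, with entries `∂_{p_i} ∂_{x_j} H`. -/
def DpxH {d : ℕ} (H : Sp d → Sp d → ℝ) (x p : Sp d) : Matrix (Fin d) (Fin d) ℝ :=
  Matrix.of fun i j => pd i (fun q => pd j (fun y => H y q) x) p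

/-- `D²_xp H (x, p)`, with entries `∂_{x_i} ∂_{p_j} H`. -/
def DxpH {d : ℕ} (H : Sp d → Sp d → ℝ) (x p : Sp d) : Matrix (Fin d) (Fin d) ℝ :=
  Matrix.of fun i j => pd i (fun y => pd j (H y) p) x

/-- The Euclidean (Frobenius) norm `|A| = (∑ A_ij²)^(1/2)` of a matrix. -/
def matNorm {d : ℕ} (A : Matrix (Fin d) (Fin d) ℝ) : ℝ := √(∑ i, ∑ j, A i j ^ 2)

/-! The assumptions on the data. -/

/-- `H : 𝕋^d × ℝ^d → ℝ` is smooth, strictly convex and coercive in `p`, and `H ≥ 1`. -/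
structure IsHamiltonian {d : ℕ} (H : Sp d → Sp d → ℝ) : Prop where
  periodic : ∀ p, TorusPeriodic (fun x => H x p)
  smooth : ContDiff ℝ ∞ (fun z : Sp d × Sp d => H z.1 z.2)
  strictConvex : ∀ x, StrictConvexOn ℝ univ (H x)
  coercive : ∀ x, Tendsto (fun p => H x p / ‖p‖) (Bornology.cobounded (Sp d)) atTop
  one_le : ∀ x p, 1 ≤ H x p

/-- `L̂ ≥ c H - C` for some `c, C > 0`, where `L̂ (x, p) = D_p H (x, p) · p - H (x, p)`. -/
def LagrangianBound {d : ℕ} (H : Sp d → Sp d → ℝ) : Prop :=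
  ∃ c C : ℝ, 0 < c ∧ 0 < C ∧ ∀ x p, c * H x p - C ≤ inner ℝ (DpH H x p) p - H x p

/-- `|D_x H|, |D²_xx H| ≤ C H + C`, and for every `δ > 0` there is `C_δ` with
`tr (D²_px H M) ≤ δ tr (D²_pp H M²) + C_δ H` for all symmetric `M`. -/
structure DerivativeBounds {d : ℕ} (H : Sp d → Sp d → ℝ) : Prop where
  x_bounds : ∃ C : ℝ, ∀ x p, ‖DxH H x p‖ ≤ C * H x p + C ∧ matNorm (DxxH H x p) ≤ C * H x p + C
  px_bound : ∀ δ : ℝ, 0 < δ → ∃ Cδ : ℝ, ∀ (x p : Sp d) (M : Matrix (Fin d) (Fin d) ℝ), M.IsSymm →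
    (DpxH H x p * M).trace ≤ δ * (DppH H x p * M ^ 2).trace + Cδ * H x p

/-- `|D²_xp H|² ≤ C H^((2+2μ)/(2+μ))`, and `|D²_pp H M|² ≤ C H^(μ/(2+μ)) tr (D²_pp H M M)` for all
symmetric `M`. -/
def SuperquadraticBounds {d : ℕ} (μ : ℝ) (H : Sp d → Sp d → ℝ) : Prop :=
  ∃ C : ℝ, ∀ x p : Sp d,
    matNorm (DxpH H x p) ^ 2 ≤ C * H x p ^ ((2 + 2 * μ) / (2 + μ)) ∧
    ∀ M : Matrix (Fin d) (Fin d) ℝ, M.IsSymm →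
      matNorm (DppH H x p * M) ^ 2 ≤ C * H x p ^ (μ / (2 + μ)) * (DppH H x p * M * M).trace

/-- The terminal value `u_T` and the initial density `m₀` are smooth on the torus, `m₀` is a
probability density, and `m₀ ≥ κ₀` for some `κ₀ > 0` (so that, in particular, `m₀ ≥ 0`). -/
structure IsData {d : ℕ} (uT m0 : Sp d → ℝ) : Prop where
  uT_periodic : TorusPeriodic uT
  uT_smooth : ContDiff ℝ ∞ uT
  m0_periodic : TorusPeriodic m0
  m0_smooth : ContDiff ℝ ∞ m0
  m0_mass : ∫ x, m0 x ∂(torusMeasure d) = 1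
  m0_lower : ∃ κ₀ : ℝ, 0 < κ₀ ∧ ∀ x, κ₀ ≤ m0 x

/-! Regularization of the coupling. -/

/-- A symmetric mollifier `η` on `ℝ^d`. -/
structure IsMollifier {d : ℕ} (η : Sp d → ℝ) : Prop where
  smooth : ContDiff ℝ ∞ η
  compactSupport : HasCompactSupport η
  nonneg : ∀ x, 0 ≤ η x
  symm : ∀ x, η (-x) = η x
  mass : ∫ x, η x = 1

/-- `η_ε * f`, where `η_ε (x) = ε^(-d) η (x / ε)`. After rescaling the variable of integration this
is `∫ η (y) f (x - ε y) dy`; for `ε = 0` this is `f (x)`, since `η` has mass one. -/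
def mollify {d : ℕ} (η : Sp d → ℝ) (ε : ℝ) (f : Sp d → ℝ) (x : Sp d) : ℝ :=
  ∫ y, η y * f (x - ε • y)

theorem mollify_zero {d : ℕ} {η : Sp d → ℝ} (hη : IsMollifier η) (f : Sp d → ℝ) :
    mollify η 0 f = f := by
  funext x
  simp [mollify, integral_mul_const, hη.mass]

theorem mollify_eq {d : ℕ} (η : Sp d → ℝ) {ε : ℝ} (hε : 0 < ε) (f : Sp d → ℝ) (x : Sp d) :
    mollify η ε f x = ∫ y, ((ε ^ d)⁻¹ * η (ε⁻¹ • y)) * f (x - y) := by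
  have h := Measure.integral_comp_inv_smul (volume : Measure (Sp d))
    (fun y => η y * f (x - ε • y)) ε
  have h2 : ∀ y : Sp d, ε • ε⁻¹ • y = y := fun y => smul_inv_smul₀ hε.ne' y
  simp only [h2, finrank_euclideanSpace, Fintype.card_fin, smul_eq_mul,
    abs_of_pos (pow_pos hε d)] at h
  simp only [mul_assoc, integral_const_mul]
  rw [h, inv_mul_cancel_left₀ (pow_pos hε d).ne']
  rfl

/-- The coupling `g_ε (m) = η_ε * g (η_ε * m)` with `g (z) = z ^ α`; `g_0 = g`. -/
def coupling {d : ℕ} (η : Sp d → ℝ) (α ε : ℝ) (m : Sp d → ℝ) : Sp d → ℝ :=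
  mollify η ε (fun y => mollify η ε m y ^ α)

/-- `(u, m)` is a smooth solution on `𝕋^d × [0,T]` of
`-u_t + H (x, Du) = Δu + g_ε (m)`, `m_t - div (D_p H (x, Du) m) = Δm`, `u(·,T) = u_T`,
`m(·,0) = m₀`. The functions are written `u t x`, `m t x`; smoothness is up to `t = 0` and `t = T`,
and values for `t ∉ [0,T]` play no role. -/
structure IsSolution {d : ℕ} (T α : ℝ) (H : Sp d → Sp d → ℝ) (uT m0 : Sp d → ℝ)
    (η : Sp d → ℝ) (ε : ℝ) (u m : ℝ → Sp d → ℝ) : Prop where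
  u_periodic : ∀ t ∈ Icc 0 T, TorusPeriodic (u t)
  m_periodic : ∀ t ∈ Icc 0 T, TorusPeriodic (m t)
  u_smooth : ContDiffOn ℝ ∞ (fun z : ℝ × Sp d => u z.1 z.2) (Icc 0 T ×ˢ univ)
  m_smooth : ContDiffOn ℝ ∞ (fun z : ℝ × Sp d => m z.1 z.2) (Icc 0 T ×ˢ univ)
  hamilton_jacobi : ∀ t ∈ Ioo 0 T, ∀ x,
    -deriv (fun s => u s x) t + H x (gradient (u t) x)
      = Laplacian.laplacian (u t) x + coupling η α ε (m t) x
  fokker_planck : ∀ t ∈ Ioo 0 T, ∀ x,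
    deriv (fun s => m s x) t - divergence (fun y => m t y • DpH H y (gradient (u t) y)) x
      = Laplacian.laplacian (m t) x
  terminal : ∀ x, u T x = uT x
  initial : ∀ x, m 0 x = m0 x

end

end MFG

namespace MFG

/-! ### Integration over the torus -/

/-! The estimate is proved at the endpoint exponent R = d(1+μ)/(d(1+μ)-2); every r < R follows
because the torus has measure one. Put β = R - 1. Testing the Fokker–Planck equation with a multiple
of m^β (`IsSolution.integral_dt_rpow`) shows that ∫ m^(β+1) can grow only through β ∫ m^(β+1) div
D_pH(x,Du), while diffusion dissipates a multiple of ∫ |D m^((β+1)/2)|².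

The superquadratic bounds give |div D_pH(x,Du)|^s ≤ C (H + tr(D²_pp H (D²u)²)) with s = (2+μ)/(1+μ),
whose conjugate exponent is 2+μ (`exists_trace_bound`). Both terms on the right are integrable
against m in space-time, uniformly in ε. For H this is the duality between the two equations, closed
by an upper bound on u at time 0 (`first_order_estimates`). For the second term one applies Δ to the
Hamilton–Jacobi equation and tests with m (`second_order_estimate`). The coupling then contributes ∫
Dm · D g_ε(m), which is nonnegative because g_ε conjugates the increasing map z ↦ z^α by a
self-adjoint averaging (`integral_pd_coupling_nonneg`). Only this sign, the sign of g_ε and one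
duality bound (`integral_coupling_le`) are used, so no constant sees ε.

Let X be the space-time integral of m^(1+β(2+μ)). Hölder's inequality, in the form of an optimized
Young inequality, bounds sup_t ∫ m^(β+1) and the dissipation by B (X+1)^(1/(2+μ)) (`energy_bound`).
The Gagliardo–Nirenberg inequality for f = m^((β+1)/2) controls f^(2+4/d), and β is exactly the
value for which this power is m^(1+β(2+μ)). Hence X ≤ E (X+1)^γ with γ = (1+2/d)/(2+μ). Since d ≥ 2
and μ > 0, γ < 1, so X is bounded and with it sup_t ∫ m^R (`integral_rpow_bound`). -/

theorem isCompact_unitCell (d : ℕ) : IsCompact (unitCell d) := by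
  have h : unitCell d = (EuclideanSpace.equiv (Fin d) ℝ).symm '' (Set.pi univ fun _ => Icc (0 : ℝ) 1) := by
    ext x
    simp only [unitCell, mem_ofPred_eq, mem_image, mem_univ_pi]
    constructor
    · intro hx
      exact ⟨EuclideanSpace.equiv (Fin d) ℝ x, fun i => hx i, by simp⟩
    · rintro ⟨y, hy, rfl⟩ i
      exact hy i
  rw [h]
  exact (isCompact_univ_pi fun _ => isCompact_Icc).image (ContinuousLinearEquiv.continuous _)

theorem measurableSet_unitCell (d : ℕ) : MeasurableSet (unitCell d) :=
  (isCompact_unitCell d).measurableSet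

theorem volume_unitCell (d : ℕ) : volume (unitCell d) = 1 := by
  have h : unitCell d = (MeasurableEquiv.toLp 2 (Fin d → ℝ)).symm ⁻¹' (Icc 0 1) := by
    ext x
    simp only [unitCell, mem_ofPred_eq, mem_preimage, mem_Icc, Pi.le_def, ← forall_and]
    rfl
  rw [h, (EuclideanSpace.volume_preserving_symm_measurableEquiv_toLp (Fin d)).measure_preimage
    measurableSet_Icc.nullMeasurableSet, Real.volume_Icc_pi]
  simp

instance (d : ℕ) : IsProbabilityMeasure (torusMeasure d) :=
  ⟨by simp [torusMeasure, volume_unitCell]⟩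

theorem integrable_torus {d : ℕ} {f : Sp d → ℝ} (hf : Continuous f) :
    Integrable f (torusMeasure d) :=
  hf.continuousOn.integrableOn_compact (isCompact_unitCell d)

theorem ae_torus_mem (d : ℕ) : ∀ᵐ x ∂(torusMeasure d), x ∈ unitCell d :=
  ae_restrict_mem (measurableSet_unitCell d)

/-- The lattice basis of `ℝ^d`. -/
noncomputable def latticeBasis (d : ℕ) : Module.Basis (Fin d) ℝ (Sp d) :=
  (EuclideanSpace.basisFun (Fin d) ℝ).toBasis

theorem latticeBasis_apply {d : ℕ} (i : Fin d) : latticeBasis d i = stdVec i := by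
  simp [latticeBasis, stdVec]

theorem TorusPeriodic.add_lattice {d : ℕ} {f : Sp d → ℝ} (hf : TorusPeriodic f) {v : Sp d}
    (hv : v ∈ Submodule.span ℤ (Set.range (latticeBasis d))) (x : Sp d) : f (v + x) = f x := by
  rw [← Submodule.mem_toAddSubgroup, Submodule.span_int_eq_addSubgroupClosure] at hv
  induction hv using AddSubgroup.closure_induction generalizing x with
  | mem y hy =>
    obtain ⟨i, rfl⟩ := hy
    rw [latticeBasis_apply, add_comm]
    exact hf i x
  | zero => simp
  | add y z _ _ hy hz => rw [add_assoc, hy, hz]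
  | neg y _ hy => rw [← hy (-y + x)]; simp

/-- The representative is chosen before the function, so bounds and extrema found on the compact
cell pass to all of ℝ^d for several periodic functions at once. -/
theorem exists_mem_unitCell {d : ℕ} (x : Sp d) :
    ∃ y ∈ unitCell d, ∀ f : Sp d → ℝ, TorusPeriodic f → f x = f y := by
  obtain ⟨v, hv, -⟩ := ZSpan.exist_unique_vadd_mem_fundamentalDomain (latticeBasis d) x
  refine ⟨v +ᵥ x, fun i => ?_, fun f hf => ?_⟩
  · have := hv i
    simp only [latticeBasis, OrthonormalBasis.coe_toBasis_repr_apply,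
      EuclideanSpace.basisFun_repr] at this
    exact Ico_subset_Icc_self this
  · exact (hf.add_lattice v.2 x).symm

theorem TorusPeriodic.bounded {d : ℕ} {f : Sp d → ℝ} (hf : TorusPeriodic f) (hc : Continuous f) :
    ∃ C : ℝ, 0 ≤ C ∧ ∀ x, |f x| ≤ C := by
  obtain ⟨C, hC⟩ := (isCompact_unitCell d).exists_bound_of_continuousOn hc.continuousOn
  refine ⟨max C 0, le_max_right _ _, fun x => ?_⟩
  obtain ⟨y, hy, h⟩ := exists_mem_unitCell x
  rw [h f hf]
  exact (hC y hy).trans (le_max_left _ _)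

/-- Only faces of the cube are at stake, a null set; the theory of lattice fundamental domains thus
applies to `torusMeasure`. -/
theorem unitCell_ae_eq (d : ℕ) :
    unitCell d =ᵐ[volume] ZSpan.fundamentalDomain (latticeBasis d) := by
  have h1 : unitCell d = (MeasurableEquiv.toLp 2 (Fin d → ℝ)).symm ⁻¹' (Icc 0 1) := by
    ext x
    simp only [unitCell, mem_ofPred_eq, mem_preimage, mem_Icc, Pi.le_def, ← forall_and]
    rfl
  have h2 : ZSpan.fundamentalDomain (latticeBasis d) =
      (MeasurableEquiv.toLp 2 (Fin d → ℝ)).symm ⁻¹' (univ.pi fun _ => Ico 0 1) := by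
    ext x
    simp only [ZSpan.mem_fundamentalDomain, latticeBasis, OrthonormalBasis.coe_toBasis_repr_apply,
      EuclideanSpace.basisFun_repr, mem_preimage, mem_univ_pi]
    rfl
  rw [h1, h2]
  refine (EuclideanSpace.volume_preserving_symm_measurableEquiv_toLp
    (Fin d)).quasiMeasurePreserving.preimage_ae_eq ?_
  exact (Measure.univ_pi_Ico_ae_eq_Icc (μ := fun _ : Fin d => (volume : Measure ℝ))).symm

open scoped Pointwise in
-- A translate of a fundamental domain of ℤ^d is again one, and a lattice-invariant function has the
-- same integral over all of them.
theorem setIntegral_vadd_unitCell {d : ℕ} {f : Sp d → ℝ} (hf : TorusPeriodic f) (v : Sp d) :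
    ∫ x in v +ᵥ unitCell d, f x = ∫ x in unitCell d, f x := by
  have h0 : (v +ᵥ unitCell d : Set (Sp d)) =ᵐ[volume]
      (v +ᵥ ZSpan.fundamentalDomain (latticeBasis d) : Set (Sp d)) := by
    rw [← preimage_vadd_neg, ← preimage_vadd_neg]
    exact (measurePreserving_vadd (-v) (volume : Measure (Sp d))).quasiMeasurePreserving.preimage_ae_eq
      (unitCell_ae_eq d)
  rw [setIntegral_congr_set h0, setIntegral_congr_set (unitCell_ae_eq d)]
  have : Countable (Submodule.span ℤ (Set.range (latticeBasis d))).toAddSubgroup :=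
    inferInstanceAs (Countable (Submodule.span ℤ (Set.range (latticeBasis d))))
  have h1 := ZSpan.isAddFundamentalDomain' (latticeBasis d) (volume : Measure (Sp d))
  refine (h1.vadd_of_comm v).setIntegral_eq h1 fun g x => ?_
  exact hf.add_lattice g.2 x

open scoped Pointwise in
theorem integral_translate {d : ℕ} {f : Sp d → ℝ} (hf : TorusPeriodic f) (v : Sp d) :
    ∫ x, f (x + v) ∂(torusMeasure d) = ∫ x, f x ∂(torusMeasure d) := by
  rw [torusMeasure, ← setIntegral_vadd_unitCell hf v]
  have := (measurePreserving_add_right (volume : Measure (Sp d)) v).setIntegral_image_emb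
    (measurableEmbedding_addRight v) f (unitCell d)
  rw [← this]
  congr 2
  ext x
  simp only [image_add_right, mem_preimage, ← preimage_vadd_neg, vadd_eq_add]
  rw [add_comm]

/-! ### Partial derivatives and integration by parts on the torus. -/

theorem TorusPeriodic.pd {d : ℕ} {f : Sp d → ℝ} (hf : TorusPeriodic f) (i : Fin d) :
    TorusPeriodic (pd i f) := by
  intro j x
  have h : (fun y => f (y + stdVec j)) = f := funext fun y => hf j y
  unfold MFG.pd
  conv_rhs => rw [← h]
  rw [fderiv_comp_add_right]

theorem contDiff_pd {d : ℕ} {f : Sp d → ℝ} (hf : ContDiff ℝ ∞ f) (i : Fin d) :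
    ContDiff ℝ ∞ (pd i f) := by
  unfold pd
  exact (hf.fderiv_right (m := ∞) (by simp)).clm_apply contDiff_const

theorem hasDerivAt_pd {d : ℕ} {f : Sp d → ℝ} (hf : Differentiable ℝ f) (i : Fin d) (x : Sp d)
    (h : ℝ) : HasDerivAt (fun s : ℝ => f (x + s • stdVec i)) (pd i f (x + h • stdVec i)) h := by
  have h1 : HasDerivAt (fun s : ℝ => x + s • (stdVec i : Sp d)) (stdVec i) h := by
    simpa using ((hasDerivAt_id h).smul_const (stdVec i : Sp d)).const_add x
  exact (hf (x + h • stdVec i)).hasFDerivAt.comp_hasDerivAt h h1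

/-- By translation invariance ∫ f(x + s e_i) dx does not depend on s; differentiate under the
integral at s = 0. No boundary terms on the cell have to be matched. -/
theorem integral_pd {d : ℕ} {f : Sp d → ℝ} (hf : ContDiff ℝ ∞ f) (hp : TorusPeriodic f)
    (i : Fin d) : ∫ x, pd i f x ∂(torusMeasure d) = 0 := by
  obtain ⟨C, -, hC⟩ := (hp.pd i).bounded (contDiff_pd hf i).continuous
  have h := (hasDerivAt_integral_of_dominated_loc_of_deriv_le (μ := torusMeasure d)
    (F := fun (s : ℝ) x => f (x + s • stdVec i)) (F' := fun s x => pd i f (x + s • stdVec i))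
    (x₀ := 0) (s := univ) (bound := fun _ => C) univ_mem
    (Eventually.of_forall fun s => (hf.continuous.comp (by fun_prop)).aestronglyMeasurable)
    (integrable_torus (hf.continuous.comp (by fun_prop)))
    ((contDiff_pd hf i).continuous.comp (by fun_prop)).aestronglyMeasurable
    (ae_of_all _ fun x s _ => hC _) (integrable_const _)
    (ae_of_all _ fun x s _ => hasDerivAt_pd (hf.differentiable (by simp)) i x s)).2
  simp only [integral_translate hp, zero_smul, add_zero] at h
  exact h.unique (hasDerivAt_const _ _)

theorem pd_mul {d : ℕ} {f g : Sp d → ℝ} {x : Sp d} (hf : DifferentiableAt ℝ f x)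
    (hg : DifferentiableAt ℝ g x) (i : Fin d) :
    pd i (fun y => f y * g y) x = pd i f x * g x + f x * pd i g x := by
  unfold pd
  rw [fderiv_fun_mul hf hg]
  simp
  ring

theorem TorusPeriodic.mul {d : ℕ} {f g : Sp d → ℝ} (hf : TorusPeriodic f) (hg : TorusPeriodic g) :
    TorusPeriodic (fun x => f x * g x) := fun i x => by simp only [hf i x, hg i x]

theorem TorusPeriodic.add {d : ℕ} {f g : Sp d → ℝ} (hf : TorusPeriodic f) (hg : TorusPeriodic g) :
    TorusPeriodic (fun x => f x + g x) := fun i x => by simp only [hf i x, hg i x]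

theorem TorusPeriodic.comp {d : ℕ} {f : Sp d → ℝ} (hf : TorusPeriodic f) (φ : ℝ → ℝ) :
    TorusPeriodic (fun x => φ (f x)) := fun i x => by simp only [hf i x]

theorem TorusPeriodic.sum {d : ℕ} {ι : Type*} {s : Finset ι} {f : ι → Sp d → ℝ}
    (hf : ∀ i, TorusPeriodic (f i)) :
    TorusPeriodic (fun x => ∑ i ∈ s, f i x) :=
  fun i x => Finset.sum_congr rfl fun j _ => hf j i x

theorem integral_torus_add {d : ℕ} {f g : Sp d → ℝ} (hf : Continuous f) (hg : Continuous g) :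
    ∫ x, (f x + g x) ∂(torusMeasure d) =
      ∫ x, f x ∂(torusMeasure d) + ∫ x, g x ∂(torusMeasure d) :=
  integral_add (integrable_torus hf) (integrable_torus hg)

theorem integral_torus_sub {d : ℕ} {f g : Sp d → ℝ} (hf : Continuous f) (hg : Continuous g) :
    ∫ x, (f x - g x) ∂(torusMeasure d) =
      ∫ x, f x ∂(torusMeasure d) - ∫ x, g x ∂(torusMeasure d) :=
  integral_sub (integrable_torus hf) (integrable_torus hg)

theorem integral_torus_sum {d : ℕ} {ι : Type*} {s : Finset ι} {f : ι → Sp d → ℝ}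
    (hf : ∀ i, Continuous (f i)) :
    ∫ x, ∑ i ∈ s, f i x ∂(torusMeasure d) = ∑ i ∈ s, ∫ x, f i x ∂(torusMeasure d) :=
  integral_finsetSum _ fun i _ => integrable_torus (hf i)

/-- Integration by parts on the torus. -/
theorem integral_mul_pd {d : ℕ} {f g : Sp d → ℝ} (hf : ContDiff ℝ ∞ f) (hfp : TorusPeriodic f)
    (hg : ContDiff ℝ ∞ g) (hgp : TorusPeriodic g) (i : Fin d) :
    ∫ x, f x * pd i g x ∂(torusMeasure d) = - ∫ x, pd i f x * g x ∂(torusMeasure d) := by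
  have h := integral_pd (hf.mul hg) (hfp.mul hgp) i
  have h2 : ∀ x, pd i (fun y => f y * g y) x = pd i f x * g x + f x * pd i g x := fun x =>
    pd_mul (hf.differentiable (by simp) x) (hg.differentiable (by simp) x) i
  simp only [h2] at h
  have h3 := integral_torus_add (f := fun x => pd i f x * g x) (g := fun x => f x * pd i g x)
    ((contDiff_pd hf i).continuous.mul hg.continuous)
    (hf.continuous.mul (contDiff_pd hg i).continuous)
  rw [h3] at h
  linarith

theorem integral_torus_nonneg {d : ℕ} {f : Sp d → ℝ} (hf : ∀ x, 0 ≤ f x) :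
    0 ≤ ∫ x, f x ∂(torusMeasure d) := integral_nonneg hf

theorem integral_torus_mono {d : ℕ} {f g : Sp d → ℝ} (hf : Continuous f) (hg : Continuous g)
    (h : ∀ x, f x ≤ g x) : ∫ x, f x ∂(torusMeasure d) ≤ ∫ x, g x ∂(torusMeasure d) :=
  integral_mono (integrable_torus hf) (integrable_torus hg) h

end MFG

namespace MFG

/-! ### Calculus in the space variable -/

theorem fderiv_fderiv_apply_comm {E : Type*} [NormedAddCommGroup E] [NormedSpace ℝ E] {f : E → ℝ}
    {x : E} (hf : ContDiffAt ℝ ∞ f x) (v w : E) :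
    fderiv ℝ (fun y => fderiv ℝ f y v) x w = fderiv ℝ (fun y => fderiv ℝ f y w) x v := by
  have hd : DifferentiableAt ℝ (fderiv ℝ f) x :=
    (hf.fderiv_right (m := ∞) (by simp)).differentiableAt (by simp)
  have h : ∀ a b : E, fderiv ℝ (fun y => fderiv ℝ f y a) x b = fderiv ℝ (fderiv ℝ f) x b a := by
    intro a b
    rw [fderiv_clm_apply hd (differentiableAt_const a)]
    simp
  rw [h, h]
  exact (hf.isSymmSndFDerivAt (by
    simpa using (show ((2 : ℕ∞) : ℕ∞ω) ≤ ((⊤ : ℕ∞) : ℕ∞ω) from WithTop.coe_le_coe.2 le_top))).eq w v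

theorem pd_comm {d : ℕ} {f : Sp d → ℝ} (hf : ContDiff ℝ ∞ f) (i j : Fin d) (x : Sp d) :
    pd i (pd j f) x = pd j (pd i f) x :=
  fderiv_fderiv_apply_comm hf.contDiffAt (stdVec j) (stdVec i)

theorem gradient_apply {d : ℕ} (f : Sp d → ℝ) (x : Sp d) (i : Fin d) :
    gradient f x i = pd i f x := by
  have h : inner ℝ (gradient f x) (stdVec i) = fderiv ℝ f x (stdVec i) := by
    rw [gradient, InnerProductSpace.toDual_symm_apply]
  rw [pd, ← h, stdVec, EuclideanSpace.inner_single_right]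
  simp

theorem contDiff_gradient {d : ℕ} {f : Sp d → ℝ} (hf : ContDiff ℝ ∞ f) :
    ContDiff ℝ ∞ (gradient f) := by
  rw [contDiff_euclidean]
  intro i
  simp only [gradient_apply]
  exact contDiff_pd hf i

theorem gradient_periodic {d : ℕ} {f : Sp d → ℝ} (hf : TorusPeriodic f) (i : Fin d) (x : Sp d) :
    gradient f (x + stdVec i) = gradient f x := by
  ext j
  simp only [gradient_apply]
  exact hf.pd j i x

/-- The Laplacian as the sum of the pure second partial derivatives. -/
noncomputable def lap {d : ℕ} (f : Sp d → ℝ) (x : Sp d) : ℝ := ∑ i, pd i (pd i f) x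

theorem laplacian_eq_lap {d : ℕ} {f : Sp d → ℝ} (hf : ContDiff ℝ ∞ f) (x : Sp d) :
    Laplacian.laplacian f x = lap f x := by
  rw [InnerProductSpace.laplacian_eq_iteratedFDeriv_orthonormalBasis f
    (EuclideanSpace.basisFun (Fin d) ℝ)]
  refine Finset.sum_congr rfl fun i _ => ?_
  have hd : DifferentiableAt ℝ (fderiv ℝ f) x :=
    (hf.fderiv_right (m := ∞) (by simp)).differentiable (by simp) x
  unfold pd
  rw [fderiv_clm_apply hd (differentiableAt_const _), iteratedFDeriv_two_apply]
  simp [stdVec]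

theorem contDiff_lap {d : ℕ} {f : Sp d → ℝ} (hf : ContDiff ℝ ∞ f) : ContDiff ℝ ∞ (lap f) :=
  ContDiff.sum fun i _ => contDiff_pd (contDiff_pd hf i) i

theorem TorusPeriodic.lap {d : ℕ} {f : Sp d → ℝ} (hf : TorusPeriodic f) : TorusPeriodic (lap f) :=
  TorusPeriodic.sum fun i => (hf.pd i).pd i

/-- `∫ f Δg = - ∑ ∫ ∂_i f ∂_i g`. -/
theorem integral_mul_lap {d : ℕ} {f g : Sp d → ℝ} (hf : ContDiff ℝ ∞ f) (hfp : TorusPeriodic f)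
    (hg : ContDiff ℝ ∞ g) (hgp : TorusPeriodic g) :
    ∫ x, f x * lap g x ∂(torusMeasure d) =
      - ∫ x, ∑ i, pd i f x * pd i g x ∂(torusMeasure d) := by
  have h1 : ∀ x, f x * lap g x = ∑ i, f x * pd i (pd i g) x := fun x => Finset.mul_sum _ _ _
  simp only [h1]
  rw [integral_torus_sum (f := fun i x => f x * pd i (pd i g) x)
      fun i => hf.continuous.mul (contDiff_pd (contDiff_pd hg i) i).continuous,
    integral_torus_sum (f := fun i x => pd i f x * pd i g x)
      fun i => (contDiff_pd hf i).continuous.mul (contDiff_pd hg i).continuous,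
    ← Finset.sum_neg_distrib]
  exact Finset.sum_congr rfl fun i _ => integral_mul_pd hf hfp (contDiff_pd hg i) (hgp.pd i) i

theorem integral_mul_lap_comm {d : ℕ} {f g : Sp d → ℝ} (hf : ContDiff ℝ ∞ f)
    (hfp : TorusPeriodic f) (hg : ContDiff ℝ ∞ g) (hgp : TorusPeriodic g) :
    ∫ x, f x * lap g x ∂(torusMeasure d) = ∫ x, lap f x * g x ∂(torusMeasure d) := by
  have h : ∀ x, lap f x * g x = g x * lap f x := fun x => mul_comm _ _
  simp only [h]
  rw [integral_mul_lap hf hfp hg hgp, integral_mul_lap hg hgp hf hfp]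
  simp only [mul_comm]

theorem pd_add {d : ℕ} {f g : Sp d → ℝ} {x : Sp d} (hf : DifferentiableAt ℝ f x)
    (hg : DifferentiableAt ℝ g x) (i : Fin d) :
    pd i (fun y => f y + g y) x = pd i f x + pd i g x := by
  unfold pd
  rw [fderiv_fun_add hf hg]
  simp

theorem pd_sum {d : ℕ} {ι : Type*} {s : Finset ι} {f : ι → Sp d → ℝ} {x : Sp d}
    (hf : ∀ k, DifferentiableAt ℝ (f k) x) (i : Fin d) :
    pd i (fun y => ∑ k ∈ s, f k y) x = ∑ k ∈ s, pd i (f k) x := by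
  unfold pd
  rw [fderiv_fun_sum fun k _ => hf k]
  simp

theorem pd_comp {d : ℕ} {f : Sp d → ℝ} {φ : ℝ → ℝ} {φ' : ℝ} {x : Sp d}
    (hφ : HasDerivAt φ φ' (f x)) (hf : DifferentiableAt ℝ f x) (i : Fin d) :
    pd i (fun y => φ (f y)) x = φ' * pd i f x := by
  unfold pd
  have h := (hφ.hasFDerivAt.comp x hf.hasFDerivAt).fderiv
  change (fderiv ℝ (φ ∘ f) x) (stdVec i) = _
  rw [h]
  simp [mul_comm]

/-! ### Functions of position and momentum -/

/-- `K (x, p)` is smooth in both variables. -/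
def PhaseSmooth {d : ℕ} (K : Sp d → Sp d → ℝ) : Prop :=
  ContDiff ℝ ∞ (fun z : Sp d × Sp d => K z.1 z.2)

/-- `∂_{x_i} K`. -/
noncomputable def dx {d : ℕ} (i : Fin d) (K : Sp d → Sp d → ℝ) (x p : Sp d) : ℝ :=
  pd i (fun y => K y p) x

/-- `∂_{p_i} K`. -/
noncomputable def dp {d : ℕ} (i : Fin d) (K : Sp d → Sp d → ℝ) (x p : Sp d) : ℝ := pd i (K x) p

variable {d : ℕ} {K : Sp d → Sp d → ℝ}

/-- Expressing partial derivatives through the joint derivative reduces smoothness and the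
commutation of x- and p-derivatives to facts about one function on the product. -/
theorem dx_eq (hK : PhaseSmooth K) (i : Fin d) (x p : Sp d) :
    dx i K x p = fderiv ℝ (fun z : Sp d × Sp d => K z.1 z.2) (x, p) (stdVec i, 0) := by
  have h1 := (hK.differentiable (by simp) (x, p)).hasFDerivAt
  have h2 : HasFDerivAt (fun y : Sp d => (y, p)) (ContinuousLinearMap.inl ℝ (Sp d) (Sp d)) x :=
    hasFDerivAt_prodMk_left x p
  have h3 := (h1.comp x h2).fderiv
  unfold dx pd
  change fderiv ℝ ((fun z : Sp d × Sp d => K z.1 z.2) ∘ fun y => (y, p)) x _ = _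
  rw [h3]
  simp

theorem dp_eq (hK : PhaseSmooth K) (i : Fin d) (x p : Sp d) :
    dp i K x p = fderiv ℝ (fun z : Sp d × Sp d => K z.1 z.2) (x, p) (0, stdVec i) := by
  have h1 := (hK.differentiable (by simp) (x, p)).hasFDerivAt
  have h2 : HasFDerivAt (fun q : Sp d => (x, q)) (ContinuousLinearMap.inr ℝ (Sp d) (Sp d)) p :=
    hasFDerivAt_prodMk_right x p
  have h3 := (h1.comp p h2).fderiv
  unfold dp pd
  change fderiv ℝ ((fun z : Sp d × Sp d => K z.1 z.2) ∘ fun y => (x, y)) p _ = _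
  rw [h3]
  simp

theorem PhaseSmooth.dx (hK : PhaseSmooth K) (i : Fin d) : PhaseSmooth (dx i K) := by
  unfold PhaseSmooth
  simp only [dx_eq hK]
  exact (hK.fderiv_right (m := ∞) (by simp)).clm_apply contDiff_const

theorem PhaseSmooth.dp (hK : PhaseSmooth K) (i : Fin d) : PhaseSmooth (dp i K) := by
  unfold PhaseSmooth
  simp only [dp_eq hK]
  exact (hK.fderiv_right (m := ∞) (by simp)).clm_apply contDiff_const

theorem dx_dp_comm (hK : PhaseSmooth K) (i j : Fin d) (x p : Sp d) :
    dx i (dp j K) x p = dp j (dx i K) x p := by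
  rw [dx_eq (hK.dp j), dp_eq (hK.dx i)]
  simp only [dx_eq hK, dp_eq hK]
  exact fderiv_fderiv_apply_comm hK.contDiffAt _ _

theorem dp_periodic (hK : ∀ p, TorusPeriodic (fun x => K x p)) (i : Fin d) :
    ∀ p, TorusPeriodic (fun x => dp i K x p) := by
  intro p j x
  have : K (x + stdVec j) = K x := funext fun q => hK q j x
  simp only [dp, this]

theorem contDiff_along (hK : PhaseSmooth K) {f : Sp d → ℝ} (hf : ContDiff ℝ ∞ f) :
    ContDiff ℝ ∞ (fun x => K x (gradient f x)) :=
  ContDiff.comp (g := fun z : Sp d × Sp d => K z.1 z.2) hK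
    (contDiff_id.prodMk (contDiff_gradient hf))

theorem periodic_along (hK : ∀ p, TorusPeriodic (fun x => K x p)) {f : Sp d → ℝ}
    (hf : TorusPeriodic f) : TorusPeriodic (fun x => K x (gradient f x)) := fun i x => by
  simp only [gradient_periodic hf]
  exact hK _ i x

theorem clm_apply_eq_sum (L : Sp d →L[ℝ] ℝ) (v : Sp d) : L v = ∑ k, v k * L (stdVec k) := by
  conv_lhs => rw [← (EuclideanSpace.basisFun (Fin d) ℝ).sum_repr v]
  simp [stdVec]

theorem pd_along (hK : PhaseSmooth K) {f : Sp d → ℝ} (hf : ContDiff ℝ ∞ f) (i : Fin d)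
    (x : Sp d) :
    pd i (fun y => K y (gradient f y)) x = dx i K x (gradient f x) +
      ∑ k, dp k K x (gradient f x) * pd i (pd k f) x := by
  have h1 := (hK.differentiable (by simp) (x, gradient f x)).hasFDerivAt
  have hg := ((contDiff_gradient hf).differentiable (by simp) x).hasFDerivAt
  have h2 : HasFDerivAt (fun y : Sp d => (y, gradient f y)) _ x := (hasFDerivAt_id x).prodMk hg
  have h3 := (HasFDerivAt.comp x h1 h2).fderiv
  have h4 : ∀ k, fderiv ℝ (gradient f) x (stdVec i) k = pd i (pd k f) x := by
    intro k
    have h5 : HasFDerivAt (fun y => gradient f y k)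
        ((EuclideanSpace.proj k : Sp d →L[ℝ] ℝ).comp (fderiv ℝ (gradient f) x)) x :=
      (EuclideanSpace.proj k : Sp d →L[ℝ] ℝ).hasFDerivAt.comp x hg
    simp only [gradient_apply] at h5
    change _ = fderiv ℝ (pd k f) x (stdVec i)
    change HasFDerivAt (pd k f) _ x at h5
    rw [h5.fderiv]
    rfl
  unfold pd
  change fderiv ℝ ((fun z : Sp d × Sp d => K z.1 z.2) ∘ fun y => (y, gradient f y)) x _ = _
  rw [h3]
  simp only [ContinuousLinearMap.comp_apply, ContinuousLinearMap.prod_apply,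
    ContinuousLinearMap.id_apply]
  have h6 : ((stdVec i : Sp d), fderiv ℝ (gradient f) x (stdVec i)) =
      (stdVec i, 0) + (0, fderiv ℝ (gradient f) x (stdVec i)) := by simp
  rw [h6, map_add, dx_eq hK]
  congr 1
  have h7 := clm_apply_eq_sum ((fderiv ℝ (fun z : Sp d × Sp d => K z.1 z.2) (x, gradient f x)).comp
    (ContinuousLinearMap.inr ℝ (Sp d) (Sp d))) (fderiv ℝ (gradient f) x (stdVec i))
  simp only [ContinuousLinearMap.comp_apply, ContinuousLinearMap.inr_apply] at h7
  rw [h7]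
  refine Finset.sum_congr rfl fun k _ => ?_
  rw [h4, dp_eq hK, mul_comm]
  rfl

theorem inner_DpH (p q x : Sp d) : inner ℝ (DpH K x p) q = ∑ k, dp k K x p * q k := by
  simp only [DpH, PiLp.inner_apply, gradient_apply, dp]
  simp [mul_comm]

theorem DpH_apply (p x : Sp d) (k : Fin d) : DpH K x p k = dp k K x p := gradient_apply _ _ _

end MFG

namespace MFG

/-! ### Functions of time and space -/

/-- `F t x` is smooth on `[0,T] × ℝ^d`, up to the ends of the time interval. -/
def SmoothST {d : ℕ} (T : ℝ) (F : ℝ → Sp d → ℝ) : Prop :=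
  ContDiffOn ℝ ∞ (fun z : ℝ × Sp d => F z.1 z.2) (Icc 0 T ×ˢ univ)

/-- The time derivative on `[0,T]`, one-sided at the ends. -/
noncomputable def dt {d : ℕ} (T : ℝ) (F : ℝ → Sp d → ℝ) (t : ℝ) (x : Sp d) : ℝ :=
  fderivWithin ℝ (fun z : ℝ × Sp d => F z.1 z.2) (Icc 0 T ×ˢ univ) (t, x) (1, 0)

variable {d : ℕ} {T : ℝ} {F G : ℝ → Sp d → ℝ}

theorem uniqueDiffOn_cylinder (d : ℕ) (hT : 0 < T) :
    UniqueDiffOn ℝ (Icc 0 T ×ˢ univ : Set (ℝ × Sp d)) :=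
  (uniqueDiffOn_Icc hT).prod uniqueDiffOn_univ

theorem SmoothST.slice (hF : SmoothST T F) {t : ℝ} (ht : t ∈ Icc 0 T) : ContDiff ℝ ∞ (F t) := by
  rw [← contDiffOn_univ]
  exact hF.comp (g := fun z : ℝ × Sp d => F z.1 z.2) (f := fun x => (t, x))
    (contDiff_const.prodMk contDiff_id).contDiffOn fun x _ => ⟨ht, mem_univ _⟩

theorem SmoothST.add (hF : SmoothST T F) (hG : SmoothST T G) :
    SmoothST T (fun t x => F t x + G t x) := ContDiffOn.add hF hG

theorem SmoothST.sub (hF : SmoothST T F) (hG : SmoothST T G) :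
    SmoothST T (fun t x => F t x - G t x) := ContDiffOn.sub hF hG

theorem SmoothST.mul (hF : SmoothST T F) (hG : SmoothST T G) :
    SmoothST T (fun t x => F t x * G t x) := ContDiffOn.mul hF hG

theorem SmoothST.sum {ι : Type*} {s : Finset ι} {F : ι → ℝ → Sp d → ℝ}
    (hF : ∀ i, SmoothST T (F i)) : SmoothST T (fun t x => ∑ i ∈ s, F i t x) :=
  ContDiffOn.sum fun i _ => hF i

theorem SmoothST.space {f : Sp d → ℝ} (hf : ContDiff ℝ ∞ f) : SmoothST T (fun _ x => f x) :=
  (hf.comp contDiff_snd).contDiffOn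

theorem SmoothST.rpow_const (hF : SmoothST T F) (hpos : ∀ t ∈ Icc 0 T, ∀ x, 0 < F t x) (a : ℝ) :
    SmoothST T (fun t x => F t x ^ a) :=
  ContDiffOn.rpow_const_of_ne hF fun z hz => (hpos z.1 hz.1 z.2).ne'

theorem SmoothST.pd_eq (hF : SmoothST T F) {t : ℝ} (ht : t ∈ Icc 0 T) (x : Sp d)
    (i : Fin d) : pd i (F t) x =
      fderivWithin ℝ (fun z : ℝ × Sp d => F z.1 z.2) (Icc 0 T ×ˢ univ) (t, x) (0, stdVec i) := by
  have h1 := (hF.differentiableOn (by simp) (t, x) ⟨ht, mem_univ _⟩).hasFDerivWithinAt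
  have h2 : HasFDerivWithinAt (fun y : Sp d => (t, y)) (ContinuousLinearMap.inr ℝ ℝ (Sp d)) univ x :=
    (hasFDerivAt_prodMk_right t x).hasFDerivWithinAt
  have h3 := (h1.comp x h2 fun y _ => ⟨ht, mem_univ _⟩).hasFDerivAt univ_mem
  unfold pd
  change fderiv ℝ ((fun z : ℝ × Sp d => F z.1 z.2) ∘ fun y => (t, y)) x _ = _
  rw [h3.fderiv]
  simp

theorem SmoothST.pd (hT : 0 < T) (hF : SmoothST T F) (i : Fin d) :
    SmoothST T (fun t => pd i (F t)) := by
  have h : ContDiffOn ℝ ∞ (fun z : ℝ × Sp d => fderivWithin ℝ (fun z : ℝ × Sp d => F z.1 z.2)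
      (Icc 0 T ×ˢ univ) z (0, stdVec i)) (Icc 0 T ×ˢ univ) :=
    (ContDiffOn.fderivWithin hF (uniqueDiffOn_cylinder d hT) (m := ∞) (by simp)).clm_apply
      contDiffOn_const
  exact h.congr fun z hz => hF.pd_eq hz.1 z.2 i

theorem SmoothST.lap (hT : 0 < T) (hF : SmoothST T F) : SmoothST T (fun t => lap (F t)) :=
  SmoothST.sum fun i => (hF.pd hT i).pd hT i

theorem SmoothST.dt (hT : 0 < T) (hF : SmoothST T F) : SmoothST T (dt T F) :=
  (ContDiffOn.fderivWithin hF (uniqueDiffOn_cylinder d hT) (m := ∞) (by simp)).clm_apply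
    contDiffOn_const

theorem SmoothST.along {K : Sp d → Sp d → ℝ} (hK : PhaseSmooth K) (hT : 0 < T)
    (hF : SmoothST T F) : SmoothST T (fun t x => K x (gradient (F t) x)) := by
  have h : ContDiffOn ℝ ∞ (fun z : ℝ × Sp d => gradient (F z.1) z.2) (Icc 0 T ×ˢ univ) := by
    rw [contDiffOn_euclidean]
    intro i
    simp only [gradient_apply]
    exact hF.pd hT i
  exact ContDiff.comp_contDiffOn (g := fun z : Sp d × Sp d => K z.1 z.2) hK
    (contDiffOn_snd.prodMk h)

theorem cylinder_mem_nhds {t : ℝ} (ht : t ∈ Ioo 0 T) (x : Sp d) :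
    (Icc 0 T ×ˢ univ : Set (ℝ × Sp d)) ∈ nhds (t, x) :=
  prod_mem_nhds (Icc_mem_nhds ht.1 ht.2) univ_mem

theorem SmoothST.contDiffAt (hF : SmoothST T F) {t : ℝ} (ht : t ∈ Ioo 0 T) (x : Sp d) :
    ContDiffAt ℝ ∞ (fun z : ℝ × Sp d => F z.1 z.2) (t, x) :=
  ContDiffOn.contDiffAt hF (cylinder_mem_nhds ht x)

theorem dt_eq {t : ℝ} (ht : t ∈ Ioo 0 T) (x : Sp d) :
    dt T F t x = fderiv ℝ (fun z : ℝ × Sp d => F z.1 z.2) (t, x) (1, 0) := by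
  rw [dt, fderivWithin_of_mem_nhds (cylinder_mem_nhds ht x)]

theorem SmoothST.hasDerivAt (hF : SmoothST T F) {t : ℝ} (ht : t ∈ Ioo 0 T) (x : Sp d) :
    HasDerivAt (fun s => F s x) (MFG.dt T F t x) t := by
  rw [dt_eq ht]
  have h1 := ((hF.contDiffAt ht x).differentiableAt (by simp)).hasFDerivAt
  have h2 : HasDerivAt (fun s : ℝ => (s, x)) ((1 : ℝ), (0 : Sp d)) t :=
    (hasDerivAt_id t).prodMk (hasDerivAt_const t x)
  exact HasFDerivAt.comp_hasDerivAt t h1 h2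

theorem SmoothST.dt_mul (hF : SmoothST T F) (hG : SmoothST T G) {t : ℝ}
    (ht : t ∈ Ioo 0 T) (x : Sp d) :
    MFG.dt T (fun t x => F t x * G t x) t x =
      MFG.dt T F t x * G t x + F t x * MFG.dt T G t x :=
  ((hF.mul hG).hasDerivAt ht x).unique ((hF.hasDerivAt ht x).mul (hG.hasDerivAt ht x))

theorem dt_space (f : Sp d → ℝ) {t : ℝ} (ht : t ∈ Ioo 0 T) (x : Sp d)
    (hf : ContDiff ℝ ∞ f) : dt T (fun _ => f) t x = 0 :=
  ((SmoothST.space hf).hasDerivAt ht x).unique (hasDerivAt_const _ _)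

/-- Both sides are mixed second derivatives of one joint function, and at interior times the
derivative within the cylinder is the ordinary one. This is what allows Δ to be applied to the
Hamilton–Jacobi equation. -/
theorem SmoothST.dt_pd (hT : 0 < T) (hF : SmoothST T F) {t : ℝ} (ht : t ∈ Ioo 0 T) (x : Sp d)
    (i : Fin d) : MFG.dt T (fun t => MFG.pd i (F t)) t x = MFG.pd i (MFG.dt T F t) x := by
  have htt := Ioo_subset_Icc_self ht
  rw [dt_eq ht, (hF.dt hT).pd_eq htt, fderivWithin_of_mem_nhds (cylinder_mem_nhds ht x)]
  have hev : ∀ᶠ z : ℝ × Sp d in nhds (t, x), z.1 ∈ Ioo 0 T :=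
    continuousAt_fst (Ioo_mem_nhds ht.1 ht.2)
  have h1 : (fun z : ℝ × Sp d => MFG.pd i (F z.1) z.2) =ᶠ[nhds (t, x)] fun z =>
      fderiv ℝ (fun z : ℝ × Sp d => F z.1 z.2) z (0, stdVec i) := by
    filter_upwards [hev] with z hz
    rw [hF.pd_eq (Ioo_subset_Icc_self hz), fderivWithin_of_mem_nhds (cylinder_mem_nhds hz z.2)]
  have h2 : (fun z : ℝ × Sp d => MFG.dt T F z.1 z.2) =ᶠ[nhds (t, x)] fun z =>
      fderiv ℝ (fun z : ℝ × Sp d => F z.1 z.2) z (1, 0) := by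
    filter_upwards [hev] with z hz
    rw [dt_eq hz]
  rw [h1.fderiv_eq, h2.fderiv_eq]
  exact fderiv_fderiv_apply_comm (hF.contDiffAt ht x) _ _

theorem SmoothST.dt_lap (hT : 0 < T) (hF : SmoothST T F) {t : ℝ} (ht : t ∈ Ioo 0 T) (x : Sp d) :
    MFG.dt T (fun t => MFG.lap (F t)) t x = MFG.lap (MFG.dt T F t) x := by
  have h1 := (hF.lap hT).hasDerivAt ht x
  have h2 : HasDerivAt (fun s => MFG.lap (F s) x)
      (∑ i, MFG.dt T (fun t => MFG.pd i (MFG.pd i (F t))) t x) t :=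
    HasDerivAt.fun_sum fun i _ => ((hF.pd hT i).pd hT i).hasDerivAt ht x
  rw [h1.unique h2]
  refine Finset.sum_congr rfl fun i _ => ?_
  rw [(hF.pd hT i).dt_pd hT ht]
  congr 1
  funext y
  exact hF.dt_pd hT ht y i

theorem SmoothST.dt_periodic (hF : SmoothST T F) (hp : ∀ t ∈ Icc 0 T, TorusPeriodic (F t)) {t : ℝ}
    (ht : t ∈ Ioo 0 T) : TorusPeriodic (MFG.dt T F t) := by
  intro i x
  refine (hF.hasDerivAt ht (x + stdVec i)).unique ?_
  refine (hF.hasDerivAt ht x).congr_of_eventuallyEq ?_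
  filter_upwards [Ioo_mem_nhds ht.1 ht.2] with s hs
  exact hp s (Ioo_subset_Icc_self hs) i x

theorem SmoothST.exists_bound (hF : SmoothST T F) :
    ∃ C : ℝ, ∀ t ∈ Icc 0 T, ∀ x ∈ unitCell d, |F t x| ≤ C := by
  obtain ⟨C, hC⟩ := (isCompact_Icc (a := (0 : ℝ)) (b := T)).prod (isCompact_unitCell d)
    |>.exists_bound_of_continuousOn (hF.continuousOn.mono (prod_mono_right (subset_univ _)))
  exact ⟨C, fun t ht x hx => hC (t, x) ⟨ht, hx⟩⟩

theorem SmoothST.continuousOn_integral (hF : SmoothST T F) :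
    ContinuousOn (fun t => ∫ x, F t x ∂(torusMeasure d)) (Icc 0 T) := by
  obtain ⟨C, hC⟩ := hF.exists_bound
  refine continuousOn_of_dominated (bound := fun _ => C)
    (fun t ht => (hF.slice ht).continuous.aestronglyMeasurable) (fun t ht => ?_)
    (integrable_const _) (ae_of_all _ fun x => ?_)
  · filter_upwards [ae_torus_mem d] with x hx using hC t ht x hx
  · exact hF.continuousOn.comp (f := fun t => (t, x)) (by fun_prop) fun _ ht => ⟨ht, mem_univ _⟩

theorem SmoothST.hasDerivAt_integral (hT : 0 < T) (hF : SmoothST T F) {t : ℝ} (ht : t ∈ Ioo 0 T) :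
    HasDerivAt (fun t => ∫ x, F t x ∂(torusMeasure d)) (∫ x, MFG.dt T F t x ∂(torusMeasure d)) t := by
  obtain ⟨C, hC⟩ := (hF.dt hT).exists_bound
  have htt := Ioo_subset_Icc_self ht
  refine (hasDerivAt_integral_of_dominated_loc_of_deriv_le (μ := torusMeasure d)
    (s := Ioo 0 T) (bound := fun _ => C) (Ioo_mem_nhds ht.1 ht.2) ?_
    (integrable_torus (hF.slice htt).continuous)
    ((hF.dt hT).slice htt).continuous.aestronglyMeasurable ?_ (integrable_const _)
    (ae_of_all _ fun x s hs => hF.hasDerivAt hs x)).2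
  · filter_upwards [Ioo_mem_nhds ht.1 ht.2] with s hs
    exact (hF.slice (Ioo_subset_Icc_self hs)).continuous.aestronglyMeasurable
  · filter_upwards [ae_torus_mem d] with x hx s hs using hC s (Ioo_subset_Icc_self hs) x hx

/-- The space-time integral over `[0,τ] × 𝕋^d`. -/
noncomputable def stInt (d : ℕ) (τ : ℝ) (F : ℝ → Sp d → ℝ) : ℝ :=
  ∫ t in 0..τ, ∫ x, F t x ∂(torusMeasure d)

theorem SmoothST.intervalIntegrable (hF : SmoothST T F) {τ : ℝ} (hτ : τ ∈ Icc 0 T) :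
    IntervalIntegrable (fun t => ∫ x, F t x ∂(torusMeasure d)) volume 0 τ := by
  refine ContinuousOn.intervalIntegrable ?_
  rw [uIcc_of_le hτ.1]
  exact hF.continuousOn_integral.mono (Icc_subset_Icc_right hτ.2)

theorem SmoothST.stInt_dt (hT : 0 < T) (hF : SmoothST T F) {τ : ℝ} (hτ : τ ∈ Icc 0 T) :
    stInt d τ (MFG.dt T F) = ∫ x, F τ x ∂(torusMeasure d) - ∫ x, F 0 x ∂(torusMeasure d) :=
  intervalIntegral.integral_eq_sub_of_hasDerivAt_of_le hτ.1
    (hF.continuousOn_integral.mono (Icc_subset_Icc_right hτ.2))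
    (fun _ ht => hF.hasDerivAt_integral hT ⟨ht.1, ht.2.trans_le hτ.2⟩)
    ((hF.dt hT).intervalIntegrable hτ)

theorem SmoothST.stInt_add (hF : SmoothST T F) (hG : SmoothST T G) {τ : ℝ} (hτ : τ ∈ Icc 0 T) :
    stInt d τ (fun t x => F t x + G t x) = stInt d τ F + stInt d τ G := by
  unfold stInt
  rw [← intervalIntegral.integral_add (hF.intervalIntegrable hτ) (hG.intervalIntegrable hτ)]
  refine intervalIntegral.integral_congr fun t ht => ?_
  rw [uIcc_of_le hτ.1] at ht
  have htt : t ∈ Icc 0 T := ⟨ht.1, ht.2.trans hτ.2⟩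
  exact integral_torus_add (hF.slice htt).continuous (hG.slice htt).continuous

theorem stInt_const_mul (c τ : ℝ) : stInt d τ (fun t x => c * F t x) = c * stInt d τ F := by
  simp only [stInt, integral_const_mul, intervalIntegral.integral_const_mul]

theorem stInt_const (c τ : ℝ) : stInt d τ (fun _ _ => c) = τ * c := by
  simp [stInt]

/-- The comparison is asked only at interior times, because the equations hold only there, and only
after integration in x, because the estimates use integration by parts. -/
theorem stInt_mono (hF : SmoothST T F) (hG : SmoothST T G) {τ : ℝ} (hτ : τ ∈ Icc 0 T)
    (h : ∀ t ∈ Ioo 0 T, ∫ x, F t x ∂(torusMeasure d) ≤ ∫ x, G t x ∂(torusMeasure d)) :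
    stInt d τ F ≤ stInt d τ G :=
  intervalIntegral.integral_mono_on_of_le_Ioo hτ.1 (hF.intervalIntegrable hτ)
    (hG.intervalIntegrable hτ) fun t ht => h t ⟨ht.1, ht.2.trans_le hτ.2⟩

end MFG

namespace MFG

/-! ### Mollification and the coupling -/

section Mollify

variable {d : ℕ} {η : Sp d → ℝ} {ε : ℝ} {f g : Sp d → ℝ}

/-- On a compact domain, continuity in the parameter and Fubini are available even though f is
periodic and need not be integrable on ℝ^d. -/
theorem mollify_eq_setIntegral (η : Sp d → ℝ) (ε : ℝ) (f : Sp d → ℝ) (x : Sp d) :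
    mollify η ε f x = ∫ y in tsupport η, η y * f (x - ε • y) := by
  refine (setIntegral_eq_integral_of_forall_compl_eq_zero fun y hy => ?_).symm
  rw [image_eq_zero_of_notMem_tsupport hy, zero_mul]

/-- The symmetry of η enters here, as the source of the self-adjointness below. -/
theorem mollify_eq_add (hη : IsMollifier η) (ε : ℝ) (f : Sp d → ℝ) (x : Sp d) :
    mollify η ε f x = ∫ y in tsupport η, η y * f (x + ε • y) := by
  have h1 : ∫ y, η y * f (x + ε • y) = mollify η ε f x := by
    rw [← integral_neg_eq_self]
    simp [mollify, hη.symm, sub_eq_add_neg]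
  rw [← h1]
  refine (setIntegral_eq_integral_of_forall_compl_eq_zero fun y hy => ?_).symm
  rw [image_eq_zero_of_notMem_tsupport hy, zero_mul]

theorem continuous_mollify (hη : IsMollifier η) (ε : ℝ) (hf : Continuous f) :
    Continuous (mollify η ε f) := by
  have h : mollify η ε f = fun x => ∫ y in tsupport η, η y * f (x - ε • y) :=
    funext fun x => mollify_eq_setIntegral η ε f x
  rw [h]
  have hc := hη.smooth.continuous
  exact continuous_parametric_integral_of_continuous (f := fun x y => η y * f (x - ε • y))
    (by unfold Function.uncurry; fun_prop) hη.compactSupport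

theorem mollify_comp_add (η : Sp d → ℝ) (ε : ℝ) (f : Sp d → ℝ) (h x : Sp d) :
    mollify η ε (fun y => f (y + h)) x = mollify η ε f (x + h) := by
  simp only [mollify, sub_add_eq_add_sub]

theorem TorusPeriodic.mollify (hf : TorusPeriodic f) (η : Sp d → ℝ) (ε : ℝ) :
    TorusPeriodic (mollify η ε f) := by
  intro i x
  rw [← mollify_comp_add]
  simp only [hf i]

theorem mollify_nonneg (hη : IsMollifier η) (ε : ℝ) (hf : ∀ x, 0 ≤ f x) (x : Sp d) :
    0 ≤ mollify η ε f x :=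
  integral_nonneg fun y => mul_nonneg (hη.nonneg y) (hf _)

theorem integrable_mollifier (hη : IsMollifier η) : Integrable η :=
  hη.smooth.continuous.integrable_of_hasCompactSupport hη.compactSupport

theorem mollify_le (hη : IsMollifier η) (ε : ℝ) (hf : Continuous f) {S : ℝ} (hS : ∀ x, f x ≤ S)
    (x : Sp d) : mollify η ε f x ≤ S := by
  have hc := hη.smooth.continuous
  have h1 : ∫ y, η y * S = S := by rw [integral_mul_const, hη.mass, one_mul]
  rw [← h1]
  refine integral_mono ?_ ((integrable_mollifier hη).mul_const S) fun y =>
    mul_le_mul_of_nonneg_left (hS _) (hη.nonneg y)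
  exact Continuous.integrable_of_hasCompactSupport (by fun_prop) hη.compactSupport.mul_right

theorem integrable_prod_torus {K : Set (Sp d)} (hK : IsCompact K) {k : Sp d → Sp d → ℝ}
    (hk : Continuous (Function.uncurry k)) :
    Integrable (Function.uncurry k) ((torusMeasure d).prod (volume.restrict K)) := by
  rw [torusMeasure, Measure.prod_restrict]
  exact hk.continuousOn.integrableOn_compact ((isCompact_unitCell d).prod hK)

/-- Mollification is self-adjoint. -/
theorem integral_mul_mollify (hη : IsMollifier η) (ε : ℝ) (hf : Continuous f)
    (hfp : TorusPeriodic f) (hg : Continuous g) (hgp : TorusPeriodic g) :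
    ∫ x, f x * mollify η ε g x ∂(torusMeasure d) =
      ∫ x, mollify η ε f x * g x ∂(torusMeasure d) := by
  have hc := hη.smooth.continuous
  simp only [mollify_eq_setIntegral η ε g, mollify_eq_add hη ε f, ← integral_const_mul,
    ← integral_mul_const]
  rw [integral_integral_swap (integrable_prod_torus hη.compactSupport
      (by unfold Function.uncurry; fun_prop)),
    integral_integral_swap (integrable_prod_torus hη.compactSupport
      (by unfold Function.uncurry; fun_prop))]
  refine integral_congr_ae (ae_of_all _ fun y => ?_)
  have hp : TorusPeriodic fun x => f x * (η y * g (x - ε • y)) := by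
    intro i x
    simp only [hfp i x, add_sub_right_comm, hgp i]
  beta_reduce
  -- For fixed y, shifting x by εy moves the translation from g to f.
  rw [← integral_translate hp (ε • y)]
  refine integral_congr_ae (ae_of_all _ fun x => ?_)
  simp only [add_sub_cancel_right]
  ring

end Mollify

/-! ### Duality bound and weak monotonicity of the coupling. -/

section Coupling

variable {d : ℕ} {η : Sp d → ℝ} {α ε : ℝ} {m : Sp d → ℝ}

theorem continuous_mollify_rpow (hη : IsMollifier η) (hα : 0 < α) (ε : ℝ) (hm : Continuous m) :
    Continuous (fun x => mollify η ε m x ^ α) :=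
  (continuous_mollify hη ε hm).rpow_const fun _ => Or.inr hα.le

theorem periodic_mollify_rpow (η : Sp d → ℝ) (α ε : ℝ) (hm : TorusPeriodic m) :
    TorusPeriodic (fun x => mollify η ε m x ^ α) :=
  (hm.mollify η ε).comp fun z => z ^ α

theorem coupling_nonneg (hη : IsMollifier η) (α ε : ℝ) (hm : ∀ x, 0 ≤ m x) (x : Sp d) :
    0 ≤ coupling η α ε m x :=
  mollify_nonneg hη ε (fun y => Real.rpow_nonneg (mollify_nonneg hη ε hm y) α) x

/-- Split at a = δ⁻¹: below it the constant dominates, above it δa ≥ 1. -/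
theorem rpow_le_mul_add {a δ : ℝ} (ha : 0 ≤ a) (hδ : 0 < δ) (hα : 0 < α) :
    a ^ α ≤ δ * (a ^ α * a) + δ⁻¹ ^ α := by
  have h0 : 0 ≤ a ^ α := Real.rpow_nonneg ha α
  rcases le_total a δ⁻¹ with h | h
  · have := Real.rpow_le_rpow ha h hα.le
    have : 0 ≤ δ * (a ^ α * a) := by positivity
    linarith
  · have h1 : 1 ≤ δ * a := by
      have := mul_le_mul_of_nonneg_left h hδ.le
      rwa [mul_inv_cancel₀ hδ.ne'] at this
    have : 0 ≤ δ⁻¹ ^ α := by positivity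
    nlinarith

/-- The coupling, tested against a bounded density, is controlled by the coupling tested against
`m` itself. -/
theorem integral_coupling_le (hη : IsMollifier η) (hα : 0 < α) (ε : ℝ) (hm : Continuous m)
    (hmp : TorusPeriodic m) (hm0 : ∀ x, 0 ≤ m x) {ν : Sp d → ℝ} (hν : Continuous ν)
    (hνp : TorusPeriodic ν) (hν0 : ∀ x, 0 ≤ ν x) {S δ : ℝ} (hδ : 0 < δ) (hS : ∀ x, ν x ≤ S) :
    ∫ x, coupling η α ε m x * ν x ∂(torusMeasure d) ≤
      S * δ * ∫ x, coupling η α ε m x * m x ∂(torusMeasure d) + S * δ⁻¹ ^ α := by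
  have hF := continuous_mollify_rpow hη hα ε hm
  have hFp := periodic_mollify_rpow η α ε hmp
  have hS0 : 0 ≤ S := (hν0 0).trans (hS 0)
  have h1 : ∀ {n : Sp d → ℝ}, Continuous n → TorusPeriodic n →
      ∫ x, coupling η α ε m x * n x ∂(torusMeasure d) =
        ∫ x, mollify η ε m x ^ α * mollify η ε n x ∂(torusMeasure d) :=
    fun hn hnp => (integral_mul_mollify hη ε hF hFp hn hnp).symm
  rw [h1 hν hνp, h1 hm hmp]
  have hv := continuous_mollify hη ε hm
  have hv0 := mollify_nonneg hη ε hm0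
  have h2 : S * δ * ∫ x, mollify η ε m x ^ α * mollify η ε m x ∂(torusMeasure d) + S * δ⁻¹ ^ α =
      ∫ x, (S * δ * (mollify η ε m x ^ α * mollify η ε m x) + S * δ⁻¹ ^ α) ∂(torusMeasure d) := by
    rw [integral_torus_add (by fun_prop) (by fun_prop), integral_const_mul]
    simp
  rw [h2]
  have hvν := continuous_mollify hη ε hν
  refine integral_torus_mono (by fun_prop) (by fun_prop) fun x => ?_
  have h3 : 0 ≤ mollify η ε m x ^ α := Real.rpow_nonneg (hv0 x) α
  calc _ ≤ mollify η ε m x ^ α * S := mul_le_mul_of_nonneg_left (mollify_le hη ε hν hS x) h3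
    _ ≤ (δ * (mollify η ε m x ^ α * mollify η ε m x) + δ⁻¹ ^ α) * S :=
      mul_le_mul_of_nonneg_right (rpow_le_mul_add (hv0 x) hδ hα) hS0
    _ = _ := by ring

/-- Moving the outer mollifier onto the increment of m leaves the product of the increments of v =
η_ε * m and of v^α, which have the same sign since z ↦ z^α is monotone on [0,∞). Working with
increments avoids any differentiability of the coupling. -/
theorem integral_increment_coupling_nonneg (hη : IsMollifier η) (hα : 0 < α) (ε : ℝ)
    (hm : Continuous m) (hmp : TorusPeriodic m) (hm0 : ∀ x, 0 ≤ m x) (h : Sp d) :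
    0 ≤ ∫ x, (m (x + h) - m x) * (coupling η α ε m (x + h) - coupling η α ε m x)
      ∂(torusMeasure d) := by
  have hF := continuous_mollify_rpow hη hα ε hm
  have hFp := periodic_mollify_rpow η α ε hmp
  have hint : ∀ {f : Sp d → ℝ}, Continuous f → ∀ x,
      Integrable fun y => η y * f (x - ε • y) := fun hf x => by
    have hc := hη.smooth.continuous
    exact Continuous.integrable_of_hasCompactSupport (by fun_prop) hη.compactSupport.mul_right
  have hsub : ∀ {f : Sp d → ℝ}, Continuous f → ∀ x,
      mollify η ε (fun y => f (y + h) - f y) x = mollify η ε f (x + h) - mollify η ε f x := by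
    intro f hf x
    rw [← mollify_comp_add]
    have hi1 := hint (f := fun y => f (y + h)) (by fun_prop) x
    have hi2 := hint hf x
    simp only [mollify, mul_sub]
    exact integral_sub hi1 hi2
  have hper : ∀ {f : Sp d → ℝ}, TorusPeriodic f → TorusPeriodic fun y => f (y + h) - f y := by
    intro f hf i x
    simp only [add_right_comm x (stdVec i) h, hf i]
  have h1 : ∀ x, coupling η α ε m (x + h) - coupling η α ε m x =
      mollify η ε (fun y => mollify η ε m (y + h) ^ α - mollify η ε m y ^ α) x :=
    fun x => (hsub hF x).symm
  simp only [h1]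
  have hFd : Continuous fun y => mollify η ε m (y + h) ^ α - mollify η ε m y ^ α :=
    (hF.comp (by fun_prop : Continuous fun y => y + h)).sub hF
  rw [integral_mul_mollify hη ε (by fun_prop) (hper hmp) hFd (hper hFp)]
  refine integral_torus_nonneg fun x => ?_
  rw [hsub hm]
  have hv0 := mollify_nonneg hη ε hm0
  rcases le_total (mollify η ε m x) (mollify η ε m (x + h)) with hle | hle
  · exact mul_nonneg (sub_nonneg.2 hle) (sub_nonneg.2 (Real.rpow_le_rpow (hv0 _) hle hα.le))
  · exact mul_nonneg_of_nonpos_of_nonpos (sub_nonpos.2 hle)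
      (sub_nonpos.2 (Real.rpow_le_rpow (hv0 _) hle hα.le))

theorem abs_increment_le {f : Sp d → ℝ} (hf : ContDiff ℝ ∞ f) {i : Fin d} {C : ℝ}
    (hC : ∀ x, |pd i f x| ≤ C) (x : Sp d) (s : ℝ) : |f (x + s • stdVec i) - f x| ≤ C * |s| := by
  have h := Convex.norm_image_sub_le_of_norm_hasDerivWithin_le (s := univ) (C := C)
    (f := fun s : ℝ => f (x + s • stdVec i)) (x := 0) (y := s)
    (fun r _ => (hasDerivAt_pd (hf.differentiable (by simp)) i x r).hasDerivWithinAt)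
    (fun r _ => hC _) convex_univ (mem_univ _) (mem_univ _)
  simpa using h

theorem tendsto_integral_increments {f g : Sp d → ℝ} (hf : ContDiff ℝ ∞ f) (hfp : TorusPeriodic f)
    (hg : ContDiff ℝ ∞ g) (hgp : TorusPeriodic g) (i : Fin d) :
    Tendsto (fun s : ℝ => ∫ x, (s⁻¹ * (f (x + s • stdVec i) - f x)) *
      (s⁻¹ * (g (x + s • stdVec i) - g x)) ∂(torusMeasure d)) (nhdsWithin 0 {0}ᶜ)
      (nhds (∫ x, pd i f x * pd i g x ∂(torusMeasure d))) := by
  obtain ⟨A, hA0, hA⟩ := (hfp.pd i).bounded (contDiff_pd hf i).continuous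
  obtain ⟨B, hB0, hB⟩ := (hgp.pd i).bounded (contDiff_pd hg i).continuous
  have hfc := hf.continuous
  have hgc := hg.continuous
  have key : ∀ {f : Sp d → ℝ} {A : ℝ}, ContDiff ℝ ∞ f → 0 ≤ A → (∀ x, |pd i f x| ≤ A) →
      ∀ s x, |s⁻¹ * (f (x + s • stdVec i) - f x)| ≤ A := by
    intro f A hf hA0 hA s x
    rcases eq_or_ne s 0 with rfl | hs
    · simpa using hA0
    rw [abs_mul, abs_inv, inv_mul_le_iff₀ (abs_pos.2 hs), mul_comm]
    exact abs_increment_le hf hA x s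
  refine tendsto_integral_filter_of_dominated_convergence (fun _ => A * B)
    (Eventually.of_forall fun s => Continuous.aestronglyMeasurable (by fun_prop))
    (Eventually.of_forall fun s => ae_of_all _ fun x => ?_) (integrable_const _)
    (ae_of_all _ fun x => ?_)
  · rw [Real.norm_eq_abs, abs_mul]
    exact mul_le_mul (key hf hA0 hA s x) (key hg hB0 hB s x) (abs_nonneg _) hA0
  · have h1 : ∀ {f : Sp d → ℝ}, ContDiff ℝ ∞ f →
        Tendsto (fun s : ℝ => s⁻¹ * (f (x + s • stdVec i) - f x)) (nhdsWithin 0 {0}ᶜ)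
          (nhds (pd i f x)) := by
      intro f hf
      have h := (hasDerivAt_pd (hf.differentiable (by simp)) i x 0).tendsto_slope_zero
      simpa using h
    exact (h1 hf).mul (h1 hg)

/-- The coupling is monotone in the weak sense. -/
theorem integral_pd_coupling_nonneg (hη : IsMollifier η) (hα : 0 < α) (ε : ℝ)
    (hm : ContDiff ℝ ∞ m) (hmp : TorusPeriodic m) (hm0 : ∀ x, 0 ≤ m x)
    (hG : ContDiff ℝ ∞ (coupling η α ε m)) (i : Fin d) :
    0 ≤ ∫ x, pd i m x * pd i (coupling η α ε m) x ∂(torusMeasure d) := by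
  have hGp : TorusPeriodic (coupling η α ε m) := (periodic_mollify_rpow η α ε hmp).mollify η ε
  refine ge_of_tendsto (tendsto_integral_increments hm hmp hG hGp i)
    (Eventually.of_forall fun s => ?_)
  have h := integral_increment_coupling_nonneg hη hα ε hm.continuous hmp hm0 (s • stdVec i)
  have h2 : ∀ x, (s⁻¹ * (m (x + s • stdVec i) - m x)) *
      (s⁻¹ * (coupling η α ε m (x + s • stdVec i) - coupling η α ε m x)) =
      (s⁻¹ * s⁻¹) * ((m (x + s • stdVec i) - m x) *
        (coupling η α ε m (x + s • stdVec i) - coupling η α ε m x)) := fun x => by ring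
  simp only [h2]
  rw [integral_const_mul]
  exact mul_nonneg (mul_self_nonneg _) h

end Coupling

end MFG

namespace MFG

/-! ### The maximum principle -/

section MaximumPrinciple

variable {d : ℕ}

theorem pd_eq_zero_of_min {f : Sp d → ℝ} {x : Sp d} (hmin : ∀ y, f x ≤ f y) (i : Fin d) :
    pd i f x = 0 := by
  have : IsLocalMin f x := Eventually.of_forall hmin
  simp [pd, this.fderiv_eq_zero]

theorem pd_pd_nonneg_of_min {f : Sp d → ℝ} (hf : ContDiff ℝ ∞ f) {x : Sp d}
    (hmin : ∀ y, f x ≤ f y) (i : Fin d) : 0 ≤ pd i (pd i f) x := by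
  by_contra! hneg
  set a := pd i (pd i f) x with ha
  -- The correction (a/4)s² keeps the second derivative negative, equal to a/2. A local maximum of
  -- the corrected function forces f(x + s e_i) ≤ f(x) + (a/4)s² < f(x) for small s > 0,
  -- contradicting minimality.
  have hd1 : ∀ s : ℝ, HasDerivAt (fun s : ℝ => f (x + s • stdVec i) - a / 4 * s ^ 2)
      (pd i f (x + s • stdVec i) - a / 4 * (2 * s)) s := fun s => by
    have h2 : HasDerivAt (fun s : ℝ => a / 4 * s ^ 2) (a / 4 * (2 * s)) s := by
      simpa using (hasDerivAt_pow 2 s).const_mul (a / 4)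
    exact (hasDerivAt_pd (hf.differentiable (by simp)) i x s).sub h2
  have hd2 : HasDerivAt (fun s : ℝ => pd i f (x + s • stdVec i) - a / 4 * (2 * s)) (a / 2) 0 := by
    have h1 := hasDerivAt_pd ((contDiff_pd hf i).differentiable (by simp)) i x 0
    have h2 : HasDerivAt (fun s : ℝ => a / 4 * (2 * s)) (a / 2) 0 := by
      have := ((hasDerivAt_id (0 : ℝ)).const_mul 2).const_mul (a / 4)
      convert! this using 1
      ring
    convert! h1.sub h2 using 1
    simp only [zero_smul, add_zero, ← ha]
    ring
  have hderiv : deriv (fun s : ℝ => f (x + s • stdVec i) - a / 4 * s ^ 2) =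
      fun s => pd i f (x + s • stdVec i) - a / 4 * (2 * s) := funext fun s => (hd1 s).deriv
  have hmax := isLocalMax_of_deriv_deriv_neg (f := fun s : ℝ => f (x + s • stdVec i) - a / 4 * s ^ 2)
    (x₀ := 0) (by rw [hderiv, hd2.deriv]; linarith)
    (by rw [hderiv]; simp [pd_eq_zero_of_min hmin]) (hd1 0).continuousAt
  obtain ⟨δ, hδ, hball⟩ := Metric.eventually_nhds_iff.1 hmax
  have h := hball (y := δ / 2) (by rw [Real.dist_eq, sub_zero, abs_of_pos (by positivity)]; linarith)
  simp only [zero_smul, add_zero] at h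
  have h3 := hmin (x + (δ / 2) • stdVec i)
  have : 0 < -a * (δ / 2) ^ 2 := mul_pos (by linarith) (by positivity)
  nlinarith

theorem deriv_nonpos_of_left_min {φ : ℝ → ℝ} {φ' t : ℝ} (h : HasDerivAt φ φ' t) (ht : 0 < t)
    (hmin : ∀ s ∈ Icc 0 t, φ t ≤ φ s) : φ' ≤ 0 := by
  have h1 := h.hasDerivWithinAt (s := Iio t)
  rw [hasDerivWithinAt_iff_tendsto_slope' (by simp)] at h1
  refine le_of_tendsto h1 ?_
  have hmem : Ioo 0 t ∈ nhdsWithin t (Iio t) := Ioo_mem_nhdsLT ht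
  filter_upwards [hmem] with s hs
  rw [slope_def_field]
  exact div_nonpos_of_nonneg_of_nonpos (sub_nonneg.2 (hmin s ⟨hs.1.le, hs.2.le⟩))
    (sub_nonpos.2 hs.2.le)

/-- The weak minimum principle for linear parabolic inequalities on the torus. -/
theorem parabolic_nonneg {T Λ : ℝ} {n n' : ℝ → Sp d → ℝ} {b : Fin d → ℝ → Sp d → ℝ}
    {c : ℝ → Sp d → ℝ} (hn : ∀ t ∈ Ioo 0 T, ContDiff ℝ ∞ (n t))
    (hp : ∀ t ∈ Icc 0 T, TorusPeriodic (n t))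
    (hcont : ContinuousOn (fun z : ℝ × Sp d => n z.1 z.2) (Icc 0 T ×ˢ univ))
    (hderiv : ∀ t ∈ Ioo 0 T, ∀ x, HasDerivAt (fun s => n s x) (n' t x) t)
    (hc : ∀ t ∈ Ioo 0 T, ∀ x, c t x ≤ Λ)
    (heq : ∀ t ∈ Ioo 0 T, ∀ x,
      lap (n t) x + ∑ i, b i t x * pd i (n t) x + c t x * n t x ≤ n' t x)
    (h0 : ∀ x, 0 ≤ n 0 x) : ∀ t ∈ Icc 0 T, ∀ x, 0 ≤ n t x := by
  -- Minimizing over [0,τ] with τ < T keeps a minimum time t₀ > 0 inside (0,T), where the inequality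
  -- is available; time T is recovered by continuity.
  have main : ∀ τ ∈ Ico 0 T, ∀ x, 0 ≤ n τ x := by
    intro τ hτ x
    -- The extra 1 makes the contradiction strict: at a negative minimum the inequality gives Λn ≤
    -- n', whereas minimality in time gives n' ≤ (Λ+1)n.
    set lam := Λ + 1 with hlam
    have hvc : ContinuousOn (fun z : ℝ × Sp d => Real.exp (-lam * z.1) * n z.1 z.2)
        (Icc 0 τ ×ˢ unitCell d) :=
      ContinuousOn.mul (by fun_prop)
        (hcont.mono (prod_mono (Icc_subset_Icc_right hτ.2.le) (subset_univ _)))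
    obtain ⟨y, hy, hxy⟩ := exists_mem_unitCell x
    obtain ⟨⟨t₀, x₀⟩, ⟨ht₀, hx₀⟩, hmin⟩ := (isCompact_Icc.prod (isCompact_unitCell d)).exists_isMinOn
      ⟨(τ, y), ⟨⟨hτ.1, le_rfl⟩, hy⟩⟩ hvc
    have hmin' : ∀ s ∈ Icc 0 τ, ∀ z,
        Real.exp (-lam * t₀) * n t₀ x₀ ≤ Real.exp (-lam * s) * n s z := by
      intro s hs z
      obtain ⟨w, hw, hzw⟩ := exists_mem_unitCell z
      rw [hzw _ (hp s ⟨hs.1, hs.2.trans hτ.2.le⟩)]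
      exact hmin (a := (s, w)) ⟨hs, hw⟩
    rcases le_or_gt 0 (n t₀ x₀) with hpos | hneg
    · have h1 := hmin' τ ⟨hτ.1, le_rfl⟩ x
      have h2 : 0 ≤ Real.exp (-lam * t₀) * n t₀ x₀ := by positivity
      exact nonneg_of_mul_nonneg_right (h2.trans h1) (Real.exp_pos _)
    · exfalso
      have ht0 : 0 < t₀ := by
        rcases ht₀.1.eq_or_lt with h | h
        · exact absurd (h0 x₀) (not_le.2 (by rwa [show t₀ = 0 from h.symm] at hneg))
        · exact h
      have htt : t₀ ∈ Ioo 0 T := ⟨ht0, ht₀.2.trans_lt hτ.2⟩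
      have hspace : ∀ z, n t₀ x₀ ≤ n t₀ z := fun z =>
        le_of_mul_le_mul_left (hmin' t₀ ht₀ z) (Real.exp_pos _)
      have he : HasDerivAt (fun s => Real.exp (-lam * s)) (Real.exp (-lam * t₀) * -lam) t₀ := by
        simpa using ((hasDerivAt_id t₀).const_mul (-lam)).exp
      have hle := deriv_nonpos_of_left_min (he.mul (hderiv t₀ htt x₀)) ht0 fun s hs =>
        hmin' s ⟨hs.1, hs.2.trans ht₀.2⟩ x₀
      have hexp := Real.exp_pos (-lam * t₀)
      have h1 : n' t₀ x₀ ≤ lam * n t₀ x₀ := by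
        have : Real.exp (-lam * t₀) * (n' t₀ x₀ - lam * n t₀ x₀) ≤ 0 := by linarith
        have := nonpos_of_mul_nonpos_right this hexp
        linarith
      have h2 := heq t₀ htt x₀
      have h3 : 0 ≤ lap (n t₀) x₀ :=
        Finset.sum_nonneg fun i _ => pd_pd_nonneg_of_min (hn t₀ htt) hspace i
      simp only [pd_eq_zero_of_min hspace, mul_zero, Finset.sum_const_zero, add_zero] at h2
      have h4 : Λ * n t₀ x₀ ≤ c t₀ x₀ * n t₀ x₀ := mul_le_mul_of_nonpos_right (hc t₀ htt x₀) hneg.le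
      rw [hlam] at h1
      linarith
  intro t ht x
  rcases ht.2.eq_or_lt with rfl | hlt
  · rcases ht.1.eq_or_lt with h | h
    · rw [← h]
      exact h0 x
    have h1 : ContinuousWithinAt (fun s => n s x) (Ioo 0 t) t :=
      (hcont.comp (f := fun s => (s, x)) (s := Icc 0 t) (by fun_prop)
        fun _ hs => ⟨hs, mem_univ _⟩).continuousWithinAt ht |>.mono Ioo_subset_Icc_self
    have : (nhdsWithin t (Ioo 0 t)).NeBot := by
      rw [nhdsWithin_Ioo_eq_nhdsLT h]
      infer_instance
    exact ge_of_tendsto h1 (eventually_mem_nhdsWithin.mono fun s hs => main s ⟨hs.1.le, hs.2⟩ x)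
  · exact main t ⟨ht.1, hlt⟩ x

end MaximumPrinciple

/-! ### Basic properties of solutions -/

/-- The `k`-th component of `D_p H (x, Du)`. -/
noncomputable def vel {d : ℕ} (H : Sp d → Sp d → ℝ) (u : ℝ → Sp d → ℝ) (k : Fin d) (t : ℝ)
    (x : Sp d) : ℝ := dp k H x (gradient (u t) x)

/-- `div (D_p H (x, Du))`. -/
noncomputable def divVel {d : ℕ} (H : Sp d → Sp d → ℝ) (u : ℝ → Sp d → ℝ) (t : ℝ) (x : Sp d) : ℝ :=
  ∑ k, pd k (vel H u k t) x

section Solution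

variable {d : ℕ} {T α ε : ℝ} {H : Sp d → Sp d → ℝ} {uT m0 η : Sp d → ℝ} {u m : ℝ → Sp d → ℝ}

theorem SmoothST.vel (hT : 0 < T) (hH : IsHamiltonian H) (hu : SmoothST T u) (k : Fin d) :
    SmoothST T (vel H u k) :=
  SmoothST.along (PhaseSmooth.dp hH.smooth k) hT hu

theorem SmoothST.divVel (hT : 0 < T) (hH : IsHamiltonian H) (hu : SmoothST T u) :
    SmoothST T (divVel H u) :=
  SmoothST.sum fun k => (hu.vel hT hH k).pd hT k

theorem vel_periodic (hH : IsHamiltonian H) {t : ℝ} (hu : TorusPeriodic (u t)) (k : Fin d) :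
    TorusPeriodic (vel H u k t) :=
  periodic_along (dp_periodic hH.periodic k) hu

theorem divVel_periodic (hH : IsHamiltonian H) {t : ℝ} (hu : TorusPeriodic (u t)) :
    TorusPeriodic (divVel H u t) :=
  TorusPeriodic.sum fun k => (vel_periodic hH hu k).pd k

namespace IsSolution

theorem smooth_u (h : IsSolution T α H uT m0 η ε u m) : SmoothST T u := h.u_smooth

theorem smooth_m (h : IsSolution T α H uT m0 η ε u m) : SmoothST T m := h.m_smooth

theorem hj (h : IsSolution T α H uT m0 η ε u m) {t : ℝ} (ht : t ∈ Ioo 0 T) (x : Sp d) :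
    dt T u t x = H x (gradient (u t) x) - lap (u t) x - coupling η α ε (m t) x := by
  have h1 := h.hamilton_jacobi t ht x
  rw [(h.smooth_u.hasDerivAt ht x).deriv,
    laplacian_eq_lap (h.smooth_u.slice (Ioo_subset_Icc_self ht))] at h1
  linarith

theorem fp (h : IsSolution T α H uT m0 η ε u m) {t : ℝ}
    (ht : t ∈ Ioo 0 T) (x : Sp d) :
    dt T m t x = lap (m t) x + ∑ k, pd k (fun y => m t y * vel H u k t y) x := by
  have h1 := h.fokker_planck t ht x
  rw [(h.smooth_m.hasDerivAt ht x).deriv,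
    laplacian_eq_lap (h.smooth_m.slice (Ioo_subset_Icc_self ht))] at h1
  have h2 : divergence (fun y => m t y • DpH H y (gradient (u t) y)) x =
      ∑ k, pd k (fun y => m t y * vel H u k t y) x := by
    simp only [divergence, PiLp.smul_apply, DpH_apply, smul_eq_mul, vel]
  rw [h2] at h1
  linarith

theorem fp_nondivergence (hT : 0 < T) (hH : IsHamiltonian H) (h : IsSolution T α H uT m0 η ε u m) {t : ℝ}
    (ht : t ∈ Ioo 0 T) (x : Sp d) :
    dt T m t x = lap (m t) x + ∑ k, vel H u k t x * pd k (m t) x + divVel H u t x * m t x := by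
  have htt := Ioo_subset_Icc_self ht
  rw [h.fp ht x, add_assoc]
  congr 1
  rw [divVel, Finset.sum_mul, ← Finset.sum_add_distrib]
  refine Finset.sum_congr rfl fun k _ => ?_
  rw [pd_mul ((h.smooth_m.slice htt).differentiable (by simp) x)
    (((h.smooth_u.vel hT hH k).slice htt).differentiable (by simp) x)]
  ring

/-- If Λ bounds |div D_pH(x,Du)|, then κ e^(-Λt) is a subsolution lying below m₀ at time 0. Here Λ
depends on the solution, so the result is only qualitative; it legitimizes real powers of m. -/
theorem m_pos (hT : 0 < T) (hH : IsHamiltonian H) (hdata : IsData uT m0)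
    (h : IsSolution T α H uT m0 η ε u m) : ∀ t ∈ Icc 0 T, ∀ x, 0 < m t x := by
  obtain ⟨κ, hκ, hκm⟩ := hdata.m0_lower
  obtain ⟨Λ, hΛ⟩ := (h.smooth_u.divVel hT hH).exists_bound
  have hΛ' : ∀ t ∈ Ioo 0 T, ∀ x, |divVel H u t x| ≤ Λ := by
    intro t ht x
    have htt := Ioo_subset_Icc_self ht
    obtain ⟨y, hy, hxy⟩ := exists_mem_unitCell x
    rw [hxy _ (divVel_periodic hH (h.u_periodic t htt))]
    exact hΛ t htt y hy
  have key := parabolic_nonneg (T := T) (Λ := Λ) (n := fun t x => m t x - κ * Real.exp (-Λ * t))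
    (n' := fun t x => dt T m t x - κ * (Real.exp (-Λ * t) * -Λ)) (b := vel H u) (c := divVel H u)
    (fun t ht => (h.smooth_m.slice (Ioo_subset_Icc_self ht)).sub contDiff_const)
    (fun t ht i x => by simp only [h.m_periodic t ht i x])
    (h.smooth_m.continuousOn.sub (by fun_prop))
    (fun t ht x => by
      have he : HasDerivAt (fun s => Real.exp (-Λ * s)) (Real.exp (-Λ * t) * -Λ) t := by
        simpa using ((hasDerivAt_id t).const_mul (-Λ)).exp
      exact (h.smooth_m.hasDerivAt ht x).sub (he.const_mul κ))
    (fun t ht x => (abs_le.1 (hΛ' t ht x)).2)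
    (fun t ht x => by
      have hpd : ∀ i, pd i (fun y => m t y - κ * Real.exp (-Λ * t)) = pd i (m t) := fun i => by
        funext y
        simp only [pd, fderiv_sub_const]
      simp only [lap, hpd]
      rw [h.fp_nondivergence hT hH ht x, lap]
      have h1 := (abs_le.1 (hΛ' t ht x)).1
      have h2 : 0 < κ * Real.exp (-Λ * t) := by positivity
      nlinarith)
    (fun x => by simpa [h.initial] using hκm x)
  intro t ht x
  have h1 := key t ht x
  have h2 : 0 < κ * Real.exp (-Λ * t) := by positivity
  linarith

theorem mass (hT : 0 < T) (hH : IsHamiltonian H) (hdata : IsData uT m0)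
    (h : IsSolution T α H uT m0 η ε u m) {t : ℝ} (ht : t ∈ Icc 0 T) :
    ∫ x, m t x ∂(torusMeasure d) = 1 := by
  have h0 : ∫ x, m 0 x ∂(torusMeasure d) = 1 := by simp only [h.initial, hdata.m0_mass]
  have h1 := h.smooth_m.stInt_dt hT ht
  have h2 : stInt d t (dt T m) = stInt d t (fun _ _ => 0) := by
    have hz : ∀ s ∈ Ioo 0 T, ∫ x, dt T m s x ∂(torusMeasure d) = 0 := by
      intro s hs
      have hss := Ioo_subset_Icc_self hs
      have hm := h.smooth_m.slice hss
      have hv : ∀ k, ContDiff ℝ ∞ (fun y => m s y * vel H u k s y) := fun k =>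
        hm.mul ((h.smooth_u.vel hT hH k).slice hss)
      simp only [h.fp hs, lap]
      rw [integral_torus_add
          (continuous_finsetSum _ fun i _ => (contDiff_pd (contDiff_pd hm i) i).continuous)
          (continuous_finsetSum _ fun i _ => (contDiff_pd (hv i) i).continuous),
        integral_torus_sum fun i => (contDiff_pd (contDiff_pd hm i) i).continuous,
        integral_torus_sum fun i => (contDiff_pd (hv i) i).continuous]
      have e1 : ∀ i, ∫ x, pd i (pd i (m s)) x ∂(torusMeasure d) = 0 := fun i =>
        integral_pd (contDiff_pd hm i) ((h.m_periodic s hss).pd i) i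
      have e2 : ∀ i, ∫ x, pd i (fun y => m s y * vel H u i s y) x ∂(torusMeasure d) = 0 := fun i =>
        integral_pd (hv i) ((h.m_periodic s hss).mul (vel_periodic hH (h.u_periodic s hss) i)) i
      simp [e1, e2]
    refine le_antisymm (stInt_mono (h.smooth_m.dt hT) (SmoothST.space contDiff_const) ht ?_)
      (stInt_mono (SmoothST.space contDiff_const) (h.smooth_m.dt hT) ht ?_) <;>
    · intro s hs
      simp [hz s hs]
  rw [h2, stInt_const, h0] at h1
  linarith

end IsSolution

end Solution

end MFG

namespace MFG

theorem stInt_nonneg {d : ℕ} {T : ℝ} {F : ℝ → Sp d → ℝ} (hF : SmoothST T F) {τ : ℝ}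
    (hτ : τ ∈ Icc 0 T) (h : ∀ t ∈ Ioo 0 T, 0 ≤ ∫ x, F t x ∂(torusMeasure d)) : 0 ≤ stInt d τ F := by
  have h1 := stInt_mono (d := d) (SmoothST.space (T := T) (f := fun _ => 0) contDiff_const) hF hτ
    (by simpa using h)
  simpa [stInt] using h1

theorem SmoothST.const_mul {d : ℕ} {T : ℝ} {F : ℝ → Sp d → ℝ} (hF : SmoothST T F) (c : ℝ) :
    SmoothST T (fun t x => c * F t x) := (SmoothST.space contDiff_const).mul hF

/-! ### Growth of the Hamiltonian -/

section Growth

variable {d : ℕ} {H : Sp d → Sp d → ℝ}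

/-- The superlinear growth of `H` in `p` is uniform in `x`. -/
theorem uniform_superlinear (hH : IsHamiltonian H) (hD : DerivativeBounds H) (K : ℝ) (hK : 0 ≤ K) :
    ∃ C : ℝ, ∀ x p, K * ‖p‖ - C ≤ H x p := by
  obtain ⟨C, hC⟩ := hD.x_bounds
  obtain ⟨R, hR⟩ := (isCompact_unitCell d).isBounded.exists_norm_le
  set B := max C 0 * max R 0 with hB
  have hB0 : 0 ≤ B := by positivity
  -- Since |D_xH| ≤ C(H+1), the function log(H+1) is Lipschitz in x uniformly in p, so its values at
  -- 0 and at y in the cell differ by at most B.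
  have hgron : ∀ y ∈ unitCell d, ∀ p, H 0 p + 1 ≤ Real.exp B * (H y p + 1) := by
    intro y hy p
    have hpos : ∀ z, 0 < H z p + 1 := fun z => by linarith [hH.one_le z p]
    have hsm : ContDiff ℝ ∞ (fun z => H z p) :=
      ContDiff.comp (g := fun z : Sp d × Sp d => H z.1 z.2) hH.smooth
        (contDiff_id.prodMk contDiff_const)
    have hder : ∀ s : ℝ, HasDerivAt (fun s : ℝ => Real.log (H (s • y) p + 1))
        (fderiv ℝ (fun z => H z p) (s • y) y / (H (s • y) p + 1)) s := by
      intro s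
      have h1 : HasDerivAt (fun s : ℝ => s • y) y s := by
        simpa using (hasDerivAt_id s).smul_const y
      have h2 := ((hsm.differentiable (by simp) (s • y)).hasFDerivAt.comp_hasDerivAt s h1)
      exact (h2.add_const 1).log (hpos _).ne'
    have hbd : ∀ s : ℝ, ‖fderiv ℝ (fun z => H z p) (s • y) y / (H (s • y) p + 1)‖ ≤ B := by
      intro s
      have h1 : ‖fderiv ℝ (fun z => H z p) (s • y)‖ ≤ max C 0 * (H (s • y) p + 1) := by
        have h2 := (hC (s • y) p).1
        have h3 : ‖DxH H (s • y) p‖ = ‖fderiv ℝ (fun z => H z p) (s • y)‖ := by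
          simp [DxH, gradient]
        rw [h3] at h2
        have := mul_le_mul_of_nonneg_right (le_max_left C 0) (hpos (s • y)).le
        linarith
      rw [norm_div, Real.norm_of_nonneg (hpos _).le, div_le_iff₀ (hpos _)]
      calc _ ≤ ‖fderiv ℝ (fun z => H z p) (s • y)‖ * ‖y‖ := ContinuousLinearMap.le_opNorm _ _
        _ ≤ (max C 0 * (H (s • y) p + 1)) * max R 0 := by
          have := hpos (s • y)
          exact mul_le_mul h1 ((hR y hy).trans (le_max_left _ _)) (norm_nonneg _) (by positivity)
        _ = _ := by rw [hB]; ring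
    have h := Convex.norm_image_sub_le_of_norm_hasDerivWithin_le (s := univ) (C := B)
      (f := fun s : ℝ => Real.log (H (s • y) p + 1)) (x := 1) (y := 0)
      (fun r _ => (hder r).hasDerivWithinAt) (fun r _ => hbd r) convex_univ (mem_univ _) (mem_univ _)
    simp only [zero_smul, one_smul, zero_sub, norm_neg, norm_one, mul_one] at h
    have h1 : Real.log (H 0 p + 1) ≤ B + Real.log (H y p + 1) := by
      have := (le_abs_self _).trans h
      linarith
    rw [← Real.exp_le_exp, Real.exp_add, Real.exp_log (hpos 0), Real.exp_log (hpos y)] at h1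
    exact h1
  -- Coercivity is used at x = 0 only, with slope K e^B, so that slope K survives the loss of the
  -- factor e^B.
  have hco := (hH.coercive 0).eventually_ge_atTop (K * Real.exp B)
  obtain ⟨ρ, hρ⟩ := (hasBasis_cobounded_norm.eventually_iff).1 hco
  obtain ⟨-, hρ⟩ := hρ
  refine ⟨K * max ρ 0 + 1, fun x p => ?_⟩
  obtain ⟨y, hy, hxy⟩ := exists_mem_unitCell x
  rw [hxy _ (hH.periodic p)]
  have h1 := hgron y hy p
  have hexp := Real.exp_pos B
  have h0 : Real.exp B * (K * ‖p‖ - K * max ρ 0) ≤ H 0 p + 1 := by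
    rcases le_total ρ ‖p‖ with h | h
    · have h2 := hρ h
      rcases (norm_nonneg p).eq_or_lt with h3 | h3
      · rw [← h3]
        have : 0 ≤ Real.exp B * (K * max ρ 0) := by positivity
        linarith [hH.one_le 0 p]
      · rw [le_div_iff₀ h3] at h2
        have : 0 ≤ Real.exp B * (K * max ρ 0) := by positivity
        nlinarith
    · have h2 : K * ‖p‖ ≤ K * max ρ 0 := mul_le_mul_of_nonneg_left (h.trans (le_max_left _ _)) hK
      have : Real.exp B * (K * ‖p‖ - K * max ρ 0) ≤ 0 :=
        mul_nonpos_of_nonneg_of_nonpos hexp.le (by linarith)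
      linarith [hH.one_le 0 p]
  have h2 := le_of_mul_le_mul_left (h0.trans h1) hexp
  linarith

end Growth

/-! ### First-order estimates -/

section FirstOrder

variable {d : ℕ} {T α : ℝ} {H : Sp d → Sp d → ℝ} {uT m0 η : Sp d → ℝ}

/-- `H (x, Du)` along a solution. -/
noncomputable def ham (H : Sp d → Sp d → ℝ) (u : ℝ → Sp d → ℝ) (t : ℝ) (x : Sp d) : ℝ :=
  H x (gradient (u t) x)

/-- The right-hand side of the Hamilton–Jacobi equation, as a function smooth up to the ends of the
time interval. -/
noncomputable def source (T : ℝ) (H : Sp d → Sp d → ℝ) (u : ℝ → Sp d → ℝ) (t : ℝ) (x : Sp d) : ℝ :=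
  ham H u t x - lap (u t) x - dt T u t x

variable {ε : ℝ} {u m : ℝ → Sp d → ℝ}

theorem SmoothST.ham (hT : 0 < T) (hH : IsHamiltonian H) (hu : SmoothST T u) :
    SmoothST T (ham H u) := SmoothST.along hH.smooth hT hu

theorem SmoothST.source (hT : 0 < T) (hH : IsHamiltonian H) (hu : SmoothST T u) :
    SmoothST T (source T H u) := ((hu.ham hT hH).sub (hu.lap hT)).sub (hu.dt hT)

theorem one_le_ham (hH : IsHamiltonian H) (t : ℝ) (x : Sp d) : 1 ≤ ham H u t x := hH.one_le _ _

namespace IsSolution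

theorem source_eq (h : IsSolution T α H uT m0 η ε u m) {t : ℝ} (ht : t ∈ Ioo 0 T) :
    source T H u t = coupling η α ε (m t) := by
  funext x
  rw [source, h.hj ht, ham]
  ring

theorem integral_source_mul_nonneg (hT : 0 < T) (hH : IsHamiltonian H) (hdata : IsData uT m0)
    (hη : IsMollifier η) (h : IsSolution T α H uT m0 η ε u m) {t : ℝ} (ht : t ∈ Ioo 0 T)
    {ν : Sp d → ℝ} (hν : ∀ x, 0 ≤ ν x) :
    0 ≤ ∫ x, source T H u t x * ν x ∂(torusMeasure d) := by
  rw [h.source_eq ht]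
  exact integral_torus_nonneg fun x => mul_nonneg (coupling_nonneg hη α ε
    (fun y => (h.m_pos hT hH hdata t (Ioo_subset_Icc_self ht) y).le) x) (hν x)

/-- The two linearly coupled equations are in duality: the Laplacians cancel, and integrating the
transport term by parts leaves -D_pH · Du times m. -/
theorem integral_dt_mul (hT : 0 < T) (hH : IsHamiltonian H) (h : IsSolution T α H uT m0 η ε u m)
    {t : ℝ} (ht : t ∈ Ioo 0 T) :
    ∫ x, dt T (fun t x => u t x * m t x) t x ∂(torusMeasure d) =
      ∫ x, ((ham H u t x - ∑ k, vel H u k t x * pd k (u t) x) * m t x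
        - source T H u t x * m t x) ∂(torusMeasure d) := by
  have htt := Ioo_subset_Icc_self ht
  have hu := h.smooth_u.slice htt
  have hm := h.smooth_m.slice htt
  have hup := h.u_periodic t htt
  have hmp := h.m_periodic t htt
  have hv : ∀ k, ContDiff ℝ ∞ (vel H u k t) := fun k => (h.smooth_u.vel hT hH k).slice htt
  have hvp : ∀ k, TorusPeriodic (vel H u k t) := fun k => vel_periodic hH hup k
  have hS := ((h.smooth_u.source hT hH).slice htt).continuous
  have hHc := ((h.smooth_u.ham hT hH).slice htt).continuous
  have hlu := (contDiff_lap hu).continuous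
  have hlm := (contDiff_lap hm).continuous
  have huc := hu.continuous
  have hmc := hm.continuous
  have hvc := fun k => (hv k).continuous
  have hpu := fun k => (contDiff_pd hu k).continuous
  have hpmv := fun k => (contDiff_pd (hm.mul (hv k)) k).continuous
  have e1 : ∀ x, dt T (fun t x => u t x * m t x) t x =
      ((ham H u t x * m t x - source T H u t x * m t x) +
        (u t x * lap (m t) x - lap (u t) x * m t x)) +
        ∑ k, u t x * pd k (fun y => m t y * vel H u k t y) x := by
    intro x
    rw [h.smooth_u.dt_mul h.smooth_m ht, h.fp ht, ← Finset.mul_sum, source]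
    ring
  have e2 : ∀ x, (ham H u t x - ∑ k, vel H u k t x * pd k (u t) x) * m t x
        - source T H u t x * m t x = (ham H u t x * m t x - source T H u t x * m t x) -
        ∑ k, pd k (u t) x * (m t x * vel H u k t x) := by
    intro x
    rw [sub_mul, Finset.sum_mul, sub_right_comm]
    congr 1
    exact Finset.sum_congr rfl fun k _ => by ring
  have e3 := integral_mul_lap_comm hu hup hm hmp
  have e4 : ∀ k, ∫ x, u t x * pd k (fun y => m t y * vel H u k t y) x ∂(torusMeasure d) =
      - ∫ x, pd k (u t) x * (m t x * vel H u k t x) ∂(torusMeasure d) := fun k =>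
    integral_mul_pd hu hup (hm.mul (hv k)) (hmp.mul (hvp k)) k
  simp only [e1, e2]
  rw [integral_torus_add (by fun_prop) (by fun_prop), integral_torus_add (by fun_prop) (by fun_prop),
    integral_torus_sub (f := fun x => u t x * lap (m t) x) (by fun_prop) (by fun_prop),
    integral_torus_sum (fun k => by fun_prop), e3, Finset.sum_congr rfl fun k _ => e4 k,
    integral_torus_sub (f := fun x => ham H u t x * m t x - source T H u t x * m t x)
      (by fun_prop) (by fun_prop), integral_torus_sum (fun k => by fun_prop),
    Finset.sum_neg_distrib]
  ring

theorem integral_dt_mul_space (hT : 0 < T) (hH : IsHamiltonian H)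
    (h : IsSolution T α H uT m0 η ε u m) {ν : Sp d → ℝ} (hν : ContDiff ℝ ∞ ν)
    (hνp : TorusPeriodic ν) {t : ℝ} (ht : t ∈ Ioo 0 T) :
    ∫ x, dt T (fun t x => u t x * ν x) t x ∂(torusMeasure d) =
      ∫ x, ((ham H u t x * ν x + ∑ k, pd k ν x * pd k (u t) x)
        - source T H u t x * ν x) ∂(torusMeasure d) := by
  have htt := Ioo_subset_Icc_self ht
  have hu := h.smooth_u.slice htt
  have hup := h.u_periodic t htt
  have hS := ((h.smooth_u.source hT hH).slice htt).continuous
  have hHc := ((h.smooth_u.ham hT hH).slice htt).continuous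
  have hlu := (contDiff_lap hu).continuous
  have hνc := hν.continuous
  have hpu := fun k => (contDiff_pd hu k).continuous
  have hpν := fun k => (contDiff_pd hν k).continuous
  have e1 : ∀ x, dt T (fun t x => u t x * ν x) t x =
      (ham H u t x * ν x - source T H u t x * ν x) - ν x * lap (u t) x := by
    intro x
    rw [h.smooth_u.dt_mul (G := fun _ => ν) (SmoothST.space hν) ht, dt_space ν ht x hν, source]
    ring
  have e2 : ∀ x, ((ham H u t x * ν x + ∑ k, pd k ν x * pd k (u t) x) - source T H u t x * ν x) =
      (ham H u t x * ν x - source T H u t x * ν x) + ∑ k, pd k ν x * pd k (u t) x := fun x => by ring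
  simp only [e1, e2]
  rw [integral_torus_sub (by fun_prop) (by fun_prop), integral_mul_lap hν hνp hu hup,
    integral_torus_add (by fun_prop) (by fun_prop)]
  ring

theorem integral_mul_m_le (hT : 0 < T) (hH : IsHamiltonian H) (hdata : IsData uT m0)
    (h : IsSolution T α H uT m0 η ε u m) {t : ℝ} (ht : t ∈ Icc 0 T) {f : Sp d → ℝ}
    (hf : Continuous f) {C : ℝ} (hC : ∀ x, f x ≤ C) :
    ∫ x, f x * m t x ∂(torusMeasure d) ≤ C := by
  have hmc := (h.smooth_m.slice ht).continuous
  calc _ ≤ ∫ x, C * m t x ∂(torusMeasure d) :=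
        integral_torus_mono (by fun_prop) (by fun_prop) fun x =>
          mul_le_mul_of_nonneg_right (hC x) (h.m_pos hT hH hdata t ht x).le
    _ = C := by rw [integral_const_mul, h.mass hT hH hdata ht, mul_one]

end IsSolution

/-- Integrate the duality identity in time and use D_pH · p - H ≥ cH - C for coercivity. Unit mass
turns the error into TC and bounds the terminal term by sup |u_T|; the unknown u at time 0 stays on
the right. -/
theorem energy_inequality (hT : 0 < T) (hH : IsHamiltonian H) (hL : LagrangianBound H)
    (hdata : IsData uT m0) :
    ∃ c C : ℝ, 0 < c ∧ ∀ ε u m, IsSolution T α H uT m0 η ε u m →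
      c * stInt d T (fun t x => ham H u t x * m t x) +
        stInt d T (fun t x => source T H u t x * m t x) ≤
        C + ∫ x, u 0 x * m0 x ∂(torusMeasure d) := by
  obtain ⟨c, C, hc, hC, hL⟩ := hL
  obtain ⟨B, hB0, hB⟩ := hdata.uT_periodic.bounded hdata.uT_smooth.continuous
  refine ⟨c, T * C + B, hc, fun ε u m h => ?_⟩
  have hTm : T ∈ Icc 0 T := ⟨hT.le, le_rfl⟩
  have hHm := (h.smooth_u.ham hT hH).mul h.smooth_m
  have hSm := (h.smooth_u.source hT hH).mul h.smooth_m
  have hum := h.smooth_u.mul h.smooth_m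
  have key := stInt_mono (d := d) (((hHm.const_mul c).add hSm).add (hum.dt hT))
    (SmoothST.space (T := T) (f := fun _ => C) contDiff_const) hTm ?_
  · rw [((hHm.const_mul c).add hSm).stInt_add (hum.dt hT) hTm,
      (hHm.const_mul c).stInt_add hSm hTm, stInt_const_mul, stInt_const,
      hum.stInt_dt hT hTm] at key
    have h1 : ∫ x, -uT x * m T x ∂(torusMeasure d) ≤ B :=
      h.integral_mul_m_le hT hH hdata hTm hdata.uT_smooth.continuous.neg
        fun x => (neg_le_abs _).trans (hB x)
    simp only [neg_mul, integral_neg] at h1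
    simp only [h.terminal, h.initial] at key
    linarith
  · intro t ht
    have htt := Ioo_subset_Icc_self ht
    have hHc := ((h.smooth_u.ham hT hH).slice htt).continuous
    have hmc := (h.smooth_m.slice htt).continuous
    have hSc := ((h.smooth_u.source hT hH).slice htt).continuous
    have hdc := ((hum.dt hT).slice htt).continuous
    have hvc := fun k => ((h.smooth_u.vel hT hH k).slice htt).continuous
    have hpu := fun k => (contDiff_pd (h.smooth_u.slice htt) k).continuous
    rw [integral_torus_add (by fun_prop) hdc, h.integral_dt_mul hT hH ht,
      ← integral_torus_add (by fun_prop) (by fun_prop)]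
    have h2 : ∫ _ : Sp d, C ∂(torusMeasure d) = ∫ x, C * m t x ∂(torusMeasure d) := by
      rw [integral_const_mul, h.mass hT hH hdata htt]
      simp
    rw [h2]
    refine integral_torus_mono (by fun_prop) (by fun_prop) fun x => ?_
    have h3 := hL x (gradient (u t) x)
    rw [inner_DpH] at h3
    simp only [gradient_apply] at h3
    have h4 := mul_le_mul_of_nonneg_right h3 (h.m_pos hT hH hdata t htt x).le
    simp only [ham, vel]
    linarith

/-- An upper bound for `u` at time `0`, tested against a positive density. -/
theorem initial_upper_bound (hT : 0 < T) (hα : 0 < α) (hH : IsHamiltonian H)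
    (hD : DerivativeBounds H) (hdata : IsData uT m0) (hη : IsMollifier η) {ν : Sp d → ℝ}
    (hν : ContDiff ℝ ∞ ν) (hνp : TorusPeriodic ν) {κ : ℝ} (hκ : 0 < κ) (hκν : ∀ x, κ ≤ ν x) {δ : ℝ}
    (hδ : 0 < δ) :
    ∃ C : ℝ, ∀ ε u m, IsSolution T α H uT m0 η ε u m →
      ∫ x, u 0 x * ν x ∂(torusMeasure d) ≤
        C + δ * stInt d T (fun t x => source T H u t x * m t x) := by
  obtain ⟨S, hS0, hS⟩ := hνp.bounded hν.continuous
  have hN : ∃ N : ℝ, 0 ≤ N ∧ ∀ i x, |pd i ν x| ≤ N := by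
    choose N hN0 hN using fun i => (hνp.pd i).bounded (contDiff_pd hν i).continuous
    exact ⟨∑ i, N i, Finset.sum_nonneg fun i _ => hN0 i, fun i x =>
      (hN i x).trans (Finset.single_le_sum (fun j _ => hN0 j) (Finset.mem_univ i))⟩
  obtain ⟨N, hN0, hN⟩ := hN
  -- With slope dN/κ, the term Hν ≥ κH absorbs |Dν · Du| ≤ dN|Du|.
  obtain ⟨A, hA⟩ := uniform_superlinear hH hD (d * N / κ) (by positivity)
  obtain ⟨B, hB0, hB⟩ := hdata.uT_periodic.bounded hdata.uT_smooth.continuous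
  -- Chosen so that Sδ' ≤ δ, with no need for S to be nonzero.
  set δ' := δ / (S + 1) with hδ'
  have hδ'0 : 0 < δ' := by positivity
  have hSδ : S * δ' ≤ δ := by
    rw [hδ', mul_div_assoc', div_le_iff₀ (by positivity)]
    nlinarith
  set E := κ * A + S * δ'⁻¹ ^ α with hE
  refine ⟨B * S + T * E, fun ε u m h => ?_⟩
  have hTm : T ∈ Icc 0 T := ⟨hT.le, le_rfl⟩
  have hSm := (h.smooth_u.source hT hH).mul h.smooth_m
  have huν : SmoothST T (fun t x => u t x * ν x) := h.smooth_u.mul (SmoothST.space hν)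
  have key := stInt_mono (d := d) (SmoothST.space (T := T) (f := fun _ => -E) contDiff_const)
    ((huν.dt hT).add (hSm.const_mul δ)) hTm ?_
  · rw [(huν.dt hT).stInt_add (hSm.const_mul δ) hTm, stInt_const_mul, stInt_const,
      huν.stInt_dt hT hTm] at key
    have h1 : ∫ x, u T x * ν x ∂(torusMeasure d) ≤ B * S := by
      simp only [h.terminal]
      have hc1 := hdata.uT_smooth.continuous
      have hc2 := hν.continuous
      calc _ ≤ ∫ _ : Sp d, B * S ∂(torusMeasure d) := by
            refine integral_torus_mono (by fun_prop) (by fun_prop) fun x => ?_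
            calc _ ≤ |uT x * ν x| := le_abs_self _
              _ = |uT x| * |ν x| := abs_mul _ _
              _ ≤ _ := mul_le_mul (hB x) (hS x) (abs_nonneg _) hB0
        _ = _ := by simp
    linarith
  · intro t ht
    have htt := Ioo_subset_Icc_self ht
    have hHc := ((h.smooth_u.ham hT hH).slice htt).continuous
    have hmc := (h.smooth_m.slice htt).continuous
    have hSc := ((h.smooth_u.source hT hH).slice htt).continuous
    have hdc := ((huν.dt hT).slice htt).continuous
    have hpu := fun k => (contDiff_pd (h.smooth_u.slice htt) k).continuous
    have hpν := fun k => (contDiff_pd hν k).continuous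
    have hνc := hν.continuous
    have hm0 := fun x => (h.m_pos hT hH hdata t htt x).le
    rw [integral_torus_add hdc (by fun_prop), h.integral_dt_mul_space hT hH hν hνp ht,
      integral_torus_sub (by fun_prop) (by fun_prop), integral_const_mul]
    have h1 := integral_coupling_le hη hα ε hmc (h.m_periodic t htt) hm0 hνc hνp
      (fun x => hκ.le.trans (hκν x)) hδ'0 (fun x => (le_abs_self _).trans (hS x))
    rw [← h.source_eq ht] at h1
    have h2 := h.integral_source_mul_nonneg hT hH hdata hη ht hm0
    have h3 := mul_le_mul_of_nonneg_right hSδ h2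
    have h4 : -(κ * A) ≤
        ∫ x, (ham H u t x * ν x + ∑ k, pd k ν x * pd k (u t) x) ∂(torusMeasure d) := by
      calc -(κ * A) = ∫ _ : Sp d, -(κ * A) ∂(torusMeasure d) := by simp
        _ ≤ _ := by
          refine integral_torus_mono (by fun_prop) (by fun_prop) fun x => ?_
          have h5 := hA x (gradient (u t) x)
          have h6 : κ * ham H u t x ≤ ham H u t x * ν x := by
            have := one_le_ham (u := u) hH t x
            rw [mul_comm]
            exact mul_le_mul_of_nonneg_left (hκν x) (by linarith)
          have h7 : -(d * N * ‖gradient (u t) x‖) ≤ ∑ k, pd k ν x * pd k (u t) x := by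
            have h8 : ∀ k ∈ Finset.univ, -(N * ‖gradient (u t) x‖) ≤ pd k ν x * pd k (u t) x := by
              intro k _
              refine (abs_le.1 ?_).1
              rw [abs_mul]
              refine mul_le_mul (hN k x) ?_ (abs_nonneg _) hN0
              rw [← gradient_apply]
              exact PiLp.norm_apply_le (gradient (u t) x) k
            have := Finset.sum_le_sum h8
            simp only [Finset.sum_const, Finset.card_univ, Fintype.card_fin, nsmul_eq_mul] at this
            linarith
          have h9 := mul_le_mul_of_nonneg_left h5 hκ.le
          have h10 : κ * (d * N / κ * ‖gradient (u t) x‖ - A) =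
              d * N * ‖gradient (u t) x‖ - κ * A := by field_simp
          rw [h10] at h9
          change κ * _ ≤ _ at h6
          simp only [ham] at h6 ⊢
          linarith
    have h5 : ∫ _ : Sp d, -E ∂(torusMeasure d) = -E := by simp
    rw [h5]
    linarith

/-- `energy_inequality` leaves ∫ u(0)m₀ on the right, and `initial_upper_bound` with ν = m₀ bounds
it by a constant plus half of the coupling term, which is absorbed. Nonnegativity of the two
space-time integrals then makes the energy inequality a lower bound for ∫ u(0)m₀. -/
theorem first_order_estimates (hT : 0 < T) (hα : 0 < α) (hH : IsHamiltonian H)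
    (hL : LagrangianBound H) (hD : DerivativeBounds H) (hdata : IsData uT m0)
    (hη : IsMollifier η) :
    ∃ C : ℝ, ∀ ε u m, IsSolution T α H uT m0 η ε u m →
      stInt d T (fun t x => ham H u t x * m t x) ≤ C ∧
      stInt d T (fun t x => source T H u t x * m t x) ≤ C ∧
      -C ≤ ∫ x, u 0 x * m0 x ∂(torusMeasure d) := by
  obtain ⟨c, C₁, hc, h1⟩ := energy_inequality (α := α) (η := η) hT hH hL hdata
  obtain ⟨κ, hκ, hκm⟩ := hdata.m0_lower
  obtain ⟨C₂, h2⟩ := initial_upper_bound hT hα hH hD hdata hη hdata.m0_smooth hdata.m0_periodic hκ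
    hκm (δ := 1 / 2) (by norm_num)
  refine ⟨max ((C₁ + C₂) / c) (max (2 * (C₁ + C₂)) C₁), fun ε u m h => ?_⟩
  have hTm : T ∈ Icc 0 T := ⟨hT.le, le_rfl⟩
  have hm0 : ∀ t ∈ Ioo 0 T, ∀ x, 0 ≤ m t x := fun t ht x =>
    (h.m_pos hT hH hdata t (Ioo_subset_Icc_self ht) x).le
  have n1 : 0 ≤ stInt d T (fun t x => ham H u t x * m t x) :=
    stInt_nonneg ((h.smooth_u.ham hT hH).mul h.smooth_m) hTm fun t ht =>
      integral_torus_nonneg fun x =>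
        mul_nonneg (zero_le_one.trans (one_le_ham hH t x)) (hm0 t ht x)
  have n2 : 0 ≤ stInt d T (fun t x => source T H u t x * m t x) :=
    stInt_nonneg ((h.smooth_u.source hT hH).mul h.smooth_m) hTm fun t ht =>
      h.integral_source_mul_nonneg hT hH hdata hη ht (hm0 t ht)
  have e1 := h1 ε u m h
  have e2 := h2 ε u m h
  have n3 := mul_nonneg hc.le n1
  refine ⟨le_max_of_le_left ?_, le_max_of_le_right (le_max_of_le_left ?_), ?_⟩
  · rw [le_div_iff₀ hc]
    linarith
  · linarith
  · have := (le_max_right (2 * (C₁ + C₂)) C₁).trans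
      (le_max_right ((C₁ + C₂) / c) (max (2 * (C₁ + C₂)) C₁))
    linarith

/-- The quantity equals -∫ u(0) Δm₀, whose weight has no sign. For small s, however, ν = m₀ - sΔm₀
stays above κ/2 and is an admissible test density. Subtracting the lower bound for ∫ u(0)m₀ from the
upper bound for ∫ u(0)ν isolates the wanted term. -/
theorem initial_laplacian_bound (hT : 0 < T) (hα : 0 < α) (hH : IsHamiltonian H)
    (hL : LagrangianBound H) (hD : DerivativeBounds H) (hdata : IsData uT m0)
    (hη : IsMollifier η) :
    ∃ C : ℝ, ∀ ε u m, IsSolution T α H uT m0 η ε u m →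
      - ∫ x, lap (u 0) x * m0 x ∂(torusMeasure d) ≤ C := by
  obtain ⟨C₁, h1⟩ := first_order_estimates hT hα hH hL hD hdata hη
  obtain ⟨κ, hκ, hκm⟩ := hdata.m0_lower
  obtain ⟨B, hB0, hB⟩ := hdata.m0_periodic.lap.bounded (contDiff_lap hdata.m0_smooth).continuous
  set s := κ / (2 * (B + 1)) with hs
  have hs0 : 0 < s := by positivity
  have hsB : s * B ≤ κ / 2 := by
    rw [hs, div_mul_eq_mul_div, div_le_iff₀ (by positivity)]
    nlinarith
  have hν : ContDiff ℝ ∞ fun x => m0 x - s * lap m0 x :=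
    hdata.m0_smooth.sub (contDiff_const.mul (contDiff_lap hdata.m0_smooth))
  have hνp : TorusPeriodic fun x => m0 x - s * lap m0 x := fun i x => by
    simp only [hdata.m0_periodic i x, hdata.m0_periodic.lap i x]
  obtain ⟨C₂, h2⟩ := initial_upper_bound hT hα hH hD hdata hη hν hνp (half_pos hκ)
    (fun x => by
      have e1 := hκm x
      have e2 := mul_le_mul_of_nonneg_left ((le_abs_self _).trans (hB x)) hs0.le
      linarith) (δ := 1) one_pos
  refine ⟨(C₂ + 2 * C₁) / s, fun ε u m h => ?_⟩
  have h0m : (0 : ℝ) ∈ Icc 0 T := ⟨le_rfl, hT.le⟩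
  have hu := h.smooth_u.slice h0m
  rw [← integral_mul_lap_comm hu (h.u_periodic 0 h0m) hdata.m0_smooth hdata.m0_periodic]
  obtain ⟨-, e2, e3⟩ := h1 ε u m h
  have e4 := h2 ε u m h
  have huc := hu.continuous
  have hmc := hdata.m0_smooth.continuous
  have hlc := (contDiff_lap hdata.m0_smooth).continuous
  have e5 : ∀ x, u 0 x * (m0 x - s * lap m0 x) = u 0 x * m0 x - s * (u 0 x * lap m0 x) :=
    fun x => by ring
  simp only [e5] at e4
  rw [integral_torus_sub (by fun_prop) (by fun_prop), integral_const_mul] at e4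
  rw [le_div_iff₀ hs0]
  linarith

end FirstOrder

end MFG

namespace MFG

/-! ### Second-order estimates -/

section SecondOrder

variable {d : ℕ}

/-- The Hessian matrix. -/
noncomputable def hess (f : Sp d → ℝ) (x : Sp d) : Matrix (Fin d) (Fin d) ℝ :=
  Matrix.of fun i j => pd i (pd j f) x

theorem hess_isSymm {f : Sp d → ℝ} (hf : ContDiff ℝ ∞ f) (x : Sp d) : (hess f x).IsSymm := by
  ext i j
  exact pd_comm hf j i x

variable {H : Sp d → Sp d → ℝ}

/-- The chain rule for the Laplacian of `H (x, Df)`. -/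
theorem lap_along (hH : PhaseSmooth H) {f : Sp d → ℝ} (hf : ContDiff ℝ ∞ f) (x : Sp d) :
    lap (fun y => H y (gradient f y)) x = (DxxH H x (gradient f x)).trace +
      2 * (DpxH H x (gradient f x) * hess f x).trace +
      (DppH H x (gradient f x) * hess f x * hess f x).trace +
      ∑ k, dp k H x (gradient f x) * pd k (lap f) x := by
  set p := gradient f x with hp
  have hpp := fun i j => contDiff_pd (contDiff_pd hf i) j
  have h1 : ∀ i, pd i (pd i (fun y => H y (gradient f y))) x =
      dx i (dx i H) x p + ∑ k, dp k (dx i H) x p * pd i (pd k f) x +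
      ∑ k, ((dx i (dp k H) x p + ∑ l, dp l (dp k H) x p * pd i (pd l f) x) * pd i (pd k f) x +
        dp k H x p * pd i (pd i (pd k f)) x) := by
    intro i
    have e : pd i (fun y => H y (gradient f y)) = fun y => dx i H y (gradient f y) +
        ∑ k, dp k H y (gradient f y) * pd i (pd k f) y := funext fun y => pd_along hH hf i y
    have s1 : ∀ k, ContDiff ℝ ∞ fun y => dp k H y (gradient f y) := fun k =>
      contDiff_along (hH.dp k) hf
    have s2 : ∀ k, ContDiff ℝ ∞ fun y => dp k H y (gradient f y) * pd i (pd k f) y := fun k =>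
      (s1 k).mul (hpp k i)
    rw [e, pd_add ((contDiff_along (hH.dx i) hf).differentiable (by simp) x)
      ((ContDiff.sum fun k _ => s2 k).differentiable (by simp) x),
      pd_along (hH.dx i) hf, pd_sum fun k => (s2 k).differentiable (by simp) x]
    congr 1
    refine Finset.sum_congr rfl fun k _ => ?_
    rw [pd_mul ((s1 k).differentiable (by simp) x) ((hpp k i).differentiable (by simp) x),
      pd_along (hH.dp k) hf]
  -- Third derivatives are reordered to assemble the transport term D_pH · D(Δf), which later
  -- cancels against the Fokker–Planck drift.
  have h2 : ∀ k, pd k (lap f) x = ∑ i, pd i (pd i (pd k f)) x := by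
    intro k
    change pd k (fun y => ∑ i, pd i (pd i f) y) x = _
    rw [pd_sum fun i => (hpp i i).differentiable (by simp) x]
    refine Finset.sum_congr rfl fun i _ => ?_
    rw [pd_comm (contDiff_pd hf i)]
    congr 1
    funext y
    exact pd_comm hf k i y
  have h3 : (DxxH H x p).trace = ∑ i, dx i (dx i H) x p := rfl
  have h4 : (DpxH H x p * hess f x).trace = ∑ i, ∑ k, dp k (dx i H) x p * pd i (pd k f) x := by
    rw [Finset.sum_comm]
    rfl
  have h5 : (DppH H x p * hess f x * hess f x).trace =
      ∑ i, ∑ k, (∑ l, dp l (dp k H) x p * pd i (pd l f) x) * pd i (pd k f) x := by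
    rw [Matrix.trace_mul_comm]
    simp only [Matrix.trace, Matrix.diag, Matrix.mul_apply, Finset.sum_mul, Finset.mul_sum]
    refine Finset.sum_congr rfl fun i _ => ?_
    rw [Finset.sum_comm]
    refine Finset.sum_congr rfl fun k _ => Finset.sum_congr rfl fun l _ => ?_
    have := pd_comm hf k i x
    change pd i (pd l f) x * (dp l (dp k H) x p * pd k (pd i f) x) = _
    rw [this]
    ring
  have h6 : ∑ k, dp k H x p * pd k (lap f) x =
      ∑ i, ∑ k, dp k H x p * pd i (pd i (pd k f)) x := by
    simp only [h2, Finset.mul_sum]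
    exact Finset.sum_comm
  rw [h3, h4, h5, h6]
  simp only [lap, h1, add_mul, Finset.sum_add_distrib, dx_dp_comm hH]
  ring

/-- The quantity `tr (D²_pp H (D²u)²)`. -/
noncomputable def dissip (H : Sp d → Sp d → ℝ) (u : ℝ → Sp d → ℝ) (t : ℝ) (x : Sp d) : ℝ :=
  (DppH H x (gradient (u t) x) * hess (u t) x * hess (u t) x).trace

theorem SmoothST.dissip {T : ℝ} {u : ℝ → Sp d → ℝ} (hT : 0 < T) (hH : IsHamiltonian H)
    (hu : SmoothST T u) : SmoothST T (dissip H u) := by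
  have h : MFG.dissip H u = fun t x => ∑ i, ∑ j, (∑ k, MFG.dp i (MFG.dp k H) x (gradient (u t) x) *
      MFG.pd k (MFG.pd j (u t)) x) * MFG.pd j (MFG.pd i (u t)) x := by
    funext t x
    simp only [MFG.dissip, Matrix.trace, Matrix.diag, Matrix.mul_apply]
    rfl
  rw [h]
  exact SmoothST.sum fun i => SmoothST.sum fun j => (SmoothST.sum fun k =>
    (SmoothST.along ((PhaseSmooth.dp hH.smooth k).dp i) hT hu).mul ((hu.pd hT j).pd hT k)).mul
      ((hu.pd hT i).pd hT j)

theorem abs_entry_le_matNorm (A : Matrix (Fin d) (Fin d) ℝ) (i j : Fin d) :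
    |A i j| ≤ matNorm A := by
  refine Real.abs_le_sqrt ?_
  calc A i j ^ 2 ≤ ∑ j, A i j ^ 2 :=
        Finset.single_le_sum (f := fun j => A i j ^ 2) (fun _ _ => sq_nonneg _) (Finset.mem_univ j)
    _ ≤ _ := Finset.single_le_sum (f := fun i => ∑ j, A i j ^ 2)
        (fun _ _ => Finset.sum_nonneg fun _ _ => sq_nonneg _) (Finset.mem_univ i)

theorem abs_trace_le_matNorm (A : Matrix (Fin d) (Fin d) ℝ) : |A.trace| ≤ d * matNorm A := by
  calc |A.trace| ≤ ∑ i, |A i i| := Finset.abs_sum_le_sum_abs _ _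
    _ ≤ ∑ _ : Fin d, matNorm A := Finset.sum_le_sum fun i _ => abs_entry_le_matNorm A i i
    _ = _ := by simp

/-- The lower-order terms in `Δ (H (x, Df))` are controlled by the dissipation and by `H`. -/
theorem exists_second_order_lower_bound (hH : IsHamiltonian H) (hD : DerivativeBounds H) :
    ∃ C : ℝ, ∀ x p (M : Matrix (Fin d) (Fin d) ℝ), M.IsSymm →
      1 / 2 * (DppH H x p * M * M).trace - C * H x p ≤
        (DxxH H x p).trace + 2 * (DpxH H x p * M).trace + (DppH H x p * M * M).trace := by
  obtain ⟨C, hC⟩ := hD.x_bounds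
  obtain ⟨C', hC'⟩ := hD.px_bound (1 / 8) (by norm_num)
  refine ⟨d * (2 * max C 0) + C', fun x p M hM => ?_⟩
  -- The sign of -2M turns the one-sided hypothesis into a lower bound for 2 tr(D²_px H M). As
  -- (-2M)² = 4M², the choice δ = 1/8 costs exactly half of the dissipation.
  have h1 := hC' x p ((-2 : ℝ) • M) (hM.smul _)
  have h2 : ((-2 : ℝ) • M) ^ 2 = (4 : ℝ) • (M * M) := by
    rw [pow_two, Matrix.smul_mul, Matrix.mul_smul, smul_smul]
    norm_num
  rw [h2, Matrix.mul_smul, Matrix.mul_smul, Matrix.trace_smul, Matrix.trace_smul, ← Matrix.mul_assoc]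
    at h1
  simp only [smul_eq_mul] at h1
  have h3 := abs_trace_le_matNorm (DxxH H x p)
  have h4 : matNorm (DxxH H x p) ≤ 2 * max C 0 * H x p := by
    have h5 := hH.one_le x p
    have h6 := mul_le_mul_of_nonneg_right (le_max_left C 0) (zero_le_one.trans h5)
    have h7 := mul_le_mul_of_nonneg_left h5 (le_max_right C 0)
    linarith [(hC x p).2, le_max_left C 0]
  have h5 := mul_le_mul_of_nonneg_left h4 (Nat.cast_nonneg (α := ℝ) d)
  have h6 := (abs_le.1 h3).1
  linarith

variable {T α : ℝ} {uT m0 η : Sp d → ℝ} {ε : ℝ} {u m : ℝ → Sp d → ℝ}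

/-- Apply Δ to the Hamilton–Jacobi equation and test with m. The products ΔuΔm cancel and the drift
is integrated by parts; equality becomes inequality by dropping the coupling term -∫ g_ε(m) Δm,
nonnegative by weak monotonicity. -/
theorem IsSolution.integral_dt_lap_mul_ge (hT : 0 < T) (hα : 0 < α) (hH : IsHamiltonian H)
    (hdata : IsData uT m0) (hη : IsMollifier η) (h : IsSolution T α H uT m0 η ε u m)
    {t : ℝ} (ht : t ∈ Ioo 0 T) :
    ∫ x, (lap (ham H u t) x - ∑ k, vel H u k t x * pd k (lap (u t)) x) * m t x ∂(torusMeasure d) ≤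
      ∫ x, dt T (fun t x => lap (u t) x * m t x) t x ∂(torusMeasure d) := by
  have htt := Ioo_subset_Icc_self ht
  have hu := h.smooth_u.slice htt
  have hm := h.smooth_m.slice htt
  have hup := h.u_periodic t htt
  have hmp := h.m_periodic t htt
  have hv : ∀ k, ContDiff ℝ ∞ (vel H u k t) := fun k => (h.smooth_u.vel hT hH k).slice htt
  have hvp : ∀ k, TorusPeriodic (vel H u k t) := fun k => vel_periodic hH hup k
  have hS := (h.smooth_u.source hT hH).slice htt
  have hSp : TorusPeriodic (source T H u t) := by
    rw [h.source_eq ht]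
    exact (periodic_mollify_rpow η α ε hmp).mollify η ε
  have hHs := (h.smooth_u.ham hT hH).slice htt
  have hHp : TorusPeriodic (ham H u t) := periodic_along hH.periodic hup
  have hd := (h.smooth_u.dt hT).slice htt
  have hdp := h.smooth_u.dt_periodic h.u_periodic ht
  have hl := contDiff_lap hu
  have hlm := (contDiff_lap hm).continuous
  have hlH := (contDiff_lap hHs).continuous
  have hld := (contDiff_lap hd).continuous
  have hSc := hS.continuous
  have hHc := hHs.continuous
  have hdc := hd.continuous
  have hlu := hl.continuous
  have hmc := hm.continuous
  have hvc := fun k => (hv k).continuous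
  have hpl := fun k => (contDiff_pd hl k).continuous
  have hpmv := fun k => (contDiff_pd (hm.mul (hv k)) k).continuous
  have e1 : ∀ x, dt T (fun t x => lap (u t) x * m t x) t x =
      lap (dt T u t) x * m t x + (lap (u t) x * lap (m t) x +
        ∑ k, lap (u t) x * pd k (fun y => m t y * vel H u k t y) x) := by
    intro x
    rw [(h.smooth_u.lap hT).dt_mul h.smooth_m ht, h.smooth_u.dt_lap hT ht, h.fp ht,
      ← Finset.mul_sum]
    ring
  have e2 : ∫ x, lap (dt T u t) x * m t x ∂(torusMeasure d) =
      ∫ x, ham H u t x * lap (m t) x ∂(torusMeasure d) -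
      ∫ x, lap (u t) x * lap (m t) x ∂(torusMeasure d) -
      ∫ x, source T H u t x * lap (m t) x ∂(torusMeasure d) := by
    rw [← integral_mul_lap_comm hd hdp hm hmp, ← integral_torus_sub (by fun_prop) (by fun_prop),
      ← integral_torus_sub (by fun_prop) (by fun_prop)]
    congr 1
    funext x
    rw [source]
    ring
  have e3 : ∀ k, ∫ x, lap (u t) x * pd k (fun y => m t y * vel H u k t y) x ∂(torusMeasure d) =
      - ∫ x, pd k (lap (u t)) x * (m t x * vel H u k t x) ∂(torusMeasure d) := fun k =>
    integral_mul_pd hl hup.lap (hm.mul (hv k)) (hmp.mul (hvp k)) k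
  have e4 : ∀ x, (lap (ham H u t) x - ∑ k, vel H u k t x * pd k (lap (u t)) x) * m t x =
      lap (ham H u t) x * m t x - ∑ k, pd k (lap (u t)) x * (m t x * vel H u k t x) := by
    intro x
    rw [sub_mul, Finset.sum_mul]
    congr 1
    exact Finset.sum_congr rfl fun k _ => by ring
  have e5 : 0 ≤ - ∫ x, source T H u t x * lap (m t) x ∂(torusMeasure d) := by
    rw [integral_mul_lap hS hSp hm hmp, neg_neg, integral_torus_sum (f := fun i x => pd i (source T H u t) x * pd i (m t) x) (fun i =>
      (contDiff_pd hS i).continuous.mul (contDiff_pd hm i).continuous)]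
    refine Finset.sum_nonneg fun i _ => ?_
    -- Smoothness of the coupling is inherited from the equation through `source`, so ε = 0 needs no
    -- separate treatment.
    have hS' := hS
    rw [h.source_eq ht] at hS' ⊢
    have := integral_pd_coupling_nonneg hη hα ε hm hmp
      (fun x => (h.m_pos hT hH hdata t htt x).le) hS' i
    simpa only [mul_comm] using this
  simp only [e1, e4]
  rw [integral_torus_sub (by fun_prop) (by fun_prop), integral_torus_add (by fun_prop)
    (by fun_prop), integral_torus_add (by fun_prop) (by fun_prop),
    integral_torus_sum (fun k => by fun_prop), integral_torus_sum (fun k => by fun_prop), e2,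
    Finset.sum_congr rfl fun k _ => e3 k, Finset.sum_neg_distrib,
    integral_mul_lap_comm hHs hHp hm hmp]
  linarith

/-- Half of the dissipation survives the lower-order terms, which cost a multiple of ∫∫ Hm. After
integration in time the end terms are controlled by Δu_T and by `initial_laplacian_bound`. -/
theorem second_order_estimate (hT : 0 < T) (hα : 0 < α) (hH : IsHamiltonian H)
    (hL : LagrangianBound H) (hD : DerivativeBounds H) (hdata : IsData uT m0)
    (hη : IsMollifier η) :
    ∃ C : ℝ, ∀ ε u m, IsSolution T α H uT m0 η ε u m →
      stInt d T (fun t x => dissip H u t x * m t x) ≤ C := by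
  obtain ⟨C₁, h1⟩ := first_order_estimates hT hα hH hL hD hdata hη
  obtain ⟨C₂, h2⟩ := initial_laplacian_bound hT hα hH hL hD hdata hη
  obtain ⟨C₃, h3⟩ := exists_second_order_lower_bound hH hD
  obtain ⟨B, hB0, hB⟩ := hdata.uT_periodic.lap.bounded (contDiff_lap hdata.uT_smooth).continuous
  refine ⟨2 * (max C₃ 0 * C₁ + B + C₂), fun ε u m h => ?_⟩
  have hTm : T ∈ Icc 0 T := ⟨hT.le, le_rfl⟩
  have hWm := (h.smooth_u.dissip hT hH).mul h.smooth_m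
  have hHm := (h.smooth_u.ham hT hH).mul h.smooth_m
  have hlm := (h.smooth_u.lap hT).mul h.smooth_m
  have key := stInt_mono (d := d) ((hWm.const_mul (1 / 2)).add (hHm.const_mul (-max C₃ 0)))
    (hlm.dt hT) hTm ?_
  · rw [(hWm.const_mul (1 / 2)).stInt_add (hHm.const_mul (-max C₃ 0)) hTm, stInt_const_mul,
      stInt_const_mul, hlm.stInt_dt hT hTm] at key
    have e1 : ∫ x, lap (u T) x * m T x ∂(torusMeasure d) ≤ B := by
      have : u T = uT := funext h.terminal
      rw [this]
      exact h.integral_mul_m_le hT hH hdata hTm (contDiff_lap hdata.uT_smooth).continuous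
        fun x => (le_abs_self _).trans (hB x)
    have e2 := h2 ε u m h
    have e3 := mul_le_mul_of_nonneg_left (h1 ε u m h).1 (le_max_right C₃ 0)
    simp only [h.initial] at key
    linarith
  · intro t ht
    have htt := Ioo_subset_Icc_self ht
    refine le_trans ?_ (h.integral_dt_lap_mul_ge hT hα hH hdata hη ht)
    have hu := h.smooth_u.slice htt
    have c1 := (hWm.slice htt).continuous
    have c2 := (hHm.slice htt).continuous
    have c3 := (contDiff_lap ((h.smooth_u.ham hT hH).slice htt)).continuous
    have c4 := fun k => ((h.smooth_u.vel hT hH k).slice htt).continuous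
    have c5 := fun k => (contDiff_pd (contDiff_lap hu) k).continuous
    have c6 := (h.smooth_m.slice htt).continuous
    refine integral_torus_mono (by fun_prop) (by fun_prop) fun x => ?_
    have e1 := lap_along hH.smooth hu x
    have e2 := h3 x (gradient (u t) x) (hess (u t) x) (hess_isSymm hu x)
    have e3 := mul_le_mul_of_nonneg_right (le_max_left C₃ 0)
      (zero_le_one.trans (one_le_ham (u := u) hH t x))
    have e4 : 1 / 2 * dissip H u t x - max C₃ 0 * ham H u t x ≤
        lap (ham H u t) x - ∑ k, vel H u k t x * pd k (lap (u t)) x := by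
      have e5 : lap (ham H u t) x = lap (fun y => H y (gradient (u t) y)) x := rfl
      rw [e5, e1]
      simp only [ham, vel, dissip] at e3 ⊢
      linarith
    have := mul_le_mul_of_nonneg_right e4 (h.m_pos hT hH hdata t htt x).le
    linarith

end SecondOrder

end MFG

namespace MFG

/-! ### The Gagliardo–Nirenberg inequality on the torus -/

section GagliardoNirenberg

open scoped NNReal ENNReal

variable {d : ℕ}

theorem unitCell_mem_nhds_center (d : ℕ) :
    unitCell d ∈ nhds (WithLp.toLp 2 fun _ => 1 / 2 : Sp d) := by
  have h : IsOpen {x : Sp d | ∀ i, x i ∈ Ioo (0 : ℝ) 1} := by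
    have h1 : {x : Sp d | ∀ i, x i ∈ Ioo (0 : ℝ) 1} =
        ⋂ i, (fun x : Sp d => x i) ⁻¹' Ioo (0 : ℝ) 1 := by
      ext x
      simp
    rw [h1]
    exact isOpen_iInter_of_finite fun i => isOpen_Ioo.preimage (by fun_prop)
  refine mem_of_superset (h.mem_nhds fun i => ?_) fun x hx i => Ioo_subset_Icc_self (hx i)
  norm_num

open scoped Pointwise in
-- Finitely many translated cells cover K, and each contributes one torus integral; N counts them.
theorem setIntegral_compact_le {K : Set (Sp d)} (hK : IsCompact K) :
    ∃ N : ℝ, 0 ≤ N ∧ ∀ g : Sp d → ℝ, Continuous g → TorusPeriodic g → (∀ x, 0 ≤ g x) →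
      ∫ x in K, g x ≤ N * ∫ x, g x ∂(torusMeasure d) := by
  have key : ∃ N : ℝ≥0, ∀ g : Sp d → ℝ, Continuous g → TorusPeriodic g → (∀ x, 0 ≤ g x) →
      ∫⁻ x in K, ENNReal.ofReal (g x) ≤ N * ENNReal.ofReal (∫ x, g x ∂(torusMeasure d)) := by
    refine hK.induction_on (p := fun s => ∃ N : ℝ≥0, ∀ g : Sp d → ℝ, Continuous g →
      TorusPeriodic g → (∀ x, 0 ≤ g x) →
      ∫⁻ x in s, ENNReal.ofReal (g x) ≤ N * ENNReal.ofReal (∫ x, g x ∂(torusMeasure d)))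
      ⟨0, by simp⟩ ?_ ?_ ?_
    · rintro s t hst ⟨N, hN⟩
      exact ⟨N, fun g hg hp h0 => (lintegral_mono_set hst).trans (hN g hg hp h0)⟩
    · rintro s t ⟨N, hN⟩ ⟨N', hN'⟩
      refine ⟨N + N', fun g hg hp h0 => (lintegral_union_le _ _ _).trans ?_⟩
      rw [ENNReal.coe_add, add_mul]
      exact add_le_add (hN g hg hp h0) (hN' g hg hp h0)
    · intro x _
      set c : Sp d := WithLp.toLp 2 fun _ => 1 / 2
      refine ⟨(x - c) +ᵥ unitCell d, mem_nhdsWithin_of_mem_nhds ?_, 1, fun g hg hp h0 => ?_⟩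
      · have := vadd_mem_nhds_vadd (x - c) (unitCell_mem_nhds_center d)
        simpa [c] using this
      · rw [← ofReal_integral_eq_lintegral_ofReal
          (hg.continuousOn.integrableOn_compact ((isCompact_unitCell d).vadd _)) (ae_of_all _ h0),
          setIntegral_vadd_unitCell hp]
        simp [torusMeasure]
  obtain ⟨N, hN⟩ := key
  refine ⟨N, N.2, fun g hg hp h0 => ?_⟩
  have h := hN g hg hp h0
  rw [← ofReal_integral_eq_lintegral_ofReal (hg.continuousOn.integrableOn_compact hK)
    (ae_of_all _ h0), ← ENNReal.ofReal_coe_nnreal,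
    ← ENNReal.ofReal_mul (NNReal.coe_nonneg N)] at h
  exact (ENNReal.ofReal_le_ofReal_iff (mul_nonneg N.2 (integral_torus_nonneg h0))).1 h

/-- Apply the Sobolev inequality to w^k with k = 1 + 2/d. Its gradient is k w^(2/d) Dw, which Hölder
splits into an L^d norm, a multiple of (∫ w²)^(1/d), and the L² norm of Dw; then square. -/
theorem gagliardo_nirenberg_space (hd : 2 ≤ d) :
    ∃ K : ℝ, 0 ≤ K ∧ ∀ w : Sp d → ℝ, ContDiff ℝ ∞ w → HasCompactSupport w → (∀ x, 0 ≤ w x) →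
      ∫ x, w x ^ (2 + 4 / (d : ℝ)) ≤
        K * ((∫ x, w x ^ 2) ^ (2 / (d : ℝ)) * ∫ x, ‖fderiv ℝ w x‖ ^ 2) := by
  have hd0 : (0 : ℝ) < d := by positivity
  have hd2 : (2 : ℝ) ≤ d := by exact_mod_cast hd
  set k : ℝ := 1 + 2 / d with hk
  have hk1 : 1 ≤ k := by
    have : 0 ≤ 2 / (d : ℝ) := by positivity
    linarith
  -- The exponent whose Sobolev conjugate is 2; equally 1/p = 1/d + 1/2, as Hölder requires. The
  -- condition p ≥ 1 is d ≥ 2.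
  set p : ℝ≥0 := 2 * d / (d + 2) with hp
  have hdn : (d : ℝ≥0) ≠ 0 := by exact_mod_cast (by omega : d ≠ 0)
  have hp1 : 1 ≤ p := by
    rw [hp, one_le_div (by positivity)]
    have : (2 : ℝ≥0) ≤ d := by exact_mod_cast hd
    calc (d : ℝ≥0) + 2 ≤ d + d := by gcongr
      _ = 2 * d := by ring
  have hp0 : p ≠ 0 := (zero_lt_one.trans_le hp1).ne'
  have htriple : ENNReal.HolderTriple (((d : ℝ≥0) : ℝ≥0∞)) ((2 : ℝ≥0) : ℝ≥0∞) (p : ℝ≥0∞) := by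
    constructor
    rw [← ENNReal.coe_inv hdn, ← ENNReal.coe_inv two_ne_zero, ← ENNReal.coe_inv hp0,
      ← ENNReal.coe_add, ENNReal.coe_inj, hp]
    field_simp
    ring
  set S : ℝ≥0 := SNormLESNormFDerivOfEqConst ℝ (volume : Measure (Sp d)) p with hS
  refine ⟨(S * k) ^ 2, by positivity, fun w hw hwc hw0 => ?_⟩
  have hwcont := hw.continuous
  set φ : Sp d → ℝ := fun x => k * w x ^ (2 / (d : ℝ)) with hφ
  have hv1 : ContDiff ℝ 1 fun x => w x ^ k := by
    have := ContDiff.rpow_const_of_le (m := 1) (p := k) (hw.of_le (by simp)) (by simpa using hk1)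
    simpa using this
  have hk0 : k ≠ 0 := (zero_lt_one.trans_le hk1).ne'
  have hvc : HasCompactSupport fun x => w x ^ k :=
    hwc.comp_left (g := fun z : ℝ => z ^ k) (Real.zero_rpow hk0)
  have hfd : fderiv ℝ (fun x => w x ^ k) = φ • fderiv ℝ w := by
    funext x
    have h1 := ((hw.differentiable (by simp) x).hasFDerivAt.rpow_const (p := k) (Or.inr hk1)).fderiv
    rw [h1, hk]
    simp [hφ, hk]
  have hwd : Continuous (fderiv ℝ w) := hw.continuous_fderiv (by simp)
  have hφc : Continuous φ :=
    continuous_const.mul (hwcont.rpow_const fun _ => Or.inr (by positivity))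
  have hφs : HasCompactSupport φ := hwc.comp_left (g := fun z : ℝ => k * z ^ (2 / (d : ℝ)))
    (by rw [Real.zero_rpow (by positivity), mul_zero])
  have hholder : eLpNorm (fderiv ℝ fun x => w x ^ k) p volume ≤
      eLpNorm φ ((d : ℝ≥0) : ℝ≥0∞) volume * eLpNorm (fderiv ℝ w) ((2 : ℝ≥0) : ℝ≥0∞) volume := by
    rw [hfd]
    exact eLpNorm_smul_le_mul_eLpNorm (hpqr := htriple) hwd.aestronglyMeasurable
      hφc.aestronglyMeasurable
  have hsob : eLpNorm (fun x => w x ^ k) ((2 : ℝ≥0) : ℝ≥0∞) volume ≤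
      S * eLpNorm (fderiv ℝ fun x => w x ^ k) p volume :=
    eLpNorm_le_eLpNorm_fderiv_of_eq (volume : Measure (Sp d)) hv1 hvc hp1
      (by rw [finrank_euclideanSpace_fin]; omega) (by
        rw [finrank_euclideanSpace_fin, hp]
        push_cast
        field_simp
        ring)
  have hmain := hsob.trans (mul_le_mul_right hholder _)
  have hd1 : Continuous fun x => w x ^ k := hv1.continuous
  have e1 : ((2 : ℝ≥0) : ℝ≥0∞) ≠ 0 := by simp
  have e2 : ((d : ℝ≥0) : ℝ≥0∞) ≠ 0 := by exact_mod_cast hdn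
  rw [MemLp.eLpNorm_eq_integral_rpow_norm e1 ENNReal.coe_ne_top
      (hd1.memLp_of_hasCompactSupport hvc),
    MemLp.eLpNorm_eq_integral_rpow_norm e2 ENNReal.coe_ne_top
      (hφc.memLp_of_hasCompactSupport hφs),
    MemLp.eLpNorm_eq_integral_rpow_norm e1 ENNReal.coe_ne_top
      (hwd.memLp_of_hasCompactSupport (hwc.fderiv ℝ)),
    ← ENNReal.ofReal_coe_nnreal (p := S), ← ENNReal.ofReal_mul (by positivity),
    ← ENNReal.ofReal_mul (by positivity), ENNReal.ofReal_le_ofReal_iff (by positivity)] at hmain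
  have i1 : ∀ x, ‖w x ^ k‖ ^ (2 : ℝ) = w x ^ (2 + 4 / (d : ℝ)) := by
    intro x
    rw [Real.norm_of_nonneg (Real.rpow_nonneg (hw0 x) _), ← Real.rpow_mul (hw0 x)]
    congr 1
    rw [hk]
    ring
  have i2 : ∀ x, ‖φ x‖ ^ (d : ℝ) = k ^ (d : ℝ) * w x ^ 2 := by
    intro x
    have h0 := Real.rpow_nonneg (hw0 x) (2 / (d : ℝ))
    rw [Real.norm_of_nonneg (by positivity), Real.mul_rpow (by positivity) h0,
      ← Real.rpow_mul (hw0 x), div_mul_cancel₀ _ hd0.ne', Real.rpow_two]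
  simp only [ENNReal.coe_toReal, NNReal.coe_natCast, NNReal.coe_ofNat, i1, i2,
    integral_const_mul] at hmain
  have n1 : 0 ≤ ∫ x, w x ^ (2 + 4 / (d : ℝ)) :=
    integral_nonneg fun x => Real.rpow_nonneg (hw0 x) _
  have n2 : 0 ≤ ∫ x, w x ^ 2 := integral_nonneg fun x => sq_nonneg _
  have n3 : 0 ≤ ∫ x, ‖fderiv ℝ w x‖ ^ 2 := integral_nonneg fun x => sq_nonneg _
  simp only [Real.rpow_two] at hmain
  rw [Real.mul_rpow (by positivity) n2, ← Real.rpow_mul (by positivity),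
    mul_inv_cancel₀ hd0.ne', Real.rpow_one] at hmain
  have hsq := pow_le_pow_left₀ (Real.rpow_nonneg n1 _) hmain 2
  have s1 : ∀ {a b : ℝ}, 0 ≤ a → (a ^ b) ^ 2 = a ^ (b * 2) := fun ha => by
    rw [← Real.rpow_natCast, ← Real.rpow_mul ha]
    norm_num
  rw [mul_pow, mul_pow, mul_pow, s1 n1, s1 n2, s1 n3, inv_mul_cancel₀ two_ne_zero, Real.rpow_one,
    Real.rpow_one, inv_mul_eq_div] at hsq
  calc _ ≤ _ := hsq
    _ = _ := by ring

theorem norm_fderiv_sq (f : Sp d → ℝ) (x : Sp d) : ‖fderiv ℝ f x‖ ^ 2 = ∑ i, pd i f x ^ 2 := by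
  have h : ‖gradient f x‖ = ‖fderiv ℝ f x‖ := by simp [gradient]
  rw [← h, EuclideanSpace.norm_sq_eq]
  simp only [gradient_apply, Real.norm_eq_abs, sq_abs]

/-- The Gagliardo–Nirenberg inequality on the torus. -/
theorem gagliardo_nirenberg_torus (hd : 2 ≤ d) :
    ∃ K : ℝ, 0 ≤ K ∧ ∀ f : Sp d → ℝ, ContDiff ℝ ∞ f → TorusPeriodic f → (∀ x, 0 ≤ f x) →
      ∫ x, f x ^ (2 + 4 / (d : ℝ)) ∂(torusMeasure d) ≤
        K * ((∫ x, f x ^ 2 ∂(torusMeasure d)) ^ (2 / (d : ℝ)) *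
          ∫ x, (∑ i, pd i f x ^ 2 + f x ^ 2) ∂(torusMeasure d)) := by
  obtain ⟨K, hK0, hK⟩ := gagliardo_nirenberg_space hd
  obtain ⟨R, hR⟩ := (isCompact_unitCell d).isBounded.exists_norm_le
  -- A cutoff equal to 1 on the cell makes f compactly supported; its derivative produces the
  -- zeroth-order term f².
  set χ : ContDiffBump (0 : Sp d) := ⟨max R 1, max R 1 + 1, by positivity, by linarith⟩ with hχ
  have hχ1 : ∀ x ∈ unitCell d, χ x = 1 := fun x hx =>
    χ.one_of_mem_closedBall (by
      rw [mem_closedBall_zero_iff]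
      exact (hR x hx).trans (le_max_left _ _))
  have hχs : ContDiff ℝ ∞ χ := χ.contDiff
  have hχc := χ.hasCompactSupport
  obtain ⟨B, hB⟩ := (hχc.fderiv ℝ).exists_bound_of_continuous (hχs.continuous_fderiv (by simp))
  have hB0 : 0 ≤ B := (norm_nonneg _).trans (hB 0)
  obtain ⟨N, hN0, hN⟩ := setIntegral_compact_le hχc
  refine ⟨K * (N ^ (2 / (d : ℝ)) * ((2 + 2 * B ^ 2) * N)), by positivity, fun f hf hfp hf0 => ?_⟩
  have hfc := hf.continuous
  have hpf := fun i => (contDiff_pd hf i).continuous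
  have hwd : ContDiff ℝ ∞ fun x => χ x * f x := hχs.mul hf
  have hws : HasCompactSupport fun x => χ x * f x := hχc.mul_right
  have hw0 : ∀ x, 0 ≤ χ x * f x := fun x => mul_nonneg χ.nonneg (hf0 x)
  have key := hK _ hwd hws hw0
  have hdpos : (0 : ℝ) < 2 + 4 / d := by positivity
  have h1 : ∫ x, f x ^ (2 + 4 / (d : ℝ)) ∂(torusMeasure d) ≤
      ∫ x, (χ x * f x) ^ (2 + 4 / (d : ℝ)) := by
    have e1 : ∫ x, f x ^ (2 + 4 / (d : ℝ)) ∂(torusMeasure d) =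
        ∫ x in unitCell d, (χ x * f x) ^ (2 + 4 / (d : ℝ)) :=
      setIntegral_congr_fun (measurableSet_unitCell d) fun x hx => by
        simp only [hχ1 x hx, one_mul]
    rw [e1]
    refine setIntegral_le_integral ?_ (ae_of_all _ fun x => Real.rpow_nonneg (hw0 x) _)
    exact (hwd.continuous.rpow_const fun _ => Or.inr hdpos.le).integrable_of_hasCompactSupport
      (hws.comp_left (g := fun z : ℝ => z ^ (2 + 4 / (d : ℝ))) (Real.zero_rpow hdpos.ne'))
  have hrestrict : ∀ g G : Sp d → ℝ, (∀ x, x ∉ tsupport χ → g x = 0) → (∀ x, g x ≤ G x) →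
      Continuous g → Continuous G → ∫ x, g x ≤ ∫ x in tsupport χ, G x := by
    intro g G hg hgG hgc hGc
    rw [← setIntegral_eq_integral_of_forall_compl_eq_zero hg]
    exact setIntegral_mono (hgc.continuousOn.integrableOn_compact hχc)
      (hGc.continuousOn.integrableOn_compact hχc) hgG
  have h2 : ∫ x, (χ x * f x) ^ 2 ≤ N * ∫ x, f x ^ 2 ∂(torusMeasure d) := by
    refine (hrestrict _ (fun x => f x ^ 2) (fun x hx => ?_) (fun x => ?_) (by fun_prop)
      (by fun_prop)).trans (hN _ (by fun_prop) (hfp.comp fun z => z ^ 2) fun x => sq_nonneg _)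
    · rw [image_eq_zero_of_notMem_tsupport hx]
      simp
    · exact pow_le_pow_left₀ (hw0 x) (mul_le_of_le_one_left (hf0 x) χ.le_one) 2
  have h3 : ∫ x, ‖fderiv ℝ (fun x => χ x * f x) x‖ ^ 2 ≤
      (2 + 2 * B ^ 2) * (N * ∫ x, (∑ i, pd i f x ^ 2 + f x ^ 2) ∂(torusMeasure d)) := by
    have hper : TorusPeriodic fun x => ∑ i, pd i f x ^ 2 + f x ^ 2 :=
      (TorusPeriodic.sum fun i => (hfp.pd i).comp fun z => z ^ 2).add (hfp.comp fun z => z ^ 2)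
    have e0 := hN _ (by fun_prop) hper fun x => by positivity
    have e1 := mul_le_mul_of_nonneg_left e0 (by positivity : (0 : ℝ) ≤ 2 + 2 * B ^ 2)
    refine le_trans ?_ e1
    rw [← integral_const_mul]
    have hcf := hwd.continuous_fderiv (by simp)
    refine hrestrict _ _ (fun x hx => ?_) (fun x => ?_) (by fun_prop) (by fun_prop)
    · have e2 : x ∉ tsupport (fun x => χ x * f x) := fun h => hx (tsupport_mul_subset_left h)
      rw [image_eq_zero_of_notMem_tsupport fun h => e2 (tsupport_fderiv_subset ℝ h)]
      simp
    · rw [fderiv_fun_mul (hχs.differentiable (by simp) x) (hf.differentiable (by simp) x)]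
      have e2 : ‖χ x • fderiv ℝ f x + f x • fderiv ℝ χ x‖ ≤ ‖fderiv ℝ f x‖ + f x * B := by
        refine (norm_add_le _ _).trans (add_le_add ?_ ?_)
        · rw [norm_smul, Real.norm_of_nonneg χ.nonneg]
          exact mul_le_of_le_one_left (norm_nonneg _) χ.le_one
        · rw [norm_smul, Real.norm_of_nonneg (hf0 x)]
          exact mul_le_mul_of_nonneg_left (hB x) (hf0 x)
      rw [← norm_fderiv_sq]
      calc _ ≤ (‖fderiv ℝ f x‖ + f x * B) ^ 2 := pow_le_pow_left₀ (norm_nonneg _) e2 2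
        _ ≤ 2 * ‖fderiv ℝ f x‖ ^ 2 + 2 * B ^ 2 * f x ^ 2 := by
          nlinarith [sq_nonneg (‖fderiv ℝ f x‖ - f x * B)]
        _ ≤ _ := by nlinarith [sq_nonneg (B * ‖fderiv ℝ f x‖), sq_nonneg (f x)]
  have n2 : 0 ≤ ∫ x, (χ x * f x) ^ 2 := integral_nonneg fun x => sq_nonneg _
  have n3 : 0 ≤ ∫ x, ‖fderiv ℝ (fun x => χ x * f x) x‖ ^ 2 := integral_nonneg fun x => sq_nonneg _
  have n4 : 0 ≤ ∫ x, f x ^ 2 ∂(torusMeasure d) := integral_torus_nonneg fun x => sq_nonneg _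
  have h4 : (∫ x, (χ x * f x) ^ 2) ^ (2 / (d : ℝ)) ≤
      N ^ (2 / (d : ℝ)) * (∫ x, f x ^ 2 ∂(torusMeasure d)) ^ (2 / (d : ℝ)) := by
    rw [← Real.mul_rpow hN0 n4]
    exact Real.rpow_le_rpow n2 h2 (by positivity)
  calc _ ≤ _ := h1
    _ ≤ _ := key
    _ ≤ K * ((N ^ (2 / (d : ℝ)) * (∫ x, f x ^ 2 ∂(torusMeasure d)) ^ (2 / (d : ℝ))) *
        ((2 + 2 * B ^ 2) * (N * ∫ x, (∑ i, pd i f x ^ 2 + f x ^ 2) ∂(torusMeasure d)))) :=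
      mul_le_mul_of_nonneg_left (mul_le_mul h4 h3 n3 (by positivity)) hK0
    _ = _ := by ring

end GagliardoNirenberg

end MFG

namespace MFG

/-! ### Integrability of the density -/

section Density

variable {d : ℕ} {H : Sp d → Sp d → ℝ}

/-- The superquadratic bounds control the divergence of the drift by the energy density. -/
theorem exists_trace_bound {μ : ℝ} (hμ0 : 0 < μ) (hH : IsHamiltonian H)
    (hS : SuperquadraticBounds μ H) :
    ∃ C : ℝ, 0 ≤ C ∧ ∀ x p (M : Matrix (Fin d) (Fin d) ℝ), M.IsSymm →
      0 ≤ (DppH H x p * M * M).trace ∧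
      |(DxpH H x p).trace + (DppH H x p * M).trace| ^ ((2 + μ) / (1 + μ)) ≤
        C * (H x p + (DppH H x p * M * M).trace) := by
  obtain ⟨C, hC⟩ := hS
  -- From (a+b)² ≤ 2a² + 2b², each trace costing d² times a squared matrix norm, bounded by C times
  -- the same power.
  set B : ℝ := 2 * d ^ 2 * max C 0 * 2 with hB
  have hB0 : 0 ≤ B := by positivity
  refine ⟨B ^ ((2 + μ) / (1 + μ) / 2), by positivity, fun x p M hM => ?_⟩
  have hH1 := hH.one_le x p
  have hH0 : 0 < H x p := zero_lt_one.trans_le hH1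
  obtain ⟨h1, h2⟩ := hC x p
  replace h2 := h2 M hM
  have hC0 : 0 ≤ C := by
    by_contra! hneg
    have h3 : 0 < H x p ^ ((2 + 2 * μ) / (2 + μ)) := by positivity
    nlinarith [sq_nonneg (matNorm (DxpH H x p))]
  -- The bound itself forces the sign: a square is at most C H^(μ/(2+μ)) times the trace. If C = 0,
  -- the matrix D²_pp H M vanishes.
  have hW : 0 ≤ (DppH H x p * M * M).trace := by
    rcases hC0.eq_or_lt with h | h
    · rw [← h, zero_mul, zero_mul] at h2
      have h3 : matNorm (DppH H x p * M) = 0 := pow_eq_zero_iff two_ne_zero |>.1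
        (le_antisymm h2 (sq_nonneg _))
      have h4 : DppH H x p * M = 0 := by
        ext i j
        have := abs_entry_le_matNorm (DppH H x p * M) i j
        rw [h3] at this
        simpa using abs_nonpos_iff.1 this
      rw [h4]
      simp
    · have h3 : 0 < C * H x p ^ (μ / (2 + μ)) := by positivity
      exact nonneg_of_mul_nonneg_right ((sq_nonneg _).trans h2) h3
  refine ⟨hW, ?_⟩
  -- Both contributions to the squared divergence scale like N^((2+2μ)/(2+μ)), since μ/(2+μ) + 1 is
  -- that exponent; the power (2+μ)/(2(1+μ)) returns exactly N.
  set N := H x p + (DppH H x p * M * M).trace with hN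
  have hN1 : 1 ≤ N := by linarith
  have hN0 : 0 < N := by linarith
  have hHN : H x p ≤ N := by linarith
  have hWN : (DppH H x p * M * M).trace ≤ N := by linarith
  have e1 : matNorm (DxpH H x p) ^ 2 ≤ C * N ^ ((2 + 2 * μ) / (2 + μ)) :=
    h1.trans (mul_le_mul_of_nonneg_left (Real.rpow_le_rpow hH0.le hHN (by positivity)) hC0)
  have e2 : matNorm (DppH H x p * M) ^ 2 ≤ C * N ^ ((2 + 2 * μ) / (2 + μ)) := by
    refine h2.trans ?_
    rw [mul_assoc]
    refine mul_le_mul_of_nonneg_left ?_ hC0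
    calc _ ≤ N ^ (μ / (2 + μ)) * N :=
          mul_le_mul (Real.rpow_le_rpow hH0.le hHN (by positivity)) hWN hW (by positivity)
      _ = N ^ (μ / (2 + μ) + 1) := by rw [Real.rpow_add hN0, Real.rpow_one]
      _ = _ := by
        congr 1
        field_simp
        ring
  set a := (DxpH H x p).trace
  set b := (DppH H x p * M).trace
  have e3 : |a + b| ^ 2 ≤ B * N ^ ((2 + 2 * μ) / (2 + μ)) := by
    have a1 := pow_le_pow_left₀ (abs_nonneg _) (abs_trace_le_matNorm (DxpH H x p)) 2
    have a2 := pow_le_pow_left₀ (abs_nonneg _) (abs_trace_le_matNorm (DppH H x p * M)) 2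
    rw [mul_pow, sq_abs] at a1 a2
    have a3 := mul_le_mul_of_nonneg_left e1 (sq_nonneg (d : ℝ))
    have a4 := mul_le_mul_of_nonneg_left e2 (sq_nonneg (d : ℝ))
    rw [sq_abs, hB, max_eq_left hC0]
    nlinarith [sq_nonneg (a - b)]
  calc |a + b| ^ ((2 + μ) / (1 + μ)) = (|a + b| ^ 2) ^ ((2 + μ) / (1 + μ) / 2) := by
        rw [← Real.rpow_natCast, ← Real.rpow_mul (abs_nonneg _)]
        congr 1
        push_cast
        ring
    _ ≤ (B * N ^ ((2 + 2 * μ) / (2 + μ))) ^ ((2 + μ) / (1 + μ) / 2) :=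
        Real.rpow_le_rpow (sq_nonneg _) e3 (by positivity)
    _ = _ := by
        rw [Real.mul_rpow hB0 (by positivity), ← Real.rpow_mul hN0.le]
        have : (2 + 2 * μ) / (2 + μ) * ((2 + μ) / (1 + μ) / 2) = 1 := by
          field_simp
        rw [this, Real.rpow_one]

theorem divVel_eq (hH : IsHamiltonian H) {u : ℝ → Sp d → ℝ} {t : ℝ} (hu : ContDiff ℝ ∞ (u t))
    (x : Sp d) : divVel H u t x = (DxpH H x (gradient (u t) x)).trace +
      (DppH H x (gradient (u t) x) * hess (u t) x).trace := by
  have h1 : ∀ k, pd k (vel H u k t) x = dx k (dp k H) x (gradient (u t) x) +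
      ∑ l, dp l (dp k H) x (gradient (u t) x) * pd k (pd l (u t)) x := fun k =>
    pd_along (PhaseSmooth.dp hH.smooth k) hu k x
  simp only [divVel, h1, Finset.sum_add_distrib]
  congr 1
  rw [Finset.sum_comm]
  rfl

/-! ### Evolution of powers of the density and closing the estimate. -/

variable {T α : ℝ} {uT m0 η : Sp d → ℝ} {ε : ℝ} {u m : ℝ → Sp d → ℝ}

theorem SmoothST.dt_rpow (hm : SmoothST T m) (hpos : ∀ t ∈ Icc 0 T, ∀ x, 0 < m t x) (R : ℝ)
    {t : ℝ} (ht : t ∈ Ioo 0 T) (x : Sp d) :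
    MFG.dt T (fun t x => m t x ^ R) t x = R * m t x ^ (R - 1) * MFG.dt T m t x := by
  have h1 := (hm.rpow_const hpos R).hasDerivAt ht x
  have h2 := (hm.hasDerivAt ht x).rpow_const (p := R)
    (Or.inl (hpos t (Ioo_subset_Icc_self ht) x).ne')
  rw [h1.unique h2]
  ring

theorem pd_rpow {f : Sp d → ℝ} (hf : Differentiable ℝ f) (hpos : ∀ x, 0 < f x) (a : ℝ) (i : Fin d)
    (x : Sp d) : pd i (fun y => f y ^ a) x = a * f x ^ (a - 1) * pd i f x :=
  pd_comp (Real.hasDerivAt_rpow_const (Or.inl (hpos x).ne')) (hf x) i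

/-- The evolution of the `L^R` norm of the density. -/
theorem IsSolution.integral_dt_rpow (hT : 0 < T) (hH : IsHamiltonian H) (hdata : IsData uT m0)
    (h : IsSolution T α H uT m0 η ε u m) {R : ℝ} (hR : 0 < R) {t : ℝ} (ht : t ∈ Ioo 0 T) :
    ∫ x, dt T (fun t x => m t x ^ R) t x ∂(torusMeasure d) =
      -(4 * (R - 1) / R) * ∫ x, ∑ i, pd i (fun y => m t y ^ (R / 2)) x ^ 2 ∂(torusMeasure d) +
        (R - 1) * ∫ x, m t x ^ R * divVel H u t x ∂(torusMeasure d) := by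
  have htt := Ioo_subset_Icc_self ht
  have hm := h.smooth_m.slice htt
  have hmp := h.m_periodic t htt
  have hpos := h.m_pos hT hH hdata
  have hp := hpos t htt
  have hmd : Differentiable ℝ (m t) := hm.differentiable (by simp)
  have hv : ∀ k, ContDiff ℝ ∞ (vel H u k t) := fun k => (h.smooth_u.vel hT hH k).slice htt
  have hvp : ∀ k, TorusPeriodic (vel H u k t) := fun k => vel_periodic hH (h.u_periodic t htt) k
  have hpow : ∀ a : ℝ, ContDiff ℝ ∞ fun y => m t y ^ a := fun a =>
    (h.smooth_m.rpow_const hpos a).slice htt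
  have hpowp : ∀ a : ℝ, TorusPeriodic fun y => m t y ^ a := fun a => hmp.comp fun z => z ^ a
  have cpow := fun a => (hpow a).continuous
  have cv := fun k => (hv k).continuous
  have clm := (contDiff_lap hm).continuous
  have cpm := fun k => (contDiff_pd hm k).continuous
  have cmv := fun k => (contDiff_pd (hm.mul (hv k)) k).continuous
  have cpp := fun a k => (contDiff_pd (hpow a) k).continuous
  have cpv := fun k => (contDiff_pd (hv k) k).continuous
  have e1 : ∀ x, dt T (fun t x => m t x ^ R) t x = R * (m t x ^ (R - 1) * lap (m t) x) +
      R * ∑ k, m t x ^ (R - 1) * pd k (fun y => m t y * vel H u k t y) x := by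
    intro x
    rw [h.smooth_m.dt_rpow hpos R ht, h.fp ht, ← Finset.mul_sum]
    ring
  have e2 : R * ∫ x, m t x ^ (R - 1) * lap (m t) x ∂(torusMeasure d) =
      -(4 * (R - 1) / R) * ∫ x, ∑ i, pd i (fun y => m t y ^ (R / 2)) x ^ 2 ∂(torusMeasure d) := by
    rw [integral_mul_lap (hpow (R - 1)) (hpowp (R - 1)) hm hmp, mul_neg, neg_mul,
      ← integral_const_mul, ← integral_const_mul]
    congr 2
    funext x
    rw [Finset.mul_sum, Finset.mul_sum]
    refine Finset.sum_congr rfl fun i _ => ?_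
    rw [pd_rpow hmd hp, pd_rpow hmd hp]
    have e3 : (m t x ^ (R / 2 - 1)) ^ 2 = m t x ^ (R - 1 - 1) := by
      rw [← Real.rpow_natCast, ← Real.rpow_mul (hp x).le]
      congr 1
      push_cast
      ring
    rw [mul_pow, mul_pow, e3]
    field_simp
    ring
  -- Integrated by parts, both sides become -R(R-1) ∫ m^(R-1) ∂_k m v_k, where v_k is the k-th
  -- component of D_pH(x,Du).
  have e4 : ∀ k, R * ∫ x, m t x ^ (R - 1) * pd k (fun y => m t y * vel H u k t y) x
      ∂(torusMeasure d) = (R - 1) * ∫ x, m t x ^ R * pd k (vel H u k t) x ∂(torusMeasure d) := by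
    intro k
    rw [integral_mul_pd (hpow (R - 1)) (hpowp (R - 1)) (hm.mul (hv k)) (hmp.mul (hvp k)),
      integral_mul_pd (hpow R) (hpowp R) (hv k) (hvp k), mul_neg, mul_neg, ← integral_const_mul,
      ← integral_const_mul]
    congr 2
    funext x
    rw [pd_rpow hmd hp, pd_rpow hmd hp]
    have e5 : m t x ^ (R - 1) = m t x ^ (R - 1 - 1) * m t x := by
      rw [← Real.rpow_add_one (hp x).ne', sub_add_cancel]
    rw [e5]
    ring
  have e6 : ∀ x, m t x ^ R * divVel H u t x = ∑ k, m t x ^ R * pd k (vel H u k t) x := fun x =>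
    Finset.mul_sum _ _ _
  simp only [e1, e6]
  rw [integral_torus_add (by fun_prop) (by fun_prop), integral_const_mul, integral_const_mul, e2,
    integral_torus_sum (f := fun k x => m t x ^ (R - 1) * pd k (fun y => m t y * vel H u k t y) x)
      (fun k => by fun_prop),
    integral_torus_sum (f := fun k x => m t x ^ R * pd k (vel H u k t) x) (fun k => by fun_prop),
    Finset.mul_sum Finset.univ _ R, Finset.sum_congr rfl fun k _ => e4 k, ← Finset.mul_sum]

/-- Young's inequality with a parameter, in the form needed for the transport term. -/
theorem mul_rpow_le_young {s s' θ a z β : ℝ} (hs : s.HolderConjugate s') (hθ : 0 < θ) (hz : 0 < z) :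
    z ^ (β + 1) * a ≤ θ ^ (-s) * (|a| ^ s * z) + θ ^ s' * z ^ (1 + β * s') := by
  -- The split z^(β+1) = z^(1/s) z^(β+1/s') leaves |a|^s with exactly one power of z, matching
  -- estimates available only against the measure m dx.
  have h := Real.young_inequality_of_nonneg (a := θ⁻¹ * (|a| * z ^ s⁻¹)) (b := θ * z ^ (β + s'⁻¹))
    (by positivity) (by positivity) hs
  have e1 : θ⁻¹ * (|a| * z ^ s⁻¹) * (θ * z ^ (β + s'⁻¹)) = z ^ (β + 1) * |a| := by
    have : z ^ (β + 1) = z ^ s⁻¹ * z ^ (β + s'⁻¹) := by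
      rw [← Real.rpow_add hz]
      congr 1
      linarith [hs.inv_add_inv_eq_one]
    rw [this]
    field_simp
  have e2 : (θ⁻¹ * (|a| * z ^ s⁻¹)) ^ s = θ ^ (-s) * (|a| ^ s * z) := by
    rw [Real.mul_rpow (by positivity) (by positivity), Real.mul_rpow (by positivity)
      (by positivity), ← Real.rpow_mul hz.le, inv_mul_cancel₀ hs.ne_zero, Real.rpow_one,
      Real.inv_rpow hθ.le, Real.rpow_neg hθ.le]
  have e3 : (θ * z ^ (β + s'⁻¹)) ^ s' = θ ^ s' * z ^ (1 + β * s') := by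
    rw [Real.mul_rpow hθ.le (by positivity), ← Real.rpow_mul hz.le, add_mul,
      inv_mul_cancel₀ hs.symm.ne_zero, add_comm]
  rw [e1, e2, e3] at h
  have h1 : θ ^ (-s) * (|a| ^ s * z) / s ≤ θ ^ (-s) * (|a| ^ s * z) :=
    div_le_self (by positivity) hs.lt.le
  have h2 : θ ^ s' * z ^ (1 + β * s') / s' ≤ θ ^ s' * z ^ (1 + β * s') :=
    div_le_self (by positivity) hs.symm.lt.le
  have h3 := mul_le_mul_of_nonneg_left (le_abs_self a) (Real.rpow_nonneg hz.le (β + 1))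
  linarith

theorem stInt_le_of_nonneg {F : ℝ → Sp d → ℝ} (hF : SmoothST T F) {τ : ℝ} (hτ : τ ∈ Icc 0 T)
    (h : ∀ t ∈ Icc 0 T, ∀ x, 0 ≤ F t x) : stInt d τ F ≤ stInt d T F := by
  have hT : T ∈ Icc 0 T := ⟨hτ.1.trans hτ.2, le_rfl⟩
  refine intervalIntegral.integral_mono_interval le_rfl hτ.1 hτ.2 ?_ (hF.intervalIntegrable hT)
  refine (ae_restrict_iff' measurableSet_Ioc).2 (ae_of_all _ fun t ht => ?_)
  exact integral_torus_nonneg fun x => h t ⟨ht.1.le, ht.2⟩ x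

/-- A sublinear power is absorbed: as (X+1)^γ ≥ 1, the added 1 only changes E into E+1, and dividing
by (X+1)^γ leaves a positive power of X+1. -/
theorem add_one_le_of_le_mul_rpow {X E γ : ℝ} (hX : 0 ≤ X) (hγ0 : 0 ≤ γ) (hγ : γ < 1)
    (h : X ≤ E * (X + 1) ^ γ) : X + 1 ≤ (E + 1) ^ (1 - γ)⁻¹ := by
  have hX1 : 0 < X + 1 := by linarith
  have h1 : 1 ≤ (X + 1) ^ γ := Real.one_le_rpow (by linarith) hγ0
  have h2 : X + 1 ≤ (E + 1) * (X + 1) ^ γ := by linarith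
  have h3 : (X + 1) ^ (1 - γ) ≤ E + 1 := by
    rw [Real.rpow_sub hX1, Real.rpow_one, div_le_iff₀ (by positivity)]
    exact h2
  have h4 : 0 < 1 - γ := by linarith
  calc X + 1 = ((X + 1) ^ (1 - γ)) ^ (1 - γ)⁻¹ := by
        rw [← Real.rpow_mul hX1.le, mul_inv_cancel₀ h4.ne', Real.rpow_one]
    _ ≤ _ := Real.rpow_le_rpow (by positivity) h3 (by positivity)

/-- The growth term is paired by Young's inequality: |div D_pH|^s m is controlled by the first- and
second-order estimates, and the remaining power of m is collected in X, whose exponent 1/(2+μ) is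
that of Hölder's inequality. -/
theorem energy_bound {μ : ℝ} (hμ0 : 0 < μ) (hT : 0 < T) (hα : 0 < α) (hH : IsHamiltonian H)
    (hL : LagrangianBound H) (hD : DerivativeBounds H) (hS : SuperquadraticBounds μ H)
    (hdata : IsData uT m0) (hη : IsMollifier η) {β : ℝ} (hβ : 0 < β) :
    ∃ B : ℝ, 0 ≤ B ∧ ∀ ε u m, IsSolution T α H uT m0 η ε u m → ∀ τ ∈ Icc 0 T,
      ∫ x, m τ x ^ (β + 1) ∂(torusMeasure d) + 4 * β / (β + 1) *
        stInt d τ (fun t x => ∑ i, pd i (fun y => m t y ^ ((β + 1) / 2)) x ^ 2) ≤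
      B * (stInt d T (fun t x => m t x ^ (1 + β * (2 + μ))) + 1) ^ (2 + μ)⁻¹ := by
  obtain ⟨C₁, h1⟩ := first_order_estimates hT hα hH hL hD hdata hη
  obtain ⟨C₂, h2⟩ := second_order_estimate hT hα hH hL hD hdata hη
  obtain ⟨C₃, hC₃, h3⟩ := exists_trace_bound hμ0 hH hS
  set A := ∫ x, m0 x ^ (β + 1) ∂(torusMeasure d) with hA
  have hA0 : 0 ≤ A := by
    obtain ⟨κ, hκ, hκm⟩ := hdata.m0_lower
    exact integral_torus_nonneg fun x => Real.rpow_nonneg (hκ.le.trans (hκm x)) _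
  set D := max (C₃ * (C₁ + C₂)) 0 with hDdef
  -- A comes from the initial density, D from the energy and dissipation bounds, and 1 from the
  -- second Young term; each multiplies Z = (X+1)^(1/(2+μ)) ≥ 1.
  refine ⟨A + β * (D + 1), by positivity, fun ε u m h τ hτ => ?_⟩
  have hpos := h.m_pos hT hH hdata
  have hTm : T ∈ Icc 0 T := ⟨hT.le, le_rfl⟩
  set s := (2 + μ) / (1 + μ) with hs
  have hconj : s.HolderConjugate (2 + μ) := by
    rw [Real.holderConjugate_iff, hs]
    refine ⟨by rw [lt_div_iff₀ (by positivity)]; linarith, ?_⟩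
    field_simp
    ring
  have sR := h.smooth_m.rpow_const hpos (β + 1)
  have sq := h.smooth_m.rpow_const hpos (1 + β * (2 + μ))
  have sf := h.smooth_m.rpow_const hpos ((β + 1) / 2)
  have sdiv := h.smooth_u.divVel hT hH
  have sHm := (h.smooth_u.ham hT hH).mul h.smooth_m
  have sWm := (h.smooth_u.dissip hT hH).mul h.smooth_m
  have sgrad : SmoothST T (fun t x => ∑ i, pd i (fun y => m t y ^ ((β + 1) / 2)) x ^ 2) := by
    simp only [pow_two]
    exact SmoothST.sum fun i => (sf.pd hT i).mul (sf.pd hT i)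
  set X := stInt d T (fun t x => m t x ^ (1 + β * (2 + μ))) with hX
  have hX0 : 0 ≤ X := stInt_nonneg sq hTm fun t ht => integral_torus_nonneg fun x =>
    Real.rpow_nonneg (hpos t (Ioo_subset_Icc_self ht) x).le _
  have hX1 : 0 < X + 1 := by linarith
  -- This balances the two Young terms: θ^(-s) = Z, and θ^(2+μ) X ≤ (X+1)^(1-1/s) = Z. The shift by
  -- 1 avoids dividing by zero.
  set θ := (X + 1) ^ (-(s * (2 + μ))⁻¹) with hθ
  have hθ0 : 0 < θ := Real.rpow_pos_of_pos hX1 _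
  set Z := (X + 1) ^ (2 + μ)⁻¹ with hZ
  have hZ1 : 1 ≤ Z := Real.one_le_rpow (by linarith) (by positivity)
  have hs0 : s ≠ 0 := hconj.ne_zero
  have t1 : θ ^ (-s) = Z := by
    rw [hθ, ← Real.rpow_mul hX1.le, hZ]
    congr 1
    field_simp
  have t2 : θ ^ (2 + μ) * X ≤ Z := by
    have : θ ^ (2 + μ) = (X + 1) ^ (-s⁻¹) := by
      rw [hθ, ← Real.rpow_mul hX1.le]
      congr 1
      field_simp
    rw [this]
    calc _ ≤ (X + 1) ^ (-s⁻¹) * (X + 1) :=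
          mul_le_mul_of_nonneg_left (by linarith) (by positivity)
      _ = (X + 1) ^ (-s⁻¹ + 1) := by rw [Real.rpow_add hX1, Real.rpow_one]
      _ = Z := by
        rw [hZ]
        congr 1
        linarith [hconj.inv_add_inv_eq_one]
  have sRHS : SmoothST T (fun t x => θ ^ (-s) * (C₃ * (ham H u t x * m t x + dissip H u t x * m t x)) +
      θ ^ (2 + μ) * m t x ^ (1 + β * (2 + μ))) :=
    (((sHm.add sWm).const_mul C₃).const_mul _).add (sq.const_mul _)
  have hpt : ∀ t ∈ Icc 0 T, ∀ x, 0 ≤ dissip H u t x ∧ m t x ^ (β + 1) * divVel H u t x ≤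
      θ ^ (-s) * (C₃ * (ham H u t x * m t x + dissip H u t x * m t x)) +
      θ ^ (2 + μ) * m t x ^ (1 + β * (2 + μ)) := by
    intro t ht x
    have hu := h.smooth_u.slice ht
    obtain ⟨w1, w2⟩ := h3 x (gradient (u t) x) (hess (u t) x) (hess_isSymm hu x)
    rw [← divVel_eq hH hu] at w2
    refine ⟨w1, (mul_rpow_le_young hconj hθ0 (hpos t ht x)).trans ?_⟩
    have w3 := mul_le_mul_of_nonneg_right w2 (hpos t ht x).le
    have w4 := mul_le_mul_of_nonneg_left w3 (Real.rpow_nonneg hθ0.le (-s))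
    simp only [ham, dissip]
    linarith
  have hmono := stInt_mono (d := d) (((sR.dt hT).add (sgrad.const_mul (4 * β / (β + 1)))))
    (sRHS.const_mul β) hτ ?_
  · rw [(sR.dt hT).stInt_add (sgrad.const_mul _) hτ, stInt_const_mul, sR.stInt_dt hT hτ,
      stInt_const_mul] at hmono
    have hle := stInt_le_of_nonneg sRHS hτ fun t ht x => by
      have h4 := (hpt t ht x).1
      have h5 := hpos t ht x
      have h6 := one_le_ham (u := u) hH t x
      positivity
    rw [(((sHm.add sWm).const_mul C₃).const_mul _).stInt_add (sq.const_mul _) hTm, stInt_const_mul,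
      stInt_const_mul, stInt_const_mul, sHm.stInt_add sWm hTm, t1] at hle
    have h4 : C₃ * (stInt d T (fun t x => ham H u t x * m t x) +
        stInt d T (fun t x => dissip H u t x * m t x)) ≤ D :=
      (mul_le_mul_of_nonneg_left (add_le_add (h1 ε u m h).1 (h2 ε u m h)) hC₃).trans
        (le_max_left _ _)
    have h5 := mul_le_mul_of_nonneg_left h4 (zero_le_one.trans hZ1)
    have h6 := mul_le_mul_of_nonneg_left (hle.trans (add_le_add h5 t2)) hβ.le
    have h7 : A ≤ A * Z := le_mul_of_one_le_right hA0 hZ1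
    simp only [h.initial] at hmono
    rw [← hA, t1] at hmono
    linarith
  · intro t ht
    have htt := Ioo_subset_Icc_self ht
    have c1 := ((sR.dt hT).slice htt).continuous
    have c2 := (sgrad.slice htt).continuous
    have c3 := (sRHS.slice htt).continuous
    have c4 := (sR.slice htt).continuous
    have c5 := (sdiv.slice htt).continuous
    rw [integral_torus_add c1 (by fun_prop),
      h.integral_dt_rpow hT hH hdata (by linarith) ht, integral_const_mul, integral_const_mul,
      add_sub_cancel_right]
    have h4 := integral_torus_mono (f := fun x => m t x ^ (β + 1) * divVel H u t x) (by fun_prop) c3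
      fun x => (hpt t htt x).2
    have h5 := mul_le_mul_of_nonneg_left h4 hβ.le
    linarith

/-- `energy_bound` controls both factors of the Gagliardo–Nirenberg inequality by powers of X+1, and
that inequality controls X in return with total power γ < 1. -/
theorem integral_rpow_bound {μ : ℝ} (hd : 2 ≤ d) (hμ0 : 0 < μ) (hT : 0 < T) (hα : 0 < α)
    (hH : IsHamiltonian H) (hL : LagrangianBound H) (hD : DerivativeBounds H)
    (hS : SuperquadraticBounds μ H) (hdata : IsData uT m0) (hη : IsMollifier η) :
    ∃ C : ℝ, 0 ≤ C ∧ ∀ ε u m, IsSolution T α H uT m0 η ε u m → ∀ t ∈ Icc 0 T,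
      ∫ x, m t x ^ (d * (1 + μ) / (d * (1 + μ) - 2)) ∂(torusMeasure d) ≤ C := by
  have hd2 : (2 : ℝ) ≤ d := by exact_mod_cast hd
  have hd0 : (0 : ℝ) < d := by linarith
  have hden : 0 < d * (1 + μ) - 2 := by nlinarith
  set β := 2 / (d * (1 + μ) - 2) with hβ
  have hβ0 : 0 < β := by positivity
  have hR : d * (1 + μ) / (d * (1 + μ) - 2) = β + 1 := by
    rw [hβ]
    field_simp
    ring
  -- This identity dictates β: it amounts to 2(β+1)/d = β(1+μ).
  have hq : 1 + β * (2 + μ) = (β + 1) / 2 * (2 + 4 / d) := by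
    rw [hβ]
    field_simp
    ring
  rw [hR]
  obtain ⟨B, hB0, hB⟩ := energy_bound hμ0 hT hα hH hL hD hS hdata hη hβ0
  obtain ⟨K, hK0, hK⟩ := gagliardo_nirenberg_torus hd
  set c := 4 * β / (β + 1) with hc
  have hc0 : 0 < c := by positivity
  set γ := (2 + μ)⁻¹ * (2 / d + 1) with hγ
  have hγ0 : 0 ≤ γ := by positivity
  -- The gap comes from 2/d + 1 ≤ 2 < 2 + μ.
  have hγ1 : γ < 1 := by
    rw [hγ, inv_mul_lt_iff₀ (by positivity)]
    have : 2 / (d : ℝ) ≤ 1 := by rw [div_le_one hd0]; exact hd2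
    linarith
  set E := K * (B ^ (2 / (d : ℝ)) * (B / c + T * B)) with hE
  have hE0 : 0 ≤ E := by positivity
  refine ⟨B * ((E + 1) ^ (1 - γ)⁻¹) ^ (2 + μ)⁻¹, by positivity, fun ε u m h => ?_⟩
  have hpos := h.m_pos hT hH hdata
  have hTm : T ∈ Icc 0 T := ⟨hT.le, le_rfl⟩
  have sq := h.smooth_m.rpow_const hpos (1 + β * (2 + μ))
  have sf := h.smooth_m.rpow_const hpos ((β + 1) / 2)
  have sgrad : SmoothST T (fun t x => ∑ i, pd i (fun y => m t y ^ ((β + 1) / 2)) x ^ 2) := by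
    simp only [pow_two]
    exact SmoothST.sum fun i => (sf.pd hT i).mul (sf.pd hT i)
  set X := stInt d T (fun t x => m t x ^ (1 + β * (2 + μ))) with hX
  have hX0 : 0 ≤ X := stInt_nonneg sq hTm fun t ht => integral_torus_nonneg fun x =>
    Real.rpow_nonneg (hpos t (Ioo_subset_Icc_self ht) x).le _
  set Z := (X + 1) ^ (2 + μ)⁻¹ with hZ
  have hX1 : 0 < X + 1 := by linarith
  have hZ0 : 0 < Z := Real.rpow_pos_of_pos hX1 _
  have hgrad0 : ∀ τ ∈ Icc 0 T,
      0 ≤ stInt d τ (fun t x => ∑ i, pd i (fun y => m t y ^ ((β + 1) / 2)) x ^ 2) := fun τ hτ =>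
    stInt_nonneg sgrad hτ fun t _ => integral_torus_nonneg fun x =>
      Finset.sum_nonneg fun i _ => sq_nonneg _
  have hsup : ∀ t ∈ Icc 0 T, ∫ x, m t x ^ (β + 1) ∂(torusMeasure d) ≤ B * Z := by
    intro t ht
    have e1 := hB ε u m h t ht
    have e2 := mul_nonneg hc0.le (hgrad0 t ht)
    linarith
  have hgrad : stInt d T (fun t x => ∑ i, pd i (fun y => m t y ^ ((β + 1) / 2)) x ^ 2) ≤
      B * Z / c := by
    have e1 := hB ε u m h T hTm
    have e2 : 0 ≤ ∫ x, m T x ^ (β + 1) ∂(torusMeasure d) :=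
      integral_torus_nonneg fun x => Real.rpow_nonneg (hpos T hTm x).le _
    rw [le_div_iff₀ hc0]
    linarith
  -- At each time the factor (∫ f²)^(2/d) is replaced by its bound uniform in time, so that only the
  -- gradient term is left to integrate.
  have hslice : ∀ t ∈ Ioo 0 T, ∫ x, m t x ^ (1 + β * (2 + μ)) ∂(torusMeasure d) ≤
      ∫ x, (K * (B * Z) ^ (2 / (d : ℝ))) *
        (∑ i, pd i (fun y => m t y ^ ((β + 1) / 2)) x ^ 2 + B * Z) ∂(torusMeasure d) := by
    intro t ht
    have htt := Ioo_subset_Icc_self ht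
    have hf := sf.slice htt
    have hgn := hK _ hf ((h.m_periodic t htt).comp fun z => z ^ ((β + 1) / 2))
      fun x => Real.rpow_nonneg (hpos t htt x).le _
    have e1 : ∀ x, (m t x ^ ((β + 1) / 2)) ^ (2 + 4 / (d : ℝ)) = m t x ^ (1 + β * (2 + μ)) := by
      intro x
      rw [← Real.rpow_mul (hpos t htt x).le, hq]
    have e2 : ∀ x, (m t x ^ ((β + 1) / 2)) ^ 2 = m t x ^ (β + 1) := by
      intro x
      rw [← Real.rpow_natCast, ← Real.rpow_mul (hpos t htt x).le]
      congr 1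
      push_cast
      ring
    have c1 := (sgrad.slice htt).continuous
    have c2 := ((h.smooth_m.rpow_const hpos (β + 1)).slice htt).continuous
    simp only [e1, e2] at hgn
    rw [integral_torus_add c1 c2] at hgn
    rw [integral_const_mul, integral_torus_add c1 (by fun_prop)]
    have n1 : 0 ≤ ∫ x, m t x ^ (β + 1) ∂(torusMeasure d) :=
      integral_torus_nonneg fun x => Real.rpow_nonneg (hpos t htt x).le _
    have n2 : 0 ≤ ∫ x, ∑ i, pd i (fun y => m t y ^ ((β + 1) / 2)) x ^ 2 ∂(torusMeasure d) :=
      integral_torus_nonneg fun x => Finset.sum_nonneg fun i _ => sq_nonneg _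
    have e3 := hsup t htt
    refine hgn.trans ?_
    rw [mul_assoc]
    refine mul_le_mul_of_nonneg_left (mul_le_mul (Real.rpow_le_rpow n1 e3 (by positivity)) ?_
      (by positivity) (by positivity)) hK0
    simpa using e3
  have sBZ : SmoothST (d := d) T (fun _ _ => B * Z) := SmoothST.space contDiff_const
  have hXle := stInt_mono (d := d) sq ((sgrad.add sBZ).const_mul (K * (B * Z) ^ (2 / (d : ℝ)))) hTm
    hslice
  rw [stInt_const_mul, sgrad.stInt_add sBZ hTm, stInt_const] at hXle
  have hfin : X ≤ E * (X + 1) ^ γ := by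
    calc X ≤ _ := hXle
      _ ≤ K * (B * Z) ^ (2 / (d : ℝ)) * (B * Z / c + T * (B * Z)) :=
        mul_le_mul_of_nonneg_left (by linarith) (by positivity)
      _ = E * (Z ^ (2 / (d : ℝ)) * Z) := by
        rw [Real.mul_rpow hB0 hZ0.le, hE]
        field_simp
      _ = E * (X + 1) ^ γ := by
        rw [← Real.rpow_add_one hZ0.ne', hZ, ← Real.rpow_mul hX1.le]
  have hbound := add_one_le_of_le_mul_rpow hX0 hγ0 hγ1 hfin
  intro t ht
  exact (hsup t ht).trans (mul_le_mul_of_nonneg_left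
    (Real.rpow_le_rpow hX1.le hbound (by positivity)) hB0)

end Density

end MFG

/-! ### From the endpoint exponent to the stated range. -/

theorem mainTheorem6 (d : ℕ) (hd : 2 ≤ d) (T μ α : ℝ) (hT : 0 < T) (hμ0 : 0 < μ) (hμ1 : μ < 1)
    (hα : 0 < α)
    (H : MFG.Sp d → MFG.Sp d → ℝ) (hH : MFG.IsHamiltonian H) (hL : MFG.LagrangianBound H)
    (hD : MFG.DerivativeBounds H) (hS : MFG.SuperquadraticBounds μ H)
    (uT m0 : MFG.Sp d → ℝ) (hdata : MFG.IsData uT m0)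
    (η : MFG.Sp d → ℝ) (hη : MFG.IsMollifier η)
    (r : ℝ) (hr1 : 1 ≤ r) (hr2 : r < (d * (1 + μ)) / (d * (1 + μ) - 2)) :
    ∃ C : ℝ, ∀ ε : ℝ, 0 ≤ ε → ∀ u m : ℝ → MFG.Sp d → ℝ,
      MFG.IsSolution T α H uT m0 η ε u m →
      ∀ t ∈ Set.Icc 0 T,
        MeasureTheory.eLpNorm (m t) (ENNReal.ofReal r) (MFG.torusMeasure d) ≤ ENNReal.ofReal C := by
  obtain ⟨C, -, hC⟩ := MFG.integral_rpow_bound hd hμ0 hT hα hH hL hD hS hdata hη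
  set R := (d * (1 + μ)) / (d * (1 + μ) - 2) with hR
  have hR0 : 0 < R := by linarith
  refine ⟨C ^ R⁻¹, fun ε _ u m h t ht => ?_⟩
  have hm := h.smooth_m.slice ht
  have hpos := h.m_pos hT hH hdata t ht
  have e0 : ENNReal.ofReal R ≠ 0 := by simpa using hR0
  have hmem : MemLp (m t) (ENNReal.ofReal R) (MFG.torusMeasure d) := by
    obtain ⟨B, -, hB⟩ := (h.m_periodic t ht).bounded hm.continuous
    exact MemLp.of_bound hm.continuous.aestronglyMeasurable B (ae_of_all _ hB)
  -- On a probability space L^r norms increase with r, so the bound at R suffices with no loss in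
  -- the constant.
  refine (eLpNorm_le_eLpNorm_of_exponent_le (ENNReal.ofReal_le_ofReal hr2.le)
    hm.continuous.aestronglyMeasurable).trans ?_
  rw [hmem.eLpNorm_eq_integral_rpow_norm e0 ENNReal.ofReal_ne_top,
    ENNReal.toReal_ofReal hR0.le]
  have e1 : ∀ x, ‖m t x‖ = m t x := fun x => Real.norm_of_nonneg (hpos x).le
  simp only [e1]
  exact ENNReal.ofReal_le_ofReal (Real.rpow_le_rpow
    (MFG.integral_torus_nonneg fun x => Real.rpow_nonneg (hpos x).le _) (hC ε u m h t ht)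
    (by positivity))
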